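/- Let $n>1$, $d\ge 1$ and $k\geq 1$ be integers, and let $\pi\colon \mathfrak X\to |\mathcal O(d)|$ be the universal family of hypersurfaces of degree $d$ in $\mathbb P^n=\mathbb P^n_{\mathbb C}$, where $\mathfrak X\subseteq \mathbb P^n\times|\mathcal O(d)|$ is the closed subscheme with equation $\sum_{|I|=d}\alpha_I x^I=0$. Let $\mathcal L$ be the pull-back of $\mathcal O(1)$ along $\mathfrak X\to\mathbb P^n$, and let $V_k=\pi_*(\mathcal L^{\otimes k})$ be the $k$-th Verlinde bundle. It is a vector bundle of rank $r^{(k)}=\binom{k+n}{n}-\binom{k+n-d}{n}$ and degree $d^{(k)}=\binom{k+n-d}{n}$, where $\binom{k+n-d}{n}$ is read as $0$ if $k<d$. Assume that $d^{(k)}\leq r^{(k)}$. Let $f_1,f_2\in H^0(\mathbb P^n,\mathcal O(d))$ be linearly independent forms of degree $d$, let $T\subseteq|\mathcal O(d)|$ be the line which they span, identified with $\mathbb P^1$ by $(s:t)\mapsto sf_1+tf_2$, and let $V_{k,T}=V_k|_T$. Then $V_{k,T}$ has the generic splitting type, that is, $$V_{k,T}\;\simeq\;\mathcal O(1)^{\oplus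 d^{(k)}}\oplus\mathcal O^{\oplus (r^{(k)}-d^{(k)})},$$ if and only if the family of products $f_1\theta,\ f_2\theta$, where $\theta$ runs over the monomials of degree $k-d$ in $x_0,\dots,x_n$ (there are none if $k<d$), is linearly independent in $H^0(\mathbb P^n,\mathcal O(k))$. -/

import Mathlib

open CategoryTheory AlgebraicGeometry TopologicalSpace Limits Opposite

noncomputable section

namespace Verlinde

universe u

attribute [local instance] MvPolynomial.gradedAlgebra Abelian.hasFiniteBiproducts

/-! ## Line bundles from transition functions -/

section Cocycle

variable {X : Scheme.{u}} {ι : Type u}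

/-- Restriction of functions from an open subset to a smaller one. -/
abbrev res {V W : X.Opens} (h : V ≤ W) : Γ(X, W) →+* Γ(X, V) :=
  (X.presheaf.map (homOfLE h).op).hom

theorem res_res {V W Z : X.Opens} (h : V ≤ W) (h' : W ≤ Z) (a : Γ(X, Z)) :
    res h (res h' a) = res (h.trans h') a := by
  simp only [res]
  rw [← CommRingCat.comp_apply, ← Functor.map_comp]
  rfl

theorem res_self {V : X.Opens} (h : V ≤ V) (a : Γ(X, V)) : res h a = a := by
  simp [res]

theorem res_glue {κ : Type u} (V : X.Opens) (W : κ → X.Opens) (hW : ∀ k, W k ≤ V)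
    (hV : V ≤ iSup W) (s : ∀ k, Γ(X, W k))
    (hs : ∀ k l, res (inf_le_left : W k ⊓ W l ≤ W k) (s k) =
      res (inf_le_right : W k ⊓ W l ≤ W l) (s l)) :
    ∃! t : Γ(X, V), ∀ k, res (hW k) t = s k :=
  TopCat.Sheaf.existsUnique_gluing' X.sheaf W V (fun k ↦ homOfLE (hW k)) hV s hs

variable (U : ι → X.Opens) (g : ∀ i j, Γ(X, U i ⊓ U j))

/-- The sections over `V` of the line bundle which is trivial on the `U i` and has the transition
functions `g i j`: families of functions `a i` on `V ⊓ U i` with `a i = g i j * a j` on the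
overlaps. -/
def cocycleSections (V : X.Opens) : AddSubgroup (∀ i, Γ(X, V ⊓ U i)) where
  carrier := {a | ∀ i j,
    res (inf_le_inf_left V (inf_le_left : U i ⊓ U j ≤ U i)) (a i) =
      res (inf_le_right : V ⊓ (U i ⊓ U j) ≤ U i ⊓ U j) (g i j) *
        res (inf_le_inf_left V (inf_le_right : U i ⊓ U j ≤ U j)) (a j)}
  zero_mem' := by intro i j; simp
  add_mem' := by
    intro a b ha hb i j
    simp only [Pi.add_apply, map_add, ha i j, hb i j, mul_add]
  neg_mem' := by
    intro a ha i j
    simp only [Pi.neg_apply, map_neg, ha i j, mul_neg]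

instance (V : X.Opens) : Module Γ(X, V) (cocycleSections U g V) where
  smul r a := ⟨fun i ↦ res inf_le_left r * a.1 i, by
    intro i j
    simp only [map_mul, res_res, a.2 i j]
    ring⟩
  one_smul a := Subtype.ext (funext fun i ↦ by
    change res inf_le_left 1 * a.1 i = a.1 i
    rw [map_one, one_mul])
  mul_smul r s a := Subtype.ext (funext fun i ↦ by
    change res inf_le_left (r * s) * a.1 i = res inf_le_left r * (res inf_le_left s * a.1 i)
    rw [map_mul, mul_assoc])
  smul_zero r := Subtype.ext (funext fun i ↦ by
    change res inf_le_left r * 0 = 0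
    rw [mul_zero])
  smul_add r a b := Subtype.ext (funext fun i ↦ by
    change res inf_le_left r * (a.1 i + b.1 i) =
      res inf_le_left r * a.1 i + res inf_le_left r * b.1 i
    rw [mul_add])
  add_smul r s a := Subtype.ext (funext fun i ↦ by
    change res inf_le_left (r + s) * a.1 i =
      res inf_le_left r * a.1 i + res inf_le_left s * a.1 i
    rw [map_add, add_mul])
  zero_smul a := Subtype.ext (funext fun i ↦ by
    change res inf_le_left 0 * a.1 i = 0
    rw [map_zero, zero_mul])

theorem cocycleSections_smul_apply (V : X.Opens) (r : Γ(X, V)) (a : cocycleSections U g V) (i : ι) :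
    (r • a).1 i = res inf_le_left r * a.1 i := rfl

/-- Restriction of sections of the line bundle. -/
def cocycleRes {V W : X.Opens} (h : V ≤ W) : cocycleSections U g W →+ cocycleSections U g V where
  toFun a := ⟨fun i ↦ res (inf_le_inf_right (U i) h) (a.1 i), by
    intro i j
    have := congrArg (res (inf_le_inf_right (U i ⊓ U j) h)) (a.2 i j)
    simpa only [map_mul, res_res] using this⟩
  map_zero' := Subtype.ext (funext fun i ↦ map_zero _)
  map_add' a b := Subtype.ext (funext fun i ↦ map_add _ _ _)

theorem cocycleRes_smul {V W : X.Opens} (h : V ≤ W) (r : Γ(X, W)) (a : cocycleSections U g W) :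
    cocycleRes U g h (r • a) = res h r • cocycleRes U g h a := by
  refine Subtype.ext (funext fun i ↦ ?_)
  change res _ (res _ r * a.1 i) = res _ (res _ r) * res _ (a.1 i)
  rw [map_mul, res_res, res_res]

/-- The presheaf of abelian groups underlying the line bundle. -/
def cocyclePresheaf : TopCat.Presheaf AddCommGrpCat.{u} X where
  obj V := AddCommGrpCat.of (cocycleSections U g V.unop)
  map f := AddCommGrpCat.ofHom (cocycleRes U g f.unop.le)
  map_id V := by
    refine AddCommGrpCat.hom_ext (AddMonoidHom.ext fun (a : cocycleSections U g V.unop) ↦ ?_)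
    exact Subtype.ext (funext fun i ↦ res_self _ (a.1 i))
  map_comp {V _ _} f f' := by
    refine AddCommGrpCat.hom_ext (AddMonoidHom.ext fun (a : cocycleSections U g V.unop) ↦ ?_)
    exact Subtype.ext (funext fun i ↦ (res_res _ _ (a.1 i)).symm)

theorem cocyclePresheaf_isSheaf : (cocyclePresheaf U g).IsSheaf := by
  rw [TopCat.Presheaf.isSheaf_iff_isSheafUniqueGluing]
  intro κ W (sf : ∀ k, cocycleSections U g (W k)) hsf
  have hcompat (k l : κ) : cocycleRes U g (inf_le_left : W k ⊓ W l ≤ W k) (sf k) =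
      cocycleRes U g (inf_le_right : W k ⊓ W l ≤ W l) (sf l) := hsf k l
  have hglue (i : ι) : ∃! t : Γ(X, iSup W ⊓ U i), ∀ k,
      res (inf_le_inf_right (U i) (le_iSup W k)) t = (sf k).1 i := by
    refine res_glue _ (fun k ↦ W k ⊓ U i) _ (by rw [iSup_inf_eq]) _ fun k l ↦ ?_
    have h := congrFun (congrArg Subtype.val (hcompat k l)) i
    have h' := congrArg (res (le_inf (le_inf (inf_le_left.trans inf_le_left)
      (inf_le_right.trans inf_le_left)) (inf_le_left.trans inf_le_right) :
        (W k ⊓ U i) ⊓ (W l ⊓ U i) ≤ (W k ⊓ W l) ⊓ U i)) h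
    change res _ (res _ ((sf k).1 i)) = res _ (res _ ((sf l).1 i)) at h'
    rwa [res_res, res_res] at h'
  choose t ht htu using hglue
  have hmem : t ∈ cocycleSections U g (iSup W) := by
    intro i j
    obtain ⟨_, -, hu⟩ := res_glue (iSup W ⊓ (U i ⊓ U j)) (fun k ↦ W k ⊓ (U i ⊓ U j))
      (fun k ↦ inf_le_inf_right _ (le_iSup W k)) (by rw [iSup_inf_eq])
      (fun k ↦ res (inf_le_inf_left (W k) (inf_le_left : U i ⊓ U j ≤ U i)) ((sf k).1 i)) (by
        intro k l
        simp only [← ht, res_res])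
    refine (hu _ fun k ↦ ?_).trans (hu _ fun k ↦ ?_).symm
    · simp only [← ht, res_res]
    · rw [(sf k).2 i j]
      simp only [← ht, res_res, map_mul]
  refine ⟨(⟨t, hmem⟩ : cocycleSections U g (iSup W)), fun k ↦ ?_, fun s hs ↦ ?_⟩
  · exact Subtype.ext (funext fun i ↦ ht i k)
  · change cocycleSections U g (iSup W) at s
    refine Subtype.ext (funext fun i ↦ htu i _ fun k ↦ ?_)
    exact congrFun (congrArg Subtype.val (hs k)) i

instance (V : (Opens X)ᵒᵖ) :
    Module (X.ringCatSheaf.obj.obj V) ((cocyclePresheaf U g).obj V) :=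
  inferInstanceAs (Module Γ(X, V.unop) (cocycleSections U g V.unop))

/-- The `𝒪_X`-module which is trivialized on the open subsets `U i`, glued along the transition
functions `g i j`. (It is a line bundle as soon as the `U i` cover `X` and the `g i j` are
invertible and satisfy the cocycle condition.) -/
def ofCocycle : X.Modules where
  val := PresheafOfModules.ofPresheaf (R := X.ringCatSheaf.obj) (cocyclePresheaf U g) 
    fun _ _ f r a ↦ cocycleRes_smul U g f.unop.le r a
  isSheaf := cocyclePresheaf_isSheaf U g

end Cocycle

/-! ## Projective spaces and the sheaves `𝒪(m)` -/

section ProjectiveSpace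

variable {σ τ : Type}

/-- The projective space over `ℂ` with homogeneous coordinates indexed by `σ`. -/
abbrev PP (σ : Type) : Scheme.{0} := Proj (MvPolynomial.homogeneousSubmodule σ ℂ)

/-- The structure morphism of projective space. -/
def toSpecC (σ : Type) : PP σ ⟶ Spec (CommRingCat.of ℂ) :=
  Proj.toSpecZero (MvPolynomial.homogeneousSubmodule σ ℂ) ≫
    Spec.map (CommRingCat.ofHom (algebraMap ℂ (MvPolynomial.homogeneousSubmodule σ ℂ 0)))

/-- The standard affine chart `x_i ≠ 0`. -/
def chart (i : σ) : (PP σ).Opens :=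
  Proj.basicOpen (MvPolynomial.homogeneousSubmodule σ ℂ) (MvPolynomial.X i)

/-- The function `x_j / x_i` on the chart `x_i ≠ 0`. -/
def ratio (i j : σ) : Γ(PP σ, chart i) :=
  Proj.awayToSection (MvPolynomial.homogeneousSubmodule σ ℂ) (MvPolynomial.X i)
    (HomogeneousLocalization.Away.mk (MvPolynomial.homogeneousSubmodule σ ℂ)
      (MvPolynomial.isHomogeneous_X ℂ i) 1 (MvPolynomial.X j) (MvPolynomial.isHomogeneous_X ℂ j))

/-- The transition function `(x_j / x_i) ^ m` of `𝒪(m)`, where `m` may be negative; at least one of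
the two factors is `1`. A form `s` of degree `m` has the local coordinates `a i = s / x_i ^ m`, for
which `a i = (x_j / x_i) ^ m * a j`. -/
def transition (m : ℤ) (i j : σ) : Γ(PP σ, chart i ⊓ chart j) :=
  res inf_le_left (ratio i j) ^ m.toNat * res inf_le_right (ratio j i) ^ (-m).toNat

/-- The line bundle `q^* 𝒪(m)` on `X`, for a morphism `q` from `X` to a projective space: it is
trivial on the preimages of the standard charts, and its transition functions are the pull-backs of
those of `𝒪(m)`. -/
def twist {X : Scheme.{0}} (q : X ⟶ PP σ) (m : ℤ) : X.Modules :=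
  ofCocycle (fun i ↦ q ⁻¹ᵁ chart i) (fun i j ↦ q.app (chart i ⊓ chart j) (transition m i j))

/-- The line bundle `𝒪(m)` on projective space. -/
def OO (σ : Type) (m : ℤ) : (PP σ).Modules := twist (𝟙 (PP σ)) m

/-- The homomorphism `y_J ↦ ∑ i, v i J * x_i` of homogeneous coordinate rings. -/
def coordHom [Fintype σ] (v : σ → τ → ℂ) :
    GradedRingHom (MvPolynomial.homogeneousSubmodule τ ℂ)
      (MvPolynomial.homogeneousSubmodule σ ℂ) where
  __ := (MvPolynomial.aeval (R := ℂ) fun J : τ ↦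
    ∑ i, MvPolynomial.C (v i J) * (MvPolynomial.X i : MvPolynomial σ ℂ)).toRingHom
  map_mem {m p} hp := by
    have := MvPolynomial.IsHomogeneous.aeval (R := ℂ) (n := 1) hp
      (fun J : τ ↦ ∑ i, MvPolynomial.C (v i J) * (MvPolynomial.X i : MvPolynomial σ ℂ))
      (fun J ↦ MvPolynomial.IsHomogeneous.sum _ _ _ fun i _ ↦
        MvPolynomial.isHomogeneous_C_mul_X _ _)
    rwa [one_mul] at this

theorem coordHom_X [Fintype σ] (v : σ → τ → ℂ) (J : τ) :
    coordHom v (MvPolynomial.X J) =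
      ∑ i, MvPolynomial.C (v i J) * (MvPolynomial.X i : MvPolynomial σ ℂ) :=
  MvPolynomial.aeval_X _ J

theorem coordHom_C [Fintype σ] (v : σ → τ → ℂ) (c : ℂ) :
    coordHom v (MvPolynomial.C c) = (MvPolynomial.C c : MvPolynomial σ ℂ) :=
  MvPolynomial.aeval_C _ c

theorem irrelevant_le_map_coordHom [Fintype σ] [Fintype τ] (v : σ → τ → ℂ)
    (hv : LinearIndependent ℂ v) :
    HomogeneousIdeal.irrelevant (MvPolynomial.homogeneousSubmodule σ ℂ) ≤
      (HomogeneousIdeal.irrelevant (MvPolynomial.homogeneousSubmodule τ ℂ)).map (coordHom v) := by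
  classical
  have hX (i : σ) : (MvPolynomial.X i : MvPolynomial σ ℂ) ∈
      (HomogeneousIdeal.irrelevant (MvPolynomial.homogeneousSubmodule τ ℂ)).toIdeal.map
        (coordHom v) := by
    obtain ⟨g, hg⟩ := LinearMap.exists_extend (Finsupp.lapply i ∘ₗ hv.repr)
    have hgv (k : σ) : g (v k) = if k = i then 1 else 0 := by
      have h := LinearMap.congr_fun hg
        (⟨v k, Submodule.subset_span ⟨k, rfl⟩⟩ : Submodule.span ℂ (Set.range v))
      simpa [hv.repr_eq_single k, Finsupp.single_apply] using h
    have hhom : (∑ J : τ, MvPolynomial.C (g (Pi.single J 1)) * MvPolynomial.X J :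
        MvPolynomial τ ℂ) ∈ MvPolynomial.homogeneousSubmodule τ ℂ 1 :=
      MvPolynomial.IsHomogeneous.sum _ _ _ fun J _ ↦ MvPolynomial.isHomogeneous_C_mul_X _ _
    have hmem : (∑ J : τ, MvPolynomial.C (g (Pi.single J 1)) * MvPolynomial.X J :
        MvPolynomial τ ℂ) ∈
        HomogeneousIdeal.irrelevant (MvPolynomial.homogeneousSubmodule τ ℂ) :=
      HomogeneousIdeal.mem_irrelevant_of_mem _ Nat.one_pos hhom
    have h := Ideal.mem_map_of_mem (coordHom v) hmem
    convert h using 1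
    simp only [map_sum, map_mul, coordHom_X, coordHom_C, Finset.mul_sum]
    rw [Finset.sum_comm]
    have (k : σ) : ∑ J : τ, (MvPolynomial.C (g (Pi.single J 1)) *
        (MvPolynomial.C (v k J) * MvPolynomial.X k) : MvPolynomial σ ℂ) =
        MvPolynomial.C (if k = i then 1 else 0) * MvPolynomial.X k := by
      rw [← hgv k, LinearMap.pi_apply_eq_sum_univ g (v k), map_sum, Finset.sum_mul]
      refine Finset.sum_congr rfl fun J _ ↦ ?_
      have hs : (fun j ↦ if J = j then (1 : ℂ) else 0) = Pi.single J 1 := by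
        ext j
        simp [Pi.single_apply, eq_comm]
      rw [hs, smul_eq_mul, map_mul]
      ring
    simp [this]
  change (HomogeneousIdeal.irrelevant (MvPolynomial.homogeneousSubmodule σ ℂ)).toIdeal ≤
    (HomogeneousIdeal.irrelevant (MvPolynomial.homogeneousSubmodule τ ℂ)).toIdeal.map (coordHom v)
  rw [HomogeneousIdeal.toIdeal_irrelevant_le]
  intro m hm p (hp : p.IsHomogeneous m)
  have hspan : p ∈ Ideal.span (MvPolynomial.X '' (Set.univ : Set σ) : Set (MvPolynomial σ ℂ)) := by
    rw [MvPolynomial.mem_ideal_span_X_image]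
    intro e he
    by_contra! h
    have h0 : e = 0 := Finsupp.ext fun i ↦ h i trivial
    have := hp (MvPolynomial.mem_support_iff.mp he)
    simp [h0] at this
    omega
  refine Ideal.span_le.mpr ?_ hspan
  rintro _ ⟨i, -, rfl⟩
  exact hX i

/-- The linear embedding of projective spaces `(x_i)_i ↦ ∑ i, x_i • v i` whose image is the linear
subspace spanned by the points `v i`. -/
def linearEmbedding [Fintype σ] [Fintype τ] (v : σ → τ → ℂ) (hv : LinearIndependent ℂ v) :
    PP σ ⟶ PP τ :=
  Proj.map (coordHom v) (irrelevant_le_map_coordHom v hv)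

end ProjectiveSpace

/-! ## The universal hypersurface and the Verlinde bundles -/

section Universal

variable (n d : ℕ)

/-- The exponents `I` of the monomials `x ^ I` of degree `d` in `n + 1` variables. -/
abbrev Exponent : Type := ↥(Finset.finsuppAntidiag (Finset.univ : Finset (Fin (n + 1))) d)

/-- The projective space `ℙⁿ`. -/
abbrev Pn : Scheme.{0} := PP (Fin (n + 1))

/-- The linear system `|𝒪(d)|` of hypersurfaces of degree `d` in `ℙⁿ`. Its homogeneous coordinates
`α_I` are the coefficients of the equation `∑ I, α_I x ^ I` of the hypersurface. -/
abbrev LinSys : Scheme.{0} := PP (Exponent n d)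

/-- The product `ℙⁿ × |𝒪(d)|` over `ℂ`. -/
abbrev Ambient : Scheme.{0} := pullback (toSpecC (Fin (n + 1))) (toSpecC (Exponent n d))

/-- The projection `ℙⁿ × |𝒪(d)| ⟶ ℙⁿ`. -/
abbrev prPn : Ambient n d ⟶ Pn n := pullback.fst _ _

/-- The projection `ℙⁿ × |𝒪(d)| ⟶ |𝒪(d)|`. -/
abbrev prLinSys : Ambient n d ⟶ LinSys n d := pullback.snd _ _

variable {n d} in
/-- The chart `x_i ≠ 0`, `α_J ≠ 0` of `ℙⁿ × |𝒪(d)|`. -/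
def ambientChart (i : Fin (n + 1)) (J : Exponent n d) : (Ambient n d).Opens :=
  prPn n d ⁻¹ᵁ chart i ⊓ prLinSys n d ⁻¹ᵁ chart J

variable {n d} in
/-- The equation `(∑ I, α_I x ^ I) / (α_J x_i ^ d)` of the universal hypersurface on the chart
`x_i ≠ 0`, `α_J ≠ 0`. -/
def localEquation (i : Fin (n + 1)) (J : Exponent n d) : Γ(Ambient n d, ambientChart i J) :=
  ∑ I : Exponent n d,
    res inf_le_right ((prLinSys n d).app (chart J) (ratio J I)) *
      ∏ l, res inf_le_left ((prPn n d).app (chart i) (ratio i l)) ^ I.1 l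

/-- The ideal sheaf of the universal hypersurface: the functions which on each chart
`x_i ≠ 0`, `α_J ≠ 0` are multiples of the local equation. -/
def universalIdeal : (Ambient n d).IdealSheafData :=
  Scheme.IdealSheafData.ofIdeals fun W ↦ ⨅ (i : Fin (n + 1)) (J : Exponent n d),
    (Ideal.span {res (inf_le_right : W.1 ⊓ ambientChart i J ≤ ambientChart i J)
      (localEquation i J)}).comap (res (inf_le_left : W.1 ⊓ ambientChart i J ≤ W.1))

/-- The universal hypersurface `𝔛` of degree `d` in `ℙⁿ`. -/
abbrev Universal : Scheme.{0} := (universalIdeal n d).subscheme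

/-- The universal family `π : 𝔛 ⟶ |𝒪(d)|` of hypersurfaces of degree `d`. -/
def family : Universal n d ⟶ LinSys n d := (universalIdeal n d).subschemeι ≫ prLinSys n d

/-- The projection `𝔛 ⟶ ℙⁿ`. -/
def toPn : Universal n d ⟶ Pn n := (universalIdeal n d).subschemeι ≫ prPn n d

/-- The power `ℒ^{⊗ k}` of the polarization `ℒ` of the universal family, the pull-back of `𝒪(1)`
along `𝔛 ⟶ ℙⁿ`. -/
def polarization (k : ℕ) : (Universal n d).Modules := twist (toPn n d) k

/-- The `k`-th Verlinde bundle `V_k = π_* ℒ^{⊗ k}` of the universal family. -/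
def verlindeBundle (k : ℕ) : (LinSys n d).Modules :=
  (Scheme.Modules.pushforward (family n d)).obj (polarization n d k)

/-- The rank `r^{(k)}` of `V_k`. -/
def verlindeRank (k : ℕ) : ℕ := (k + n).choose n - (k + n - d).choose n

/-- The degree `d^{(k)}` of `V_k`. For `k < d` the binomial coefficient is `0`, also where the
subtraction truncates, as long as `n` is positive. -/
def verlindeDegree (k : ℕ) : ℕ := (k + n - d).choose n

variable {n d} in
/-- The coordinates of a form of degree `d` as a point of `|𝒪(d)|`. -/
def coeffs (f : MvPolynomial (Fin (n + 1)) ℂ) (I : Exponent n d) : ℂ := f.coeff I.1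

variable {n d} in
theorem linearIndependent_coeffs {f : Fin 2 → MvPolynomial (Fin (n + 1)) ℂ}
    (hf : ∀ i, (f i).IsHomogeneous d) (hli : LinearIndependent ℂ f) :
    LinearIndependent ℂ fun i ↦ coeffs (d := d) (f i) := by
  rw [Fintype.linearIndependent_iff] at hli ⊢
  intro c hc
  refine hli c (MvPolynomial.ext _ _ fun m ↦ ?_)
  rw [MvPolynomial.coeff_sum, MvPolynomial.coeff_zero]
  simp only [MvPolynomial.coeff_smul]
  by_cases hm : m ∈ Finset.finsuppAntidiag (Finset.univ : Finset (Fin (n + 1))) d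
  · simpa [coeffs] using congrFun hc ⟨m, hm⟩
  · refine Finset.sum_eq_zero fun i _ ↦ ?_
    rw [(hf i).coeff_eq_zero, smul_zero]
    intro h
    rw [Finsupp.degree_eq_sum] at h
    exact hm (by simp [Finset.mem_finsuppAntidiag, h])

variable {n d} in
/-- The line `T = ℙ¹ ⟶ |𝒪(d)|`, `(s : t) ↦ s f₁ + t f₂`, spanned by two linearly independent forms
of degree `d`. -/
def line {f : Fin 2 → MvPolynomial (Fin (n + 1)) ℂ}
    (hf : ∀ i, (f i).IsHomogeneous d) (hli : LinearIndependent ℂ f) :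
    PP (Fin 2) ⟶ LinSys n d :=
  linearEmbedding (fun i ↦ coeffs (f i)) (linearIndependent_coeffs hf hli)

variable {n d} in
/-- The restriction `V_{k,T}` of the Verlinde bundle to the line `T` spanned by `f₁` and `f₂`. -/
def verlindeOnLine (k : ℕ) {f : Fin 2 → MvPolynomial (Fin (n + 1)) ℂ}
    (hf : ∀ i, (f i).IsHomogeneous d) (hli : LinearIndependent ℂ f) : (PP (Fin 2)).Modules :=
  (Scheme.Modules.pullback (line hf hli)).obj (verlindeBundle n d k)

end Universal

/-! ## Splitting types -/

/-- The `𝒪_{ℙ¹}`-module `M` has the splitting type `b`: the tuple `b` is non-increasing and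
`M ≅ ⨁ i, 𝒪(b i)`. -/
def HasSplittingType {r : ℕ} (M : (PP (Fin 2)).Modules) (b : Fin r → ℤ) : Prop :=
  Antitone b ∧ Nonempty (M ≅ ⨁ fun i ↦ OO (Fin 2) (b i))

/-- The tuple `(1, …, 1, 0, …, 0)` of size `r` with `δ` entries equal to `1`. -/
def genericType (r δ : ℕ) : Fin r → ℤ := fun i ↦ if (i : ℕ) < δ then 1 else 0

end Verlinde

end

open CategoryTheory AlgebraicGeometry TopologicalSpace Limits Opposite

noncomputable section

namespace Verlinde

universe u

attribute [local instance] MvPolynomial.gradedAlgebra Abelian.hasFiniteBiproducts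

/-! The Verlinde bundle has a presentation by forms. Multiplication by the universal equation gives
the exact sequence `0 → 𝒪(k - d) ⊠ 𝒪(-1) → 𝒪(k) ⊠ 𝒪 → ℒ^k → 0` on the product of `ℙⁿ` and `|𝒪(d)|`.
As `n ≥ 2`, the group `H¹(ℙⁿ, 𝒪(k - d))` vanishes, so `V_k` is generated by the monomials of degree
`k`, and its relations are generated by the equations `∑ I, α_I x^(θ + I) = 0`, with `θ` a monomial
of degree `k - d`. The generators are found in `generates_verlindeSection`, the relations in
`exists_eq_equation_mul`. In place of an exact sequence, the proof uses the universal property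
`exists_hom_of_satisfiesRelations`: homomorphisms out of `V_k` are families of sections satisfying
these relations. The cohomology is computed by hand with Laurent polynomials over the functions on a
small affine open subset of `|𝒪(d)|`.

Pull-back is left adjoint to push-forward, so the universal property passes to the line `T`: by
`exists_hom_of_satisfiesLineRelations`, `V_{k,T}` is generated by the monomials with the relations
`s f₁θ + t f₂θ = 0`. On the other hand `𝒪(1)` on `ℙ¹` is generated by two sections with the single
relation `s y₁ + t y₂ = 0` (`exists_hom_OO_one`).

If the products `f_i θ` are independent, extend them to a basis of the forms of degree `k`. Each
pair `f₁θ, f₂θ` then presents a copy of `𝒪(1)`, and each additional basis vector a copy of `𝒪`; this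
is `nonempty_iso_of_linearIndependent`.

Conversely, a functional on the forms of degree `k` that kills all products induces a homomorphism
`V_{k,T} → 𝒪`. For the generic splitting type, `Hom(𝒪(1), 𝒪) = 0` and `H⁰(𝒪) = ℂ` bound the
dimension of the space of these functionals by `r - d`, writing `r` and `d` for the rank and the
degree of `V_k` (`finrank_ker_le_of_iso`). Since the forms of degree `k` have dimension `r + d`, the
products span at least `2d` dimensions. There are `2d` of them, so they are independent. -/

/-! ## Sections of sheaves of modules -/

section Modules

variable {X : Scheme.{u}}

/-- Restriction of sections of a sheaf of modules. -/
abbrev mres (M : X.Modules) {V W : X.Opens} (h : V ≤ W) : Γ(M, W) →+ Γ(M, V) :=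
  (M.presheaf.map (homOfLE h).op).hom

variable {M N : X.Modules}

theorem mres_mres {V W Z : X.Opens} (h : V ≤ W) (h' : W ≤ Z) (a : Γ(M, Z)) :
    mres M h (mres M h' a) = mres M (h.trans h') a := by
  simp only [mres]
  rw [← AddCommGrpCat.comp_apply, ← Functor.map_comp]
  rfl

theorem mres_self {V : X.Opens} (h : V ≤ V) (a : Γ(M, V)) : mres M h a = a := by
  change (M.presheaf.map (𝟙 _)) a = a
  rw [CategoryTheory.Functor.map_id]
  rfl

theorem mres_smul {V W : X.Opens} (h : V ≤ W) (r : Γ(X, W)) (a : Γ(M, W)) :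
    mres M h (r • a) = res h r • mres M h a :=
  Scheme.Modules.map_smul M (homOfLE h) r a

theorem app_mres (φ : M ⟶ N) {V W : X.Opens} (h : V ≤ W) (a : Γ(M, W)) :
    φ.app V (mres M h a) = mres N h (φ.app W a) :=
  ConcreteCategory.congr_hom (φ.mapPresheaf.naturality (homOfLE h).op) a

theorem mres_glue {κ : Type u} (V : X.Opens) (W : κ → X.Opens) (hW : ∀ k, W k ≤ V)
    (hV : V ≤ iSup W) (s : ∀ k, Γ(M, W k))
    (hs : ∀ k l, mres M (inf_le_left : W k ⊓ W l ≤ W k) (s k) =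
      mres M (inf_le_right : W k ⊓ W l ≤ W l) (s l)) :
    ∃! t : Γ(M, V), ∀ k, mres M (hW k) t = s k :=
  TopCat.Sheaf.existsUnique_gluing' ⟨M.presheaf, M.isSheaf⟩ W V (fun k ↦ homOfLE (hW k)) hV s hs

/-- Sections that agree locally are equal. -/
theorem mres_ext {V : X.Opens} {a b : Γ(M, V)}
    (h : ∀ x ∈ V, ∃ (W : X.Opens) (hW : W ≤ V), x ∈ W ∧ mres M hW a = mres M hW b) : a = b := by
  choose W hW hx he using h
  obtain ⟨t, -, ht⟩ := mres_glue (M := M) V (fun x : V ↦ W x.1 x.2) (fun x ↦ hW x.1 x.2)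
    (fun x hxV ↦ Opens.mem_iSup.mpr ⟨⟨x, hxV⟩, hx x hxV⟩) (fun x ↦ mres M (hW x.1 x.2) a)
    (fun k l ↦ by rw [mres_mres, mres_mres])
  rw [ht a fun _ ↦ rfl, ht b fun x ↦ (he x.1 x.2).symm]

theorem res_ext {V : X.Opens} {a b : Γ(X, V)}
    (h : ∀ x ∈ V, ∃ (W : X.Opens) (hW : W ≤ V), x ∈ W ∧ res hW a = res hW b) : a = b := by
  choose W hW hx he using h
  obtain ⟨t, -, ht⟩ := res_glue V (fun x : V ↦ W x.1 x.2) (fun x ↦ hW x.1 x.2)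
    (fun x hxV ↦ Opens.mem_iSup.mpr ⟨⟨x, hxV⟩, hx x hxV⟩) (fun x ↦ res (hW x.1 x.2) a)
    (fun k l ↦ by rw [res_res, res_res])
  rw [ht a fun _ ↦ rfl, ht b fun x ↦ (he x.1 x.2).symm]

/-- A morphism of sheaves of modules from compatible maps on sections. -/
def homMk (f : ∀ V : X.Opens, Γ(M, V) →+ Γ(N, V))
    (hsmul : ∀ V (r : Γ(X, V)) (a : Γ(M, V)), f V (r • a) = r • f V a)
    (hres : ∀ {V W : X.Opens} (h : V ≤ W) (a : Γ(M, W)), f V (mres M h a) = mres N h (f W a)) :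
    M ⟶ N :=
  SheafOfModules.Hom.mk
    { app V := ModuleCat.ofHom (X := M.val.obj V) (Y := N.val.obj V)
        { toFun := f V.unop
          map_add' := map_add _
          map_smul' := hsmul V.unop }
      naturality {V W} i := by
        ext a
        exact hres i.unop.le a }

/-- The section `∑ i, c i • m i` over `V`. -/
def comb {ι : Type*} [Fintype ι] (m : ι → Γ(M, ⊤)) {V : X.Opens} (c : ι → Γ(X, V)) : Γ(M, V) :=
  ∑ i, c i • mres M le_top (m i)

section comb

variable {ι : Type*} [Fintype ι] (m : ι → Γ(M, ⊤))

theorem comb_res {V W : X.Opens} (h : V ≤ W) (c : ι → Γ(X, W)) :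
    mres M h (comb m c) = comb m fun i ↦ res h (c i) := by
  simp only [comb, map_sum, mres_smul, mres_mres]

theorem comb_add {V : X.Opens} (c c' : ι → Γ(X, V)) :
    comb m (c + c') = comb m c + comb m c' := by
  simp only [comb, Pi.add_apply, add_smul, Finset.sum_add_distrib]

theorem comb_sub {V : X.Opens} (c c' : ι → Γ(X, V)) :
    comb m (c - c') = comb m c - comb m c' := by
  simp only [comb, Pi.sub_apply, sub_smul, Finset.sum_sub_distrib]

theorem comb_smul {V : X.Opens} (r : Γ(X, V)) (c : ι → Γ(X, V)) :
    comb m (r • c) = r • comb m c := by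
  simp only [comb, Pi.smul_apply, smul_eq_mul, mul_smul, Finset.smul_sum]

theorem app_comb (φ : M ⟶ N) {V : X.Opens} (c : ι → Γ(X, V)) :
    φ.app V (comb m c) = comb (fun i ↦ φ.app ⊤ (m i)) c := by
  simp only [comb, map_sum, Scheme.Modules.Hom.app_smul, app_mres]

theorem comb_single [DecidableEq ι] (i : ι) : comb m (Pi.single i (1 : Γ(X, ⊤))) = m i := by
  rw [comb, Finset.sum_eq_single i]
  · rw [Pi.single_eq_same, one_smul, mres_self]
  · intro j _ hj
    rw [Pi.single_eq_of_ne hj, zero_smul]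
  · simp

end comb

/-- The sections `m i` generate `M` locally. -/
def Generates {ι : Type*} [Fintype ι] (m : ι → Γ(M, ⊤)) : Prop :=
  ∀ (V : X.Opens) (s : Γ(M, V)), ∀ x ∈ V, ∃ (W : X.Opens) (hW : W ≤ V), x ∈ W ∧
    ∃ c : ι → Γ(X, W), mres M hW s = comb m c

theorem Generates.hom_ext {ι : Type*} [Fintype ι] {m : ι → Γ(M, ⊤)} (hm : Generates m)
    {φ ψ : M ⟶ N} (h : ∀ i, φ.app ⊤ (m i) = ψ.app ⊤ (m i)) : φ = ψ := by
  refine Scheme.Modules.hom_ext _ _ fun V ↦ ?_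
  ext s
  refine mres_ext fun x hx ↦ ?_
  obtain ⟨W, hW, hxW, c, hc⟩ := hm V s x hx
  refine ⟨W, hW, hxW, ?_⟩
  rw [← app_mres, ← app_mres, hc, app_comb, app_comb]
  simp only [h]

/-- A morphism out of a locally generated sheaf of modules may be prescribed on the generators,
subject to the relations between them. -/
theorem Generates.exists_hom {ι : Type*} [Fintype ι] {m : ι → Γ(M, ⊤)} (hm : Generates m)
    (n : ι → Γ(N, ⊤))
    (hrel : ∀ (V : X.Opens) (c : ι → Γ(X, V)), comb m c = 0 → ∀ x ∈ V,
      ∃ (W : X.Opens) (hW : W ≤ V), x ∈ W ∧ comb n (fun i ↦ res hW (c i)) = 0) :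
    ∃ φ : M ⟶ N, ∀ i, φ.app ⊤ (m i) = n i := by
  classical
  have hrel' (V : X.Opens) (c : ι → Γ(X, V)) (hc : comb m c = 0) : comb n c = 0 := by
    refine mres_ext fun x hx ↦ ?_
    obtain ⟨W, hW, hxW, h⟩ := hrel V c hc x hx
    exact ⟨W, hW, hxW, by rw [comb_res, h, map_zero]⟩
  have heq (V : X.Opens) (c c' : ι → Γ(X, V)) (hc : comb m c = comb m c') :
      comb n c = comb n c' := by
    rw [← sub_eq_zero, ← comb_sub]
    exact hrel' V _ (by rw [comb_sub, hc, sub_self])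
  -- The image is characterized by all local expressions of `s` at once. It is thus independent of
  -- choices, and compatibility with restriction follows from uniqueness alone.
  have key (V : X.Opens) (s : Γ(M, V)) : ∃! t : Γ(N, V), ∀ (W : X.Opens) (hW : W ≤ V)
      (c : ι → Γ(X, W)), mres M hW s = comb m c → mres N hW t = comb n c := by
    choose W hW hx c hc using hm V s
    obtain ⟨t, ht, htu⟩ := mres_glue (M := N) V (fun x : V ↦ W x.1 x.2) (fun x ↦ hW x.1 x.2)
      (fun x hxV ↦ Opens.mem_iSup.mpr ⟨⟨x, hxV⟩, hx x hxV⟩) (fun x ↦ comb n (c x.1 x.2))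
      (fun k l ↦ by
        rw [comb_res, comb_res]
        refine heq _ _ _ ?_
        rw [← comb_res, ← comb_res, ← hc, ← hc, mres_mres, mres_mres])
    refine ⟨t, fun Z hZ c' hc' ↦ ?_, fun t' ht' ↦ htu t' fun x ↦ ht' _ _ _ (hc x.1 x.2)⟩
    refine mres_ext fun x hxZ ↦ ⟨Z ⊓ W x (hZ hxZ), inf_le_left, ⟨hxZ, hx _ _⟩, ?_⟩
    have h2 : mres N (inf_le_right : Z ⊓ W x (hZ hxZ) ≤ _) (mres N (hW x (hZ hxZ)) t) =
        mres N inf_le_right (comb n (c x (hZ hxZ))) := congrArg _ (ht ⟨x, hZ hxZ⟩)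
    rw [mres_mres] at h2
    rw [mres_mres, h2, comb_res, comb_res]
    refine heq _ _ _ ?_
    rw [← comb_res, ← comb_res, ← hc, ← hc', mres_mres, mres_mres]
  choose F hF hFu using key
  have hcomb (V : X.Opens) (c : ι → Γ(X, V)) : F V (comb m c) = comb n c := by
    have := hF V (comb m c) V le_rfl c (mres_self _ _)
    rwa [mres_self] at this
  have hres {V W : X.Opens} (h : V ≤ W) (a : Γ(M, W)) : F V (mres M h a) = mres N h (F W a) := by
    refine (hFu V _ _ fun Z hZ c hc ↦ ?_).symm
    rw [mres_mres] at hc ⊢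
    exact hF W a Z _ c hc
  have hlocal (V : X.Opens) (s s' : Γ(M, V)) (x : X) (hx : x ∈ V) : ∃ (W : X.Opens) (hW : W ≤ V),
      x ∈ W ∧ ∃ c c' : ι → Γ(X, W), mres M hW s = comb m c ∧ mres M hW s' = comb m c' := by
    obtain ⟨W, hW, hxW, c, hc⟩ := hm V s x hx
    obtain ⟨W', hW', hxW', c', hc'⟩ := hm V s' x hx
    refine ⟨W ⊓ W', inf_le_left.trans hW, ⟨hxW, hxW'⟩, fun i ↦ res inf_le_left (c i),
      fun i ↦ res inf_le_right (c' i), ?_, ?_⟩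
    · rw [← comb_res, ← hc, mres_mres]
    · rw [← comb_res, ← hc', mres_mres]
  let f (V : X.Opens) : Γ(M, V) →+ Γ(N, V) := AddMonoidHom.mk' (F V) fun s s' ↦ by
    refine mres_ext fun x hx ↦ ?_
    obtain ⟨W, hW, hxW, c, c', hc, hc'⟩ := hlocal V s s' x hx
    refine ⟨W, hW, hxW, ?_⟩
    rw [map_add, ← hres, ← hres, ← hres, map_add, hc, hc', ← comb_add, hcomb, hcomb, hcomb,
      comb_add]
  have hsmul (V : X.Opens) (r : Γ(X, V)) (s : Γ(M, V)) : F V (r • s) = r • F V s := by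
    refine mres_ext fun x hx ↦ ?_
    obtain ⟨W, hW, hxW, c, -, hc, -⟩ := hlocal V s s x hx
    refine ⟨W, hW, hxW, ?_⟩
    rw [mres_smul, ← hres, ← hres, mres_smul, hc, ← comb_smul, hcomb, hcomb, comb_smul]
  refine ⟨homMk f hsmul hres, fun i ↦ ?_⟩
  change F ⊤ (m i) = n i
  rw [← comb_single m i, hcomb, comb_single]

end Modules

/-! ## Laurent polynomials -/

section Laurent

variable (σ : Type) (R : Type*) [CommRing R]

/-- Laurent polynomials in the variables `x_i`, where `i : σ`. -/
abbrev Laurent : Type _ := AddMonoidAlgebra R (σ → ℤ)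

variable {σ}

/-- Laurent polynomials with exponents in `C`. -/
def expIn (C : Set (σ → ℤ)) : Submodule R (Laurent σ R) where
  carrier := {p | ∀ e, p.coeff e ≠ 0 → e ∈ C}
  zero_mem' := by intro e he; simp at he
  add_mem' := by
    intro p q hp hq e he
    by_contra h
    apply he
    rw [AddMonoidAlgebra.coeff_add, Finsupp.add_apply, not_imp_comm.mp (hp e) h,
      not_imp_comm.mp (hq e) h, add_zero]
  smul_mem' := by
    intro r p hp e he
    refine hp e fun h ↦ he ?_
    rw [AddMonoidAlgebra.coeff_smul_apply, h, smul_zero]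

variable {R}

theorem single_mem_expIn {C : Set (σ → ℤ)} {e : σ → ℤ} (he : e ∈ C) (r : R) :
    AddMonoidAlgebra.single e r ∈ expIn R C := by
  classical
  intro e' h
  rw [AddMonoidAlgebra.coeff_single, Finsupp.single_apply] at h
  by_contra h'
  refine h (if_neg ?_)
  rintro rfl
  exact h' he

theorem mul_mem_expIn {C C' C'' : Set (σ → ℤ)} (hC : ∀ a ∈ C, ∀ b ∈ C', a + b ∈ C'')
    {p q : Laurent σ R} (hp : p ∈ expIn R C) (hq : q ∈ expIn R C') : p * q ∈ expIn R C'' := by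
  classical
  intro e he
  have := AddMonoidAlgebra.support_coeff_mul_subset p q (Finsupp.mem_support_iff.mpr he)
  obtain ⟨a, ha, b, hb, rfl⟩ := Finset.mem_add.mp this
  exact hC a (hp a (Finsupp.mem_support_iff.mp ha)) b (hq b (Finsupp.mem_support_iff.mp hb))

/-- A Laurent polynomial is determined by its coefficients along an enumeration of the possible
exponents. -/
theorem eq_sum_single {ι : Type*} [Fintype ι] {C : Set (σ → ℤ)} (ε : ι → σ → ℤ)
    (hε : Function.Injective ε) (hC : ∀ e ∈ C, ∃ i, ε i = e) {p : Laurent σ R}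
    (hp : p ∈ expIn R C) : p = ∑ i, AddMonoidAlgebra.single (ε i) (p.coeff (ε i)) := by
  classical
  refine AddMonoidAlgebra.ext (Finsupp.ext fun e ↦ ?_)
  rw [AddMonoidAlgebra.coeff_sum, Finsupp.finsetSum_apply]
  simp only [AddMonoidAlgebra.coeff_single, Finsupp.single_apply]
  by_cases he : ∃ i, ε i = e
  · obtain ⟨i, rfl⟩ := he
    rw [Finset.sum_eq_single i]
    · simp
    · intro j _ hj
      exact if_neg fun h ↦ hj (hε h)
    · simp
  · rw [Finset.sum_eq_zero fun i _ ↦ if_neg fun h ↦ he ⟨i, h⟩]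
    by_contra h
    exact he (hC e (hp e h))

section xpow

variable (R) [DecidableEq σ]

/-- The Laurent monomial `x_i ^ m`. -/
def xpow (i : σ) (m : ℤ) : Laurent σ R := AddMonoidAlgebra.single (Pi.single i m) 1

variable {R}

theorem xpow_add (i : σ) (m m' : ℤ) : xpow R i m * xpow R i m' = xpow R i (m + m') := by
  rw [xpow, xpow, xpow, AddMonoidAlgebra.single_mul_single, one_mul, Pi.single_add]

theorem xpow_zero (i : σ) : xpow R i 0 = 1 := by
  rw [xpow, Pi.single_zero, AddMonoidAlgebra.one_def]

theorem xpow_mul_xpow_neg (i : σ) (m : ℤ) : xpow R i m * xpow R i (-m) = 1 := by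
  rw [xpow_add, add_neg_cancel, xpow_zero]

end xpow

variable [Fintype σ]

/-- The exponents of degree `m` which are nonnegative away from `S`. -/
def cone (S : Set σ) (m : ℤ) : Set (σ → ℤ) := {e | ∑ i, e i = m ∧ ∀ i ∉ S, 0 ≤ e i}

theorem mul_mem_cone {S S' : Set σ} {m m' l : ℤ} (hl : m + m' = l) {p q : Laurent σ R}
    (hp : p ∈ expIn R (cone S m)) (hq : q ∈ expIn R (cone S' m')) :
    p * q ∈ expIn R (cone (S ∪ S') l) := by
  refine mul_mem_expIn (C'' := cone (S ∪ S') l) (fun a ha b hb ↦ ⟨?_, fun i hi ↦ ?_⟩) hp hq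
  · simp only [Pi.add_apply, Finset.sum_add_distrib, ha.1, hb.1, hl]
  · exact add_nonneg (ha.2 i fun h ↦ hi (Or.inl h)) (hb.2 i fun h ↦ hi (Or.inr h))

variable [DecidableEq σ]

theorem xpow_mem (i : σ) (m : ℤ) : xpow R i m ∈ expIn R (cone {i} m) :=
  single_mem_expIn (C := cone {i} m) ⟨by simp, fun j hj ↦ by rw [Pi.single_eq_of_ne hj]⟩ 1

/-- The first condition permits a negative exponent only at `i`, the second only at `j`. This is how
regularity on two charts forces a form to be a polynomial. -/
theorem mem_cone_empty_of_forall {m : ℤ} {i j : σ} (hij : i ≠ j) {p : Laurent σ R}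
    (hi : p ∈ expIn R (cone {i} m)) (hj : p ∈ expIn R (cone {j} m)) :
    p ∈ expIn R (cone ∅ m) := by
  intro e he
  refine ⟨(hi e he).1, fun l _ ↦ ?_⟩
  by_cases h : l = i
  · exact (hj e he).2 l fun h' ↦ hij (h.symm.trans h')
  · exact (hi e he).2 l h

/-- The vanishing of the first Čech cohomology group of `𝒪(m)` on projective space of dimension
at least two. -/
theorem exists_of_cocycle (i₀ i₁ i₂ : σ) (h₀₁ : i₀ ≠ i₁) (h₀₂ : i₀ ≠ i₂) (h₁₂ : i₁ ≠ i₂) {m : ℤ}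
    (H : σ → σ → Laurent σ R) (hmem : ∀ i j, H i j ∈ expIn R (cone {i, j} m))
    (hH : ∀ i j l, H i j + H j l = H i l) :
    ∃ h : σ → Laurent σ R, (∀ i, h i ∈ expIn R (cone {i} m)) ∧ ∀ i j, H i j = h i - h j := by
  classical
  -- For each exponent separately, the cocycle is trivialized by comparison with a fixed chart: with
  -- `i₁` if `x_{i₀}` occurs with a negative exponent, and with `i₀` otherwise. The coboundary
  -- identity holds for either choice; the choice is made for the sake of the cone condition.
  let h (i : σ) : Laurent σ R := AddMonoidAlgebra.ofCoeff
    ((H i i₁).coeff.filter (fun e ↦ e i₀ < 0) + (H i i₀).coeff.filter fun e ↦ ¬ e i₀ < 0)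
  have hc (i : σ) (e : σ → ℤ) :
      (h i).coeff e = if e i₀ < 0 then (H i i₁).coeff e else (H i i₀).coeff e := by
    simp only [h, Finsupp.add_apply, Finsupp.filter_apply]
    split_ifs <;> simp
  have hcoc (i j l : σ) (e : σ → ℤ) :
      (H i l).coeff e = (H i j).coeff e + (H j l).coeff e := by
    rw [← hH i j l, AddMonoidAlgebra.coeff_add, Finsupp.add_apply]
  refine ⟨h, fun i e he ↦ ?_, fun i j ↦ AddMonoidAlgebra.ext (Finsupp.ext fun e ↦ ?_)⟩
  · rw [hc] at he
    split_ifs at he with h0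
    · have h1 := hmem i i₁ e he
      refine ⟨h1.1, fun l (hl : l ≠ i) ↦ ?_⟩
      -- A negative exponent at `i₀` in `H i i₁` is only possible if `i₀` is `i` or `i₁`.
      obtain rfl : i = i₀ := by
        by_contra hi
        have := h1.2 i₀ (by
          rintro (h | h)
          exacts [hi h.symm, h₀₁ h])
        omega
      by_cases hl1 : l = i₁
      · by_contra hneg
        subst hl1
        apply he
        -- The detour through the third chart: a monomial with negative exponents at both `i₀` and
        -- `i₁` occurs neither in `H i₀ i₂` nor in `H i₂ i₁`. This is where dimension at least two
        -- enters.
        rw [hcoc i i₂ l]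
        have a1 : (H i i₂).coeff e = 0 := by
          by_contra hne
          exact hneg ((hmem i i₂ e hne).2 l (by
            rintro (h | h)
            exacts [hl h, h₁₂ h]))
        have a2 : (H i₂ l).coeff e = 0 := by
          by_contra hne
          have := (hmem i₂ l e hne).2 i (by
            rintro (h | h)
            exacts [h₀₂ h, h₀₁ h])
          omega
        rw [a1, a2, add_zero]
      · exact h1.2 l (by
          rintro (h | h)
          exacts [hl h, hl1 h])
    · have h1 := hmem i i₀ e he
      refine ⟨h1.1, fun l (hl : l ≠ i) ↦ ?_⟩
      by_cases hl0 : l = i₀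
      · subst hl0
        omega
      · exact h1.2 l (by
          rintro (h | h)
          exacts [hl h, hl0 h])
  · rw [AddMonoidAlgebra.coeff_sub, Finsupp.sub_apply, hc, hc]
    split_ifs
    · rw [hcoc i j i₁, add_sub_cancel_right]
    · rw [hcoc i j i₀, add_sub_cancel_right]

variable [IsDomain R]

/-- Sections of `𝒪(k)` on a hypersurface of degree `d` in projective space of dimension at least
two lift to forms of degree `k`. -/
theorem exists_form_of_sections (i₀ i₁ i₂ : σ) (h₀₁ : i₀ ≠ i₁) (h₀₂ : i₀ ≠ i₂) (h₁₂ : i₁ ≠ i₂)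
    {d k : ℤ} {G : Laurent σ R} (hG : G ∈ expIn R (cone ∅ d)) (hG0 : G ≠ 0)
    (b : σ → Laurent σ R) (hb : ∀ i, b i ∈ expIn R (cone {i} k))
    (H : σ → σ → Laurent σ R) (hmem : ∀ i j, H i j ∈ expIn R (cone {i, j} (k - d)))
    (hH : ∀ i j, b i - b j = G * H i j) :
    ∃ P ∈ expIn R (cone ∅ k), ∃ q : σ → Laurent σ R, (∀ i, q i ∈ expIn R (cone {i} (k - d))) ∧
      ∀ i, b i = P + G * q i := by
  -- The differences of the `b i` satisfy the cocycle condition trivially; cancelling `G` transfers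
  -- it to `H`.
  obtain ⟨q, hq, hHq⟩ := exists_of_cocycle i₀ i₁ i₂ h₀₁ h₀₂ h₁₂ H hmem fun i j l ↦
    mul_left_cancel₀ hG0 (by rw [mul_add, ← hH, ← hH, ← hH]; ring)
  have hP (i j : σ) : b i - G * q i = b j - G * q j := by
    have := hH i j
    rw [hHq, mul_sub] at this
    linear_combination this
  have hPm (i : σ) : b i - G * q i ∈ expIn R (cone {i} k) := by
    refine sub_mem (hb i) ?_
    have := mul_mem_cone (show d + (k - d) = k by ring) hG (hq i)
    rwa [Set.empty_union] at this
  -- The corrected lifts agree on all charts, so their common value has no denominators.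
  refine ⟨b i₀ - G * q i₀, mem_cone_empty_of_forall h₀₁ (hPm i₀) ?_, q, hq, fun i ↦ ?_⟩
  · rw [hP i₀ i₁]
    exact hPm i₁
  · rw [← hP i i₀, sub_add_cancel]

/-- A form which is divisible by `G` on all charts is divisible by `G`. -/
theorem exists_form_of_dvd (i₀ i₁ : σ) (h₀₁ : i₀ ≠ i₁) {d k : ℤ} {G P : Laurent σ R} (hG0 : G ≠ 0)
    (H : σ → Laurent σ R) (hmem : ∀ i, H i ∈ expIn R (cone {i} (k - d)))
    (hH : ∀ i, P = G * H i) : ∃ q ∈ expIn R (cone ∅ (k - d)), P = G * q := by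
  refine ⟨H i₀, mem_cone_empty_of_forall h₀₁ (hmem i₀) ?_, hH i₀⟩
  have : H i₀ = H i₁ := mul_left_cancel₀ hG0 (by rw [← hH, ← hH])
  rw [this]
  exact hmem i₁

end Laurent

/-! ### Functions on projective space: constants, values at points, Laurent expansions on the torus.
-/

section ProjSections

variable {σ : Type}

theorem le_preimage_top {X Y : Scheme.{u}} (f : X ⟶ Y) (U : X.Opens) : U ≤ f ⁻¹ᵁ ⊤ := le_top

/-- The constant functions. -/
def const (σ : Type) (U : (PP σ).Opens) : ℂ →+* Γ(PP σ, U) :=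
  ((Scheme.ΓSpecIso (CommRingCat.of ℂ)).inv ≫ (toSpecC σ).appLE ⊤ U (le_preimage_top _ _)).hom

theorem res_const {U V : (PP σ).Opens} (h : U ≤ V) (c : ℂ) : res h (const σ V c) = const σ U c := by
  simp only [res, const]
  rw [← CommRingCat.comp_apply, Category.assoc, Scheme.Hom.appLE_map]

/-- A morphism to an affine scheme is determined by its effect on global functions, so the ring map
can be read off from a factorization through `Spec`. It serves to compute `const` on basic open
subsets. -/
theorem appLE_eq_of_ι_comp {X : Scheme.{u}} {R : CommRingCat.{u}} (f : X ⟶ Spec R) (U : X.Opens)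
    (g : R ⟶ Γ(X, U)) (h : U.ι ≫ f = U.toSpecΓ ≫ Spec.map g) :
    (Scheme.ΓSpecIso R).inv ≫ f.appLE ⊤ U (le_preimage_top _ _) = g := by
  have h1 := congrArg Scheme.Hom.appTop h
  rw [Scheme.Hom.comp_appTop, Scheme.Hom.comp_appTop, Scheme.Opens.toSpecΓ_appTop] at h1
  rw [← Category.assoc, Scheme.ΓSpecIso_naturality, ← cancel_mono U.topIso.hom] at h1
  simp only [Category.assoc, Iso.inv_hom_id, Category.comp_id] at h1
  rw [Iso.inv_comp_eq, ← h1]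
  simp only [Scheme.Hom.appTop, Scheme.Hom.appLE, Scheme.Opens.ι_app, Scheme.Opens.topIso_hom]
  exact congrArg (_ ≫ ·) ((congrArg X.presheaf.map (Subsingleton.elim _ _)).trans
    (X.presheaf.map_comp _ _))

theorem const_basicOpen {m : ℕ} (f : MvPolynomial σ ℂ)
    (hf : f ∈ MvPolynomial.homogeneousSubmodule σ ℂ m) (hm : 0 < m) (c : ℂ) :
    const σ (Proj.basicOpen (MvPolynomial.homogeneousSubmodule σ ℂ) f) c =
      Proj.awayToSection (MvPolynomial.homogeneousSubmodule σ ℂ) f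
        (HomogeneousLocalization.fromZeroRingHom _ _ (algebraMap ℂ _ c)) := by
  have h1 : (Proj.basicOpen (MvPolynomial.homogeneousSubmodule σ ℂ) f).ι ≫ toSpecC σ =
      Scheme.Opens.toSpecΓ _ ≫ Spec.map (CommRingCat.ofHom (algebraMap ℂ
        (MvPolynomial.homogeneousSubmodule σ ℂ 0)) ≫ CommRingCat.ofHom
        (HomogeneousLocalization.fromZeroRingHom (MvPolynomial.homogeneousSubmodule σ ℂ)
          (Submonoid.powers f)) ≫ Proj.awayToSection _ f) := by
    have := Proj.awayι_toSpecZero _ f hf hm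
    rw [Proj.awayι, Category.assoc, Iso.inv_comp_eq, Proj.basicOpenIsoSpec_hom,
      Proj.basicOpenToSpec] at this
    rw [toSpecC, ← Category.assoc, this]
    simp only [Spec.map_comp, Category.assoc]
  have h2 := appLE_eq_of_ι_comp _ _ _ h1
  rw [const, h2]
  rfl

/-- A point of projective space as a homogeneous prime ideal. -/
abbrev point (p : PP σ) : ProjectiveSpectrum (MvPolynomial.homogeneousSubmodule σ ℂ) := p

/-- The value of a function on projective space at a point. -/
def evalAt {U : (PP σ).Opens} (p : U) : Γ(PP σ, U) →+*
    Localization.AtPrime (point p.1).asHomogeneousIdeal.toIdeal where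
  toFun s := (s.1 p).val
  map_one' := HomogeneousLocalization.val_one
  map_zero' := HomogeneousLocalization.val_zero
  map_add' _ _ := HomogeneousLocalization.val_add _ _
  map_mul' _ _ := HomogeneousLocalization.val_mul _ _

/-- Functions are families of germs, and homogeneous fractions embed in the local rings of affine
space. There the denominators are units, so identities between ratios reduce to identities between
polynomials. -/
theorem evalAt_ext {U : (PP σ).Opens} {s t : Γ(PP σ, U)} (h : ∀ p : U, evalAt p s = evalAt p t) :
    s = t :=
  Subtype.ext (funext fun p ↦ HomogeneousLocalization.val_injective _ (h p))

theorem evalAt_res {U V : (PP σ).Opens} (h : U ≤ V) (s : Γ(PP σ, V)) (p : U) :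
    evalAt p (res h s) = evalAt ⟨p.1, h p.2⟩ s := rfl

/-- A polynomial as an element of the local ring of affine space. -/
def polyAt (p : PP σ) :
    MvPolynomial σ ℂ →+* Localization.AtPrime (point p).asHomogeneousIdeal.toIdeal :=
  algebraMap _ _

theorem isUnit_polyAt {f : MvPolynomial σ ℂ} {p : PP σ}
    (hp : p ∈ Proj.basicOpen (MvPolynomial.homogeneousSubmodule σ ℂ) f) : IsUnit (polyAt p f) :=
  IsLocalization.map_units (M := (point p).asHomogeneousIdeal.toIdeal.primeCompl) _ ⟨f, hp⟩

theorem evalAt_awayToSection {m : ℕ} {f : MvPolynomial σ ℂ}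
    (hf : f ∈ MvPolynomial.homogeneousSubmodule σ ℂ m) (n : ℕ) (a : MvPolynomial σ ℂ)
    (ha : a ∈ MvPolynomial.homogeneousSubmodule σ ℂ (n • m))
    (p : Proj.basicOpen (MvPolynomial.homogeneousSubmodule σ ℂ) f) :
    evalAt p (Proj.awayToSection (MvPolynomial.homogeneousSubmodule σ ℂ) f
      (HomogeneousLocalization.Away.mk _ hf n a ha)) * polyAt p.1 f ^ n = polyAt p.1 a := by
  have hp : f ^ n ∈ (point p.1).asHomogeneousIdeal.toIdeal.primeCompl :=
    pow_mem (show f ∈ (point p.1).asHomogeneousIdeal.toIdeal.primeCompl from p.2) n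
  have h : evalAt p (Proj.awayToSection (MvPolynomial.homogeneousSubmodule σ ℂ) f
      (HomogeneousLocalization.Away.mk _ hf n a ha)) = Localization.mk a ⟨f ^ n, hp⟩ := rfl
  rw [h, Localization.mk_eq_mk', ← map_pow]
  exact IsLocalization.mk'_spec _ a ⟨f ^ n, hp⟩

theorem evalAt_ratio (i j : σ) (p : chart i) :
    evalAt p (ratio i j) * polyAt p.1 (MvPolynomial.X i) = polyAt p.1 (MvPolynomial.X j) := by
  have := evalAt_awayToSection (MvPolynomial.isHomogeneous_X ℂ i) 1 (MvPolynomial.X j)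
    (MvPolynomial.isHomogeneous_X ℂ j) p
  rwa [pow_one] at this

theorem ratio_self (i : σ) : ratio i i = 1 := by
  refine evalAt_ext fun p ↦ ?_
  apply (isUnit_polyAt p.2).mul_right_cancel
  rw [evalAt_ratio, map_one, one_mul]

/-- `x_l / x_i = (x_j / x_i) * (x_l / x_j)`. -/
theorem ratio_mul_ratio (i j l : σ) {U : (PP σ).Opens} (hi : U ≤ chart i) (hj : U ≤ chart j) :
    res hi (ratio i j) * res hj (ratio j l) = res hi (ratio i l) := by
  refine evalAt_ext fun p ↦ ?_
  apply (isUnit_polyAt (hi p.2)).mul_right_cancel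
  rw [map_mul, mul_right_comm]
  simp only [evalAt_res]
  rw [evalAt_ratio i j ⟨p.1, hi p.2⟩, evalAt_ratio i l ⟨p.1, hi p.2⟩, mul_comm,
    evalAt_ratio j l ⟨p.1, hj p.2⟩]

theorem iSup_chart : ⨆ i : σ, chart i = ⊤ := by
  refine Proj.iSup_basicOpen_eq_top' _ _ (fun i ↦ ⟨1, MvPolynomial.isHomogeneous_X ℂ i⟩) ?_
  rw [eq_top_iff]
  rintro p -
  induction p using MvPolynomial.induction_on with
  | C c =>
    exact Subalgebra.algebraMap_mem _ (⟨MvPolynomial.C c, MvPolynomial.isHomogeneous_C _ _⟩ :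
      MvPolynomial.homogeneousSubmodule σ ℂ 0)
  | add p q hp hq => exact add_mem hp hq
  | mul_X p i hp => exact mul_mem hp (Algebra.subset_adjoin ⟨i, rfl⟩)

theorem exists_mem_chart (p : PP σ) : ∃ i, p ∈ chart i :=
  Opens.mem_iSup.mp (iSup_chart (σ := σ) ▸ Opens.mem_top p)

theorem evalAt_const {U : (PP σ).Opens} (c : ℂ) (p : U) :
    evalAt p (const σ U c) = polyAt p.1 (MvPolynomial.C c) := by
  obtain ⟨i, hi⟩ := exists_mem_chart p.1
  have h1 : evalAt p (const σ U c) = evalAt ⟨p.1, hi⟩ (const σ (chart i) c) := by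
    rw [← evalAt_res (inf_le_left : U ⊓ chart i ≤ U) _ ⟨p.1, p.2, hi⟩,
      ← evalAt_res (inf_le_right : U ⊓ chart i ≤ chart i) _ ⟨p.1, p.2, hi⟩, res_const, res_const]
  rw [h1]
  exact (congrArg (evalAt (U := chart i) ⟨p.1, hi⟩)
    (const_basicOpen _ (MvPolynomial.isHomogeneous_X ℂ i) Nat.one_pos c)).trans
      (Localization.mk_one_eq_algebraMap _)

theorem isAffineOpen_chart (i : σ) : IsAffineOpen (chart i) :=
  Proj.isAffineOpen_basicOpen _ _ (MvPolynomial.isHomogeneous_X ℂ i) Nat.one_pos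

/-- Evaluation of a polynomial at the Laurent monomials `x_i`. -/
def toLaurent [DecidableEq σ] {R : Type*} [CommRing R] (κ : ℂ →+* R) :
    MvPolynomial σ ℂ →+* Laurent σ R :=
  MvPolynomial.eval₂Hom (AddMonoidAlgebra.singleZeroRingHom.comp κ) fun i ↦ xpow R i 1

section monomials

variable [DecidableEq σ] {R : Type*} [CommRing R] (κ : ℂ →+* R)

theorem isUnit_xpow (i : σ) (m : ℤ) : IsUnit (xpow R i m) :=
  IsUnit.of_mul_eq_one _ (xpow_mul_xpow_neg i m)

theorem toLaurent_X (i : σ) : toLaurent κ (MvPolynomial.X i) = xpow R i 1 :=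
  MvPolynomial.eval₂Hom_X' _ _ _

theorem toLaurent_C (c : ℂ) : toLaurent (σ := σ) κ (MvPolynomial.C c) =
    AddMonoidAlgebra.single 0 (κ c) :=
  MvPolynomial.eval₂Hom_C _ _ _

end monomials

section coordProd

variable [Fintype σ]

variable (σ) in
/-- The square of the product of the coordinates. -/
def coordProd : MvPolynomial σ ℂ := ∏ i, MvPolynomial.X i ^ 2

theorem coordProd_mem : coordProd σ ∈ MvPolynomial.homogeneousSubmodule σ ℂ (∑ _i : σ, 2) :=
  MvPolynomial.IsHomogeneous.prod _ _ _ fun i _ ↦ MvPolynomial.isHomogeneous_X_pow i 2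

variable (σ) in
/-- The locus in projective space where no coordinate vanishes. -/
def torus : (PP σ).Opens := Proj.basicOpen (MvPolynomial.homogeneousSubmodule σ ℂ) (coordProd σ)

theorem sum_two_pos [Nonempty σ] : 0 < ∑ _i : σ, 2 := by
  simp [Fintype.card_pos]

end coordProd

variable [Fintype σ] [DecidableEq σ] {R : Type*} [CommRing R] (κ : ℂ →+* R)

theorem isUnit_toLaurent_coordProd : IsUnit (toLaurent κ (coordProd σ)) := by
  rw [coordProd, map_prod]
  refine IsUnit.prod_iff.mpr fun i _ ↦ ?_
  rw [map_pow, toLaurent_X]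
  exact (isUnit_xpow i 1).pow 2

/-- The expansion of functions on the torus as Laurent polynomials. -/
def expand [Nonempty σ] : Γ(PP σ, torus σ) →+* Laurent σ R :=
  ((IsLocalization.Away.lift (S := Localization.Away (coordProd σ)) (coordProd σ)
      (isUnit_toLaurent_coordProd κ)).comp
    (algebraMap (HomogeneousLocalization.Away (MvPolynomial.homogeneousSubmodule σ ℂ)
      (coordProd σ)) _)).comp
    (Proj.basicOpenIsoAway _ (coordProd σ) coordProd_mem sum_two_pos).inv.hom

theorem expand_awayToSection_self [Nonempty σ] (y) :
    expand κ (Proj.awayToSection (MvPolynomial.homogeneousSubmodule σ ℂ) (coordProd σ) y) =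
      IsLocalization.Away.lift (S := Localization.Away (coordProd σ)) (coordProd σ)
        (isUnit_toLaurent_coordProd κ) y.val := by
  have := ConcreteCategory.congr_hom
    (Proj.basicOpenIsoAway _ (coordProd σ) coordProd_mem sum_two_pos).hom_inv_id y
  exact congrArg (fun z ↦ IsLocalization.Away.lift (S := Localization.Away (coordProd σ))
    (coordProd σ) (isUnit_toLaurent_coordProd κ) (HomogeneousLocalization.val z)) this

/-- On the torus, `a / f ^ n` becomes `a g ^ n / (f g) ^ n`. Its expansion follows from the
universal property of the localization, after cancelling the unit which is the image of `g ^ n`. -/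
theorem expand_awayToSection [Nonempty σ] {m m' : ℕ} {f g : MvPolynomial σ ℂ}
    (hf : f ∈ MvPolynomial.homogeneousSubmodule σ ℂ m)
    (hg : g ∈ MvPolynomial.homogeneousSubmodule σ ℂ m') (hfg : coordProd σ = f * g)
    (h : torus σ ≤ Proj.basicOpen (MvPolynomial.homogeneousSubmodule σ ℂ) f)
    (n : ℕ) (a : MvPolynomial σ ℂ)
    (ha : a ∈ MvPolynomial.homogeneousSubmodule σ ℂ (n • m)) :
    expand κ (res h (Proj.awayToSection (MvPolynomial.homogeneousSubmodule σ ℂ) f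
      (HomogeneousLocalization.Away.mk _ hf n a ha))) * toLaurent κ f ^ n = toLaurent κ a := by
  have h1 : res h (Proj.awayToSection (MvPolynomial.homogeneousSubmodule σ ℂ) f
      (HomogeneousLocalization.Away.mk _ hf n a ha)) = Proj.awayToSection _ (coordProd σ)
        (HomogeneousLocalization.awayMap _ hg hfg
          (HomogeneousLocalization.Away.mk _ hf n a ha)) :=
    (ConcreteCategory.congr_hom (Proj.awayMap_awayToSection _ hg hfg) _).symm
  have hgu : IsUnit (toLaurent κ g) :=
    isUnit_of_mul_isUnit_right (by
      rw [← map_mul, ← hfg]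
      exact isUnit_toLaurent_coordProd κ)
  have hd : coordProd σ ^ n ∈ Submonoid.powers (coordProd σ) := ⟨n, rfl⟩
  rw [h1, expand_awayToSection_self, HomogeneousLocalization.awayMap_mk,
    HomogeneousLocalization.Away.val_mk, Localization.mk_eq_mk']
  apply (hgu.pow n).mul_right_cancel
  rw [mul_assoc, ← mul_pow, ← map_mul, ← hfg, ← map_pow, ← map_pow, ← map_mul]
  simp only [← IsLocalization.Away.lift_eq (coordProd σ) (isUnit_toLaurent_coordProd κ)
    (S := Localization.Away (coordProd σ))]
  rw [← map_mul]
  exact congrArg _ (IsLocalization.mk'_spec _ _ (⟨coordProd σ ^ n, hd⟩ :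
    Submonoid.powers (coordProd σ)))

theorem expand_const [Nonempty σ] (c : ℂ) :
    expand κ (const σ (torus σ) c) = AddMonoidAlgebra.single 0 (κ c) := by
  refine (congrArg (expand κ) (const_basicOpen _ coordProd_mem sum_two_pos c)).trans ?_
  rw [expand_awayToSection_self, ← toLaurent_C, ← IsLocalization.Away.lift_eq (coordProd σ)
    (isUnit_toLaurent_coordProd κ) (S := Localization.Away (coordProd σ))]
  exact congrArg _ (Localization.mk_one_eq_algebraMap _)

end ProjSections

/-! ### Generators of the ring of functions on a chart. -/

section ChartRing

/-- Every monomial of `a` contributes the same power of `u`. Applied with `u = x_i`, it passes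
between a form and its dehomogenization. -/
theorem eval₂_mul_of_isHomogeneous {σ R S : Type*} [CommSemiring R] [CommSemiring S] (f : R →+* S)
    (g : σ → S) (u : S) {n : ℕ} {a : MvPolynomial σ R} (ha : a.IsHomogeneous n) :
    a.eval₂ f (fun l ↦ g l * u) = a.eval₂ f g * u ^ n := by
  rw [MvPolynomial.eval₂_eq, MvPolynomial.eval₂_eq, Finset.sum_mul]
  refine Finset.sum_congr rfl fun e he ↦ ?_
  rw [mul_assoc]
  congr 1
  simp only [mul_pow, Finset.prod_mul_distrib]
  rw [Finset.prod_pow_eq_pow_sum]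
  congr 2
  have := ha (MvPolynomial.mem_support_iff.mp he)
  rw [← this]
  simp [Finsupp.weight_apply, Finsupp.sum]

variable {σ : Type}

/-- The functions on a chart are the polynomials in the functions `x_l / x_i`. -/
theorem chart_induction (i : σ) (S : Subring Γ(PP σ, chart i)) (hc : ∀ c, const σ (chart i) c ∈ S)
    (hr : ∀ l, ratio i l ∈ S) (s : Γ(PP σ, chart i)) : s ∈ S := by
  have hX := MvPolynomial.isHomogeneous_X ℂ i
  obtain ⟨y, rfl⟩ : ∃ y, Proj.awayToSection (MvPolynomial.homogeneousSubmodule σ ℂ)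
      (MvPolynomial.X i) y = s :=
    ⟨_, ConcreteCategory.congr_hom (Proj.basicOpenIsoAway _ _ hX Nat.one_pos).inv_hom_id s⟩
  obtain ⟨n, a, ha, rfl⟩ := HomogeneousLocalization.Away.mk_surjective _ hX y
  -- The fraction `a / x_i ^ n` is `a` evaluated at the ratios `x_l / x_i`; this is checked at
  -- points after multiplication by the unit `x_i ^ n`.
  have : (Proj.awayToSection (MvPolynomial.homogeneousSubmodule σ ℂ) (MvPolynomial.X i)
      (HomogeneousLocalization.Away.mk _ hX n a ha) : Γ(PP σ, chart i)) =
        MvPolynomial.eval₂Hom (const σ (chart i)) (ratio i) a := by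
    refine evalAt_ext (U := chart i) fun p ↦ ?_
    apply ((isUnit_polyAt p.2).pow n).mul_right_cancel
    refine (evalAt_awayToSection hX n a ha p).trans ?_
    rw [MvPolynomial.map_eval₂Hom]
    have ha' : a.IsHomogeneous n := by simpa using ha
    have h1 := eval₂_mul_of_isHomogeneous ((evalAt p).comp (const σ (chart i)))
      (fun l ↦ evalAt p (ratio i l)) (polyAt p.1 (MvPolynomial.X i)) ha'
    refine Eq.trans ?_ h1
    simp only [evalAt_ratio]
    have h2 : (evalAt p).comp (const σ (chart i)) = (polyAt p.1).comp MvPolynomial.C :=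
      RingHom.ext fun c ↦ evalAt_const c p
    rw [h2, ← MvPolynomial.hom_eval₂, MvPolynomial.eval₂_eta]
  refine (congrArg (· ∈ S) this).mpr ?_
  clear this ha
  induction a using MvPolynomial.induction_on with
  | C c => simpa using hc c
  | add p q hp hq => simpa using add_mem hp hq
  | mul_X p i hp => simpa using mul_mem hp (hr i)

theorem chart_inf_chart (i j : σ) : chart i ⊓ chart j =
    Proj.basicOpen (MvPolynomial.homogeneousSubmodule σ ℂ)
      (MvPolynomial.X i * MvPolynomial.X j) :=
  (Proj.basicOpen_mul _ _ _).symm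

theorem isAffineOpen_chart_inf (i j : σ) : IsAffineOpen (chart i ⊓ chart j) := by
  rw [chart_inf_chart]
  exact Proj.isAffineOpen_basicOpen _ _ ((MvPolynomial.isHomogeneous_X ℂ i).mul
    (MvPolynomial.isHomogeneous_X ℂ j)) two_pos

theorem xpow_pow [DecidableEq σ] {R : Type*} [CommRing R] (i : σ) (m : ℤ) (n : ℕ) :
    xpow R i m ^ n = xpow R i (n * m) := by
  rw [xpow, AddMonoidAlgebra.single_pow, one_pow, ← Pi.single_smul, nsmul_eq_mul]
  rfl

end ChartRing

/-! ### Exponents of Laurent monomials on the charts. -/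

section Monomials

variable {σ : Type} [Fintype σ]

/-- Laurent polynomials of degree zero with nonnegative exponents away from `S`. -/
def coneRing (R : Type*) [CommRing R] (S : Set σ) : Subring (Laurent σ R) where
  carrier := expIn R (cone S 0)
  zero_mem' := zero_mem _
  add_mem' := add_mem
  neg_mem' := neg_mem
  one_mem' := single_mem_expIn (C := cone S 0) ⟨by simp, by simp⟩ 1
  mul_mem' := by
    intro p q hp hq
    have := mul_mem_cone (add_zero 0) hp hq
    rwa [Set.union_self] at this

theorem single_zero_mem_cone {R : Type*} [CommRing R] (S : Set σ) (r : R) :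
    AddMonoidAlgebra.single 0 r ∈ expIn R (cone S 0) :=
  single_mem_expIn (C := cone S 0) ⟨by simp, by simp⟩ r

theorem torus_le_basicOpen {f g : MvPolynomial σ ℂ} (h : coordProd σ = f * g) :
    torus σ ≤ Proj.basicOpen (MvPolynomial.homogeneousSubmodule σ ℂ) f :=
  Proj.basicOpen_mono _ _ _ ⟨g, h⟩

variable [DecidableEq σ]

theorem prod_xpow {R : Type*} [CommRing R] (e : σ → ℤ) :
    ∏ i, xpow R i (e i) = AddMonoidAlgebra.single e 1 := by
  simp only [xpow]
  rw [AddMonoidAlgebra.prod_single, Finset.prod_const_one, Finset.univ_sum_single]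

theorem toLaurent_monomial {R : Type*} [CommRing R] (κ : ℂ →+* R) (e : σ →₀ ℕ) (c : ℂ) :
    toLaurent κ (MvPolynomial.monomial e c) =
      AddMonoidAlgebra.single (fun i ↦ (e i : ℤ)) (κ c) := by
  rw [toLaurent, MvPolynomial.coe_eval₂Hom, MvPolynomial.eval₂_monomial,
    Finsupp.prod_fintype _ _ (by simp)]
  simp only [xpow_pow, mul_one]
  rw [prod_xpow, RingHom.comp_apply]
  change AddMonoidAlgebra.single 0 (κ c) * _ = _
  rw [AddMonoidAlgebra.single_mul_single, zero_add, mul_one]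

theorem toLaurent_mem {R : Type*} [CommRing R] (κ : ℂ →+* R) {n : ℕ} {a : MvPolynomial σ ℂ}
    (ha : a.IsHomogeneous n) : toLaurent κ a ∈ expIn R (cone ∅ n) := by
  rw [a.as_sum, map_sum]
  refine sum_mem fun e he ↦ ?_
  rw [toLaurent_monomial]
  refine single_mem_expIn (C := cone ∅ n) ⟨?_, fun _ _ ↦ by positivity⟩ _
  have := ha (MvPolynomial.mem_support_iff.mp he)
  rw [← this]
  simp [Finsupp.weight_apply, Finsupp.sum_fintype]

theorem coordProd_eq_X_mul (i : σ) : coordProd σ = MvPolynomial.X i *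
    (MvPolynomial.X i * ∏ l ∈ Finset.univ.erase i, MvPolynomial.X l ^ 2) := by
  rw [coordProd, ← Finset.mul_prod_erase _ _ (Finset.mem_univ i)]
  ring

theorem coordProd_eq_X_mul_X_mul {i j : σ} (h : i ≠ j) :
    coordProd σ = (MvPolynomial.X i * MvPolynomial.X j) * (MvPolynomial.X i * MvPolynomial.X j *
      ∏ l ∈ (Finset.univ.erase i).erase j, MvPolynomial.X l ^ 2) := by
  rw [coordProd, ← Finset.mul_prod_erase _ _ (Finset.mem_univ i),
    ← Finset.mul_prod_erase _ _ (Finset.mem_erase.mpr ⟨h.symm, Finset.mem_univ j⟩)]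
  ring

theorem torus_le_chart (i : σ) : torus σ ≤ chart i := torus_le_basicOpen (coordProd_eq_X_mul i)

theorem torus_le_overlap (i j : σ) : torus σ ≤ chart i ⊓ chart j :=
  le_inf (torus_le_chart i) (torus_le_chart j)

/-- The exponent of the Laurent monomial `∏ l, (x_l / x_i) ^ e l`. -/
def chartExponent (i : σ) (e : {l // l ≠ i} →₀ ℕ) : σ → ℤ :=
  ∑ l, e l • (Pi.single l.1 1 + Pi.single i (-1))

theorem chartExponent_apply (i : σ) (e : {l // l ≠ i} →₀ ℕ) (l : {l // l ≠ i}) :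
    chartExponent i e l = e l := by
  rw [chartExponent, Finset.sum_apply, Finset.sum_eq_single l]
  · simp [Pi.single_eq_of_ne l.2]
  · intro m _ hm
    have : l.1 ≠ m.1 := fun h ↦ hm (Subtype.ext h.symm)
    simp [Pi.single_eq_of_ne l.2, Pi.single_eq_of_ne this]
  · simp

theorem sum_chartExponent (i : σ) (e : {l // l ≠ i} →₀ ℕ) : ∑ l, chartExponent i e l = 0 := by
  simp only [chartExponent, Finset.sum_apply]
  rw [Finset.sum_comm]
  refine Finset.sum_eq_zero fun l _ ↦ ?_
  simp only [Pi.smul_apply, Pi.add_apply, ← Finset.smul_sum, Finset.sum_add_distrib]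
  simp

/-- In degree zero, the entry at `i` is determined by the others. -/
theorem chartExponent_eq {i : σ} {e : {l // l ≠ i} →₀ ℕ} {e' : σ → ℤ} (h0 : ∑ l, e' l = 0)
    (h : ∀ l : {l // l ≠ i}, (e l : ℤ) = e' l) : chartExponent i e = e' := by
  have h1 (l : σ) (hl : l ≠ i) : chartExponent i e l = e' l := by
    rw [chartExponent_apply i e ⟨l, hl⟩, h]
  funext l
  by_cases hl : l = i
  · subst hl
    have h2 := sum_chartExponent l e
    rw [← h0, ← Finset.add_sum_erase _ _ (Finset.mem_univ l),
      ← Finset.add_sum_erase _ _ (Finset.mem_univ l),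
      Finset.sum_congr rfl fun m hm ↦ h1 m (Finset.ne_of_mem_erase hm)] at h2
    exact add_right_cancel h2
  · exact h1 l hl

theorem chartExponent_injective (i : σ) : Function.Injective (chartExponent i) := by
  intro e e' h
  ext l
  have := congrFun h l.1
  rwa [chartExponent_apply, chartExponent_apply, Nat.cast_inj] at this

end Monomials

/-! ### Functions on a product of projective spaces and their expansions. -/

section Product

variable {σ τ : Type}

/-- The universal property gives a map `P → S`; composed with the inclusion it is the identity, by
uniqueness, so the inclusion is onto. -/
theorem isPushout_induction {A B C P : CommRingCat.{u}} {f : A ⟶ B} {g : A ⟶ C} {inl : B ⟶ P}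
    {inr : C ⟶ P} (h : IsPushout f g inl inr) (S : Subring P) (hl : ∀ b, inl b ∈ S)
    (hr : ∀ c, inr c ∈ S) (p : P) : p ∈ S := by
  let inl' : B ⟶ CommRingCat.of S := CommRingCat.ofHom (inl.hom.codRestrict S hl)
  let inr' : C ⟶ CommRingCat.of S := CommRingCat.ofHom (inr.hom.codRestrict S hr)
  have hw : f ≫ inl' = g ≫ inr' := by
    ext a
    exact ConcreteCategory.congr_hom h.w a
  have : h.desc inl' inr' hw ≫ CommRingCat.ofHom S.subtype = 𝟙 P := by
    refine h.hom_ext ?_ ?_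
    · rw [← Category.assoc, h.inl_desc, Category.comp_id]
      rfl
    · rw [← Category.assoc, h.inr_desc, Category.comp_id]
      rfl
  have h2 := ConcreteCategory.congr_hom this p
  rw [CommRingCat.comp_apply] at h2
  have h3 : p = S.subtype (h.desc inl' inr' hw p) := h2.symm
  rw [h3]
  exact Subtype.prop _

variable (σ τ) in
/-- The product of two projective spaces. -/
abbrev PPProd : Scheme.{0} := pullback (toSpecC σ) (toSpecC τ)

/-- The product of two open subsets. -/
def box (U : (PP σ).Opens) (W : (PP τ).Opens) : (PPProd σ τ).Opens :=
  pullback.fst (toSpecC σ) (toSpecC τ) ⁻¹ᵁ U ⊓ pullback.snd (toSpecC σ) (toSpecC τ) ⁻¹ᵁ W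

theorem box_mono {U U' : (PP σ).Opens} {W W' : (PP τ).Opens} (h : U ≤ U') (h' : W ≤ W') :
    box U W ≤ box U' W' :=
  inf_le_inf (fun _ hx ↦ h hx) (fun _ hx ↦ h' hx)

theorem box_le_left (U : (PP σ).Opens) (W : (PP τ).Opens) :
    box U W ≤ pullback.fst (toSpecC σ) (toSpecC τ) ⁻¹ᵁ U := inf_le_left

theorem box_le_right (U : (PP σ).Opens) (W : (PP τ).Opens) :
    box U W ≤ pullback.snd (toSpecC σ) (toSpecC τ) ⁻¹ᵁ W := inf_le_right

/-- Pull-back of functions from the first factor. -/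
def left (U : (PP σ).Opens) (W : (PP τ).Opens) : Γ(PP σ, U) →+* Γ(PPProd σ τ, box U W) :=
  ((pullback.fst (toSpecC σ) (toSpecC τ)).appLE U (box U W) (box_le_left U W)).hom

/-- Pull-back of functions from the second factor. -/
def right (U : (PP σ).Opens) (W : (PP τ).Opens) : Γ(PP τ, W) →+* Γ(PPProd σ τ, box U W) :=
  ((pullback.snd (toSpecC σ) (toSpecC τ)).appLE W (box U W) (box_le_right U W)).hom

theorem res_left {U U' : (PP σ).Opens} {W W' : (PP τ).Opens} (h : U ≤ U') (h' : W ≤ W')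
    (s : Γ(PP σ, U')) : res (box_mono h h') (left U' W' s) = left U W (res h s) := by
  simp only [left, res]
  rw [← CommRingCat.comp_apply, ← CommRingCat.comp_apply, Scheme.Hom.appLE_map,
    Scheme.Hom.map_appLE]

theorem res_right {U U' : (PP σ).Opens} {W W' : (PP τ).Opens} (h : U ≤ U') (h' : W ≤ W')
    (s : Γ(PP τ, W')) : res (box_mono h h') (right U' W' s) = right U W (res h' s) := by
  simp only [right, res]
  rw [← CommRingCat.comp_apply, ← CommRingCat.comp_apply, Scheme.Hom.appLE_map,
    Scheme.Hom.map_appLE]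

theorem left_const (U : (PP σ).Opens) (W : (PP τ).Opens) (c : ℂ) :
    left U W (const σ U c) = ((Scheme.ΓSpecIso (CommRingCat.of ℂ)).inv ≫
      (pullback.fst (toSpecC σ) (toSpecC τ) ≫ toSpecC σ).appLE ⊤ (box U W)
        (le_preimage_top _ _)).hom c := by
  simp only [left, const]
  rw [← CommRingCat.comp_apply, Category.assoc, Scheme.Hom.appLE_comp_appLE]

theorem right_const (U : (PP σ).Opens) (W : (PP τ).Opens) (c : ℂ) :
    right U W (const τ W c) = left U W (const σ U c) := by
  rw [left_const]
  simp only [right, const, pullback.condition]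
  rw [← CommRingCat.comp_apply, Category.assoc, Scheme.Hom.appLE_comp_appLE]

theorem isPushout_box {U : (PP σ).Opens} {W : (PP τ).Opens} (hU : IsAffineOpen U)
    (hW : IsAffineOpen W) :
    IsPushout ((toSpecC σ).appLE ⊤ U (le_preimage_top _ _))
      ((toSpecC τ).appLE ⊤ W (le_preimage_top _ _))
      ((pullback.fst (toSpecC σ) (toSpecC τ)).appLE U (box U W) (box_le_left U W))
      ((pullback.snd (toSpecC σ) (toSpecC τ)).appLE W (box U W) (box_le_right U W)) :=
  (isIso_pushoutSection_iff (IsPullback.of_hasPullback (toSpecC σ) (toSpecC τ))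
    (le_preimage_top _ _) (le_preimage_top _ _) rfl).mp
    (isIso_pushoutSection_of_isAffineOpen _ _ _ _ (isAffineOpen_top _) hW hU)

theorem isAffineOpen_box {U : (PP σ).Opens} {W : (PP τ).Opens} (hU : IsAffineOpen U)
    (hW : IsAffineOpen W) : IsAffineOpen (box U W) := by
  have : IsAffine _ := isAffineOpen_top (Spec (CommRingCat.of ℂ))
  have : IsAffine _ := hU
  have : IsAffine _ := hW
  exact .of_isPullback (Scheme.Hom.isPullback_resLE
    (IsPullback.of_hasPullback (toSpecC σ) (toSpecC τ))
    (le_preimage_top _ W) (le_preimage_top _ U) (rfl : box U W = _))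

theorem box_induction {U : (PP σ).Opens} {W : (PP τ).Opens} (hU : IsAffineOpen U)
    (hW : IsAffineOpen W) (S : Subring Γ(PPProd σ τ, box U W)) (hl : ∀ s, left U W s ∈ S)
    (hr : ∀ r, right U W r ∈ S) (b) : b ∈ S :=
  isPushout_induction (isPushout_box hU hW) S hl hr b

theorem isAffineOpen_torus [Fintype σ] [Nonempty σ] : IsAffineOpen (torus σ) :=
  Proj.isAffineOpen_basicOpen _ _ coordProd_mem sum_two_pos

/-- Polynomials in the functions `x_l / x_i` with coefficients on `W`. -/
def chartPoly (i : σ) (W : (PP τ).Opens) :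
    MvPolynomial {l // l ≠ i} Γ(PP τ, W) →+* Γ(PPProd σ τ, box (chart i) W) :=
  MvPolynomial.eval₂Hom (right (chart i) W) fun l ↦ left (chart i) W (ratio i l)

theorem chartPoly_surjective {W : (PP τ).Opens} (hW : IsAffineOpen W) (i : σ) :
    Function.Surjective (chartPoly i W) := by
  intro b
  refine box_induction (isAffineOpen_chart i) hW (chartPoly i W).range (fun s ↦ ?_)
    (fun r ↦ ⟨MvPolynomial.C r, MvPolynomial.eval₂Hom_C _ _ _⟩) b
  refine chart_induction i ((chartPoly i W).range.comap (left (chart i) W)) (fun c ↦ ?_)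
    (fun l ↦ ?_) s
  · refine ⟨MvPolynomial.C (const τ W c), (MvPolynomial.eval₂Hom_C _ _ _).trans ?_⟩
    rw [right_const, left_const]
  · by_cases hl : l = i
    · subst hl
      exact ⟨1, by rw [map_one, ratio_self, map_one]⟩
    · exact ⟨MvPolynomial.X ⟨l, hl⟩, MvPolynomial.eval₂Hom_X' _ _ _⟩

section expandBox

variable [Fintype σ] [DecidableEq σ] [Nonempty σ]

/-- The expansion as a morphism of `CommRingCat`. -/
def expandHom (R : CommRingCat.{0}) (κ : ℂ →+* R) :
    Γ(PP σ, torus σ) ⟶ CommRingCat.of (Laurent σ R) :=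
  CommRingCat.ofHom (R := Γ(PP σ, torus σ)) (S := Laurent σ R) (expand κ)

/-- The inclusion of the constants as a morphism of `CommRingCat`. -/
def laurentC (σ : Type) (R : CommRingCat.{0}) : R ⟶ CommRingCat.of (Laurent σ R) :=
  CommRingCat.ofHom AddMonoidAlgebra.singleZeroRingHom

/-- The expansion of functions on the product of the torus and an affine open subset as Laurent
polynomials. -/
def expandBox {W : (PP τ).Opens} (hW : IsAffineOpen W) :
    Γ(PPProd σ τ, box (torus σ) W) →+* Laurent σ Γ(PP τ, W) :=
  ((isPushout_box (U := torus σ) isAffineOpen_torus hW).desc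
    (expandHom (σ := σ) Γ(PP τ, W) (const τ W)) (laurentC σ Γ(PP τ, W)) (by
      rw [← cancel_epi (Scheme.ΓSpecIso (CommRingCat.of ℂ)).inv]
      exact CommRingCat.hom_ext (RingHom.ext (expand_const (const τ W))))).hom

variable {W : (PP τ).Opens} (hW : IsAffineOpen W)

theorem expandBox_left (s : Γ(PP σ, torus σ)) :
    expandBox hW (left (torus σ) W s) = expand (const τ W) s :=
  ConcreteCategory.congr_hom ((isPushout_box (isAffineOpen_torus (σ := σ)) hW).inl_desc
    (expandHom (σ := σ) Γ(PP τ, W) (const τ W)) (laurentC σ Γ(PP τ, W)) _) s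

theorem expandBox_right (r : Γ(PP τ, W)) :
    expandBox hW (right (torus σ) W r) = AddMonoidAlgebra.single 0 r :=
  ConcreteCategory.congr_hom ((isPushout_box (isAffineOpen_torus (σ := σ)) hW).inr_desc
    (expandHom (σ := σ) Γ(PP τ, W) (const τ W)) (laurentC σ Γ(PP τ, W)) _) r

/-- The expansion of functions on the product of an open subset containing the torus and an affine
open subset as Laurent polynomials. -/
def expandOn {U : (PP σ).Opens} (hU : torus σ ≤ U) :
    Γ(PPProd σ τ, box U W) →+* Laurent σ Γ(PP τ, W) :=
  (expandBox hW).comp (res (box_mono hU le_rfl))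

theorem expandOn_left {U : (PP σ).Opens} (hU : torus σ ≤ U) (s : Γ(PP σ, U)) :
    expandOn hW hU (left U W s) = expand (const τ W) (res hU s) := by
  rw [expandOn, RingHom.comp_apply, res_left hU le_rfl, expandBox_left]

theorem expandOn_right {U : (PP σ).Opens} (hU : torus σ ≤ U) (r : Γ(PP τ, W)) :
    expandOn hW hU (right U W r) = AddMonoidAlgebra.single 0 r := by
  rw [expandOn, RingHom.comp_apply, res_right hU le_rfl, expandBox_right, res_self]

theorem expandOn_res {U U' : (PP σ).Opens} (hU : torus σ ≤ U) (h : U ≤ U')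
    (b : Γ(PPProd σ τ, box U' W)) :
    expandOn hW hU (res (box_mono h le_rfl) b) = expandOn hW (hU.trans h) b := by
  rw [expandOn, expandOn, RingHom.comp_apply, RingHom.comp_apply, res_res]

theorem expand_ratio {R : Type*} [CommRing R] (κ : ℂ →+* R) (i l : σ) :
    expand κ (res (torus_le_chart i) (ratio i l)) = xpow R l 1 * xpow R i (-1) := by
  have h := expand_awayToSection κ (MvPolynomial.isHomogeneous_X ℂ i)
    (g := MvPolynomial.X i * ∏ l ∈ Finset.univ.erase i, MvPolynomial.X l ^ 2)
    (m' := 1 + ∑ l ∈ Finset.univ.erase i, 2)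
    ((MvPolynomial.isHomogeneous_X ℂ i).mul (MvPolynomial.IsHomogeneous.prod _ _ _
      fun l _ ↦ MvPolynomial.isHomogeneous_X_pow l 2)) (coordProd_eq_X_mul i) (torus_le_chart i) 1
      (MvPolynomial.X l) (MvPolynomial.isHomogeneous_X ℂ l)
  rw [toLaurent_X, toLaurent_X, pow_one] at h
  rw [← h, mul_assoc, xpow_mul_xpow_neg, mul_one]
  rfl

/-- Functions on the product of a chart and an affine open subset have expansions with exponents
of degree zero which are nonnegative away from the index of the chart. -/
theorem expandOn_chart_mem (i : σ) (b : Γ(PPProd σ τ, box (chart i) W)) :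
    expandOn hW (torus_le_chart i) b ∈ expIn Γ(PP τ, W) (cone {i} 0) := by
  refine box_induction (isAffineOpen_chart i) hW ((coneRing _ {i}).comap
    (expandOn hW (torus_le_chart i))) (fun s ↦ ?_) (fun r ↦ ?_) b
  · refine chart_induction i (((coneRing _ {i}).comap
      (expandOn hW (torus_le_chart i))).comap (left (chart i) W)) (fun c ↦ ?_) (fun l ↦ ?_) s
    · change expandOn hW _ (left _ _ _) ∈ expIn Γ(PP τ, W) (cone {i} 0)
      rw [expandOn_left, res_const, expand_const]
      exact single_zero_mem_cone _ _
    · change expandOn hW _ (left _ _ _) ∈ expIn Γ(PP τ, W) (cone {i} 0)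
      rw [expandOn_left, expand_ratio]
      have := mul_mem_cone (show (1 : ℤ) + -1 = 0 by norm_num) (toLaurent_mem (const τ W)
        (MvPolynomial.isHomogeneous_X ℂ l)) (xpow_mem (R := Γ(PP τ, W)) i (-1))
      rwa [toLaurent_X, Set.empty_union] at this
  · change expandOn hW _ (right _ _ _) ∈ expIn Γ(PP τ, W) (cone {i} 0)
    rw [expandOn_right]
    exact single_zero_mem_cone _ _

/-- Such a function is a form divided by a power of `x_i x_j`, which makes only the exponents at `i`
and `j` possibly negative. The open subset is a variable with an equation so that it can be replaced
by a basic open subset. -/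
theorem expand_overlap_mem {R : Type*} [CommRing R] (κ : ℂ →+* R) {i j : σ} (hij : i ≠ j)
    {U : (PP σ).Opens} (hU : U = Proj.basicOpen (MvPolynomial.homogeneousSubmodule σ ℂ)
      (MvPolynomial.X i * MvPolynomial.X j)) (h : torus σ ≤ U) (s : Γ(PP σ, U)) :
    expand κ (res h s) ∈ expIn R (cone {i, j} 0) := by
  subst hU
  have hX := (MvPolynomial.isHomogeneous_X ℂ i).mul (MvPolynomial.isHomogeneous_X ℂ j)
  obtain ⟨y, rfl⟩ : ∃ y, Proj.awayToSection (MvPolynomial.homogeneousSubmodule σ ℂ)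
      (MvPolynomial.X i * MvPolynomial.X j) y = s :=
    ⟨_, ConcreteCategory.congr_hom (Proj.basicOpenIsoAway _ _ hX two_pos).inv_hom_id s⟩
  obtain ⟨n, a, ha, rfl⟩ := HomogeneousLocalization.Away.mk_surjective _ hX y
  have h := expand_awayToSection κ hX
    (g := MvPolynomial.X i * MvPolynomial.X j *
      ∏ l ∈ (Finset.univ.erase i).erase j, MvPolynomial.X l ^ 2)
    (m' := 1 + 1 + ∑ l ∈ (Finset.univ.erase i).erase j, 2)
    (hX.mul (MvPolynomial.IsHomogeneous.prod _ _ _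
      fun l _ ↦ MvPolynomial.isHomogeneous_X_pow l 2)) (coordProd_eq_X_mul_X_mul hij) h n a ha
  rw [map_mul, toLaurent_X, toLaurent_X, mul_pow, xpow_pow, xpow_pow] at h
  have h2 := congrArg (· * (xpow R i (-(n * 1)) * xpow R j (-(n * 1)))) h
  simp only at h2
  rw [mul_assoc, mul_mul_mul_comm, xpow_mul_xpow_neg, xpow_mul_xpow_neg, mul_one, mul_one] at h2
  rw [h2]
  have h3 := mul_mem_cone rfl (xpow_mem (R := R) i (-(n * 1))) (xpow_mem (R := R) j (-(n * 1)))
  have h4 := mul_mem_cone (l := 0) (by push_cast [smul_eq_mul]; ring) (toLaurent_mem κ ha) h3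
  rwa [Set.empty_union] at h4

/-- Functions on the product of the intersection of two charts and an affine open subset have
expansions with exponents of degree zero which are nonnegative away from the indices of the
charts. -/
theorem expandOn_overlap_mem {i j : σ} (hij : i ≠ j)
    (b : Γ(PPProd σ τ, box (chart i ⊓ chart j) W)) :
    expandOn hW (torus_le_overlap i j) b ∈ expIn Γ(PP τ, W) (cone {i, j} 0) := by
  refine box_induction (isAffineOpen_chart_inf i j) hW ((coneRing _ {i, j}).comap
    (expandOn hW (torus_le_overlap i j))) (fun s ↦ ?_) (fun r ↦ ?_) b
  · change expandOn hW _ (left _ _ _) ∈ expIn Γ(PP τ, W) (cone {i, j} 0)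
    rw [expandOn_left]
    exact expand_overlap_mem _ hij (chart_inf_chart i j) _ _
  · change expandOn hW _ (right _ _ _) ∈ expIn Γ(PP τ, W) (cone {i, j} 0)
    rw [expandOn_right]
    exact single_zero_mem_cone _ _

theorem expandOn_chartPoly_monomial (i : σ) (e : {l // l ≠ i} →₀ ℕ) (r : Γ(PP τ, W)) :
    expandOn hW (torus_le_chart i) (chartPoly i W (MvPolynomial.monomial e r)) =
      AddMonoidAlgebra.single (chartExponent i e) r := by
  rw [chartPoly, MvPolynomial.coe_eval₂Hom, MvPolynomial.eval₂_monomial,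
    Finsupp.prod_fintype _ _ (by simp), map_mul, map_prod, expandOn_right]
  simp only [map_pow, expandOn_left, expand_ratio]
  simp only [xpow, AddMonoidAlgebra.single_mul_single, AddMonoidAlgebra.single_pow, one_pow,
    mul_one, AddMonoidAlgebra.prod_single, Finset.prod_const_one, zero_add]
  rfl

/-- Distinct monomials in the ratios have distinct Laurent exponents, so the polynomial can be
recovered from its expansion. With surjectivity of `chartPoly` this makes the expansion injective on
charts. -/
theorem expandOn_chartPoly_coeff (i : σ) (p : MvPolynomial {l // l ≠ i} Γ(PP τ, W))
    (e : {l // l ≠ i} →₀ ℕ) :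
    (expandOn hW (torus_le_chart i) (chartPoly i W p)).coeff (chartExponent i e) = p.coeff e := by
  classical
  induction p using MvPolynomial.induction_on' with
  | monomial e' r =>
    rw [expandOn_chartPoly_monomial, AddMonoidAlgebra.coeff_single, Finsupp.single_apply,
      MvPolynomial.coeff_monomial]
    simp only [(chartExponent_injective i).eq_iff]
  | add p q hp hq =>
    rw [map_add, map_add, AddMonoidAlgebra.coeff_add, Finsupp.add_apply, hp, hq,
      MvPolynomial.coeff_add]

theorem expandOn_chart_injective (i : σ) :
    Function.Injective (expandOn hW (torus_le_chart i)) := by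
  rw [injective_iff_map_eq_zero]
  intro b hb
  obtain ⟨p, rfl⟩ := chartPoly_surjective hW i b
  have : p = 0 := MvPolynomial.ext _ _ fun e ↦ by
    rw [← expandOn_chartPoly_coeff hW, hb]
    simp
  rw [this, map_zero]

/-- Monomial by monomial, the exponents away from `i` are those of a monomial in the ratios, and
degree zero takes care of the exponent at `i`. With `expandOn_chart_mem` this describes the image of
the expansion exactly. -/
theorem exists_expandOn_chart_eq (i : σ) {p : Laurent σ Γ(PP τ, W)}
    (hp : p ∈ expIn Γ(PP τ, W) (cone {i} 0)) :
    ∃ b, expandOn hW (torus_le_chart i) b = p := by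
  classical
  suffices h : p ∈ (expandOn hW (torus_le_chart i)).range from h
  have hsum : p = ∑ e ∈ p.coeff.support, AddMonoidAlgebra.single e (p.coeff e) := by
    refine AddMonoidAlgebra.ext ?_
    rw [AddMonoidAlgebra.coeff_sum]
    simp only [AddMonoidAlgebra.coeff_single]
    exact (Finsupp.sum_single p.coeff).symm
  rw [hsum]
  refine sum_mem fun e he ↦ ?_
  have he' := hp e (Finsupp.mem_support_iff.mp he)
  refine ⟨chartPoly i W (MvPolynomial.monomial
    (Finsupp.equivFunOnFinite.symm fun l ↦ (e l.1).toNat) (p.coeff e)), ?_⟩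
  rw [expandOn_chartPoly_monomial, chartExponent_eq he'.1 fun l ↦ ?_]
  exact Int.toNat_of_nonneg (he'.2 l.1 l.2)

end expandBox

end Product

/-! ## Ideal sheaves cut out by an equation on an affine open subset -/

section PrincipalIdeal

/-- The two open subsets are equal; two inclusions in place of an equation avoid transport of
sections. -/
theorem mem_span_res_iff {X : Scheme.{u}} {V V' U : X.Opens} (h : V ≤ V') (h' : V' ≤ V)
    (hU : V' ≤ U) (e : Γ(X, U)) (a : Γ(X, V')) :
    res h a ∈ Ideal.span {res (h.trans hU) e} ↔ a ∈ Ideal.span {res hU e} := by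
  obtain rfl : V = V' := le_antisymm h h'
  rw [res_self]

theorem image_preimage_le {X : Scheme.{u}} (U W : X.Opens) : U.ι ''ᵁ U.ι ⁻¹ᵁ W ≤ W ⊓ U := by
  rintro _ ⟨y, hy, rfl⟩
  exact ⟨hy, y.2⟩

theorem le_image_preimage {X : Scheme.{u}} (U W : X.Opens) : W ⊓ U ≤ U.ι ''ᵁ U.ι ⁻¹ᵁ W :=
  fun x hx ↦ ⟨⟨x, hx.2⟩, hx.1, rfl⟩

variable {X : Scheme.{u}} [X.IsSeparated]

/-- A function on `U` as a global function on the open subscheme `U`. -/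
def toOpen {X : Scheme.{u}} (U : X.Opens) (e : Γ(X, U)) : Γ(U, ⊤) := res (U.ι_image_le ⊤) e

/-- A function on `U` as a function on an open subset of the open subscheme `U`. -/
def toOpenOn {X : Scheme.{u}} (U : X.Opens) (e : Γ(X, U)) (V : (U : Scheme.{u}).Opens) : Γ(U, V) :=
  res (U.ι_image_le V) e

theorem res_toOpen {X : Scheme.{u}} (U : X.Opens) (e : Γ(X, U)) (V : (U : Scheme.{u}).Opens) :
    res (X := U) (le_top : V ≤ ⊤) (toOpen U e) = toOpenOn U e V :=
  show res (X := X) (U.ι.image_mono le_top) (res (U.ι_image_le ⊤) e) = _ from res_res _ _ e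

/-- The functions whose restriction to `U` is a multiple of `e`. -/
def principalIdeal (U : X.Opens) (e : Γ(X, U)) : X.IdealSheafData :=
  (Scheme.IdealSheafData.ofIdealTop (X := U) (Ideal.span {toOpen U e})).map U.ι

/-- The ideal sheaf is the kernel of the composite of the closed immersion into `U` cut out by `e`
with the inclusion of `U`. On `W` it is computed on `W ⊓ U`, which is affine because `X` is
separated. -/
theorem mem_principalIdeal {U : X.Opens} (hU : IsAffineOpen U) (e : Γ(X, U)) (W : X.affineOpens)
    (a : Γ(X, W)) : a ∈ (principalIdeal U e).ideal W ↔
      res (inf_le_left : W.1 ⊓ U ≤ W.1) a ∈ Ideal.span {res (inf_le_right : W.1 ⊓ U ≤ U) e} := by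
  have : IsAffine U := hU
  have hW : IsAffineOpen (U.ι ⁻¹ᵁ W.1) := by
    have h := (W.2.inf hU).preimage_of_isOpenImmersion U.ι (by simp)
    rwa [Scheme.Hom.preimage_inf, Scheme.Opens.ι_preimage_self, inf_top_eq] at h
  rw [principalIdeal, Scheme.IdealSheafData.map, Scheme.Hom.ker_apply, RingHom.mem_ker,
    Scheme.Hom.comp_app]
  have h1 : U.ι.app W.1 a ∈ RingHom.ker ((Scheme.IdealSheafData.ofIdealTop (X := U)
      (Ideal.span {toOpen U e})).subschemeι.app (U.ι ⁻¹ᵁ W.1)).hom ↔ U.ι.app W.1 a ∈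
        Ideal.span {toOpenOn U e (U.ι ⁻¹ᵁ W.1)} := by
    rw [Scheme.IdealSheafData.ker_subschemeι_app _ ⟨U.ι ⁻¹ᵁ W.1, hW⟩, ← res_toOpen,
      ← Set.image_singleton (f := res _), ← Ideal.map_span]
    rfl
  refine h1.trans ?_
  have h3 := mem_span_res_iff (image_preimage_le U W.1) (le_image_preimage U W.1) inf_le_right e
    (res inf_le_left a)
  rw [res_res] at h3
  exact h3

end PrincipalIdeal
/-! ## Pull-back of functions -/

section pull

variable {X Y Z : Scheme.{u}}

/-- Pull-back of functions along a morphism. -/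
abbrev pull (q : X ⟶ Y) {U : Y.Opens} {V : X.Opens} (h : V ≤ q ⁻¹ᵁ U) : Γ(Y, U) →+* Γ(X, V) :=
  (q.appLE U V h).hom

theorem res_pull (q : X ⟶ Y) {U : Y.Opens} {V V' : X.Opens} (h : V ≤ q ⁻¹ᵁ U) (h' : V' ≤ V)
    (s : Γ(Y, U)) : res h' (pull q h s) = pull q (h'.trans h) s := by
  simp only [pull, res]
  rw [← CommRingCat.comp_apply, Scheme.Hom.appLE_map]

theorem pull_res (q : X ⟶ Y) {U U' : Y.Opens} {V : X.Opens} (h : V ≤ q ⁻¹ᵁ U) (h' : U ≤ U')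
    (s : Γ(Y, U')) : pull q h (res h' s) = pull q (h.trans fun _ hx ↦ h' hx) s := by
  simp only [pull, res]
  rw [← CommRingCat.comp_apply, Scheme.Hom.map_appLE]

theorem res_app (q : X ⟶ Y) {U : Y.Opens} {V : X.Opens} (h : V ≤ q ⁻¹ᵁ U) (s : Γ(Y, U)) :
    res h (q.app U s) = pull q h s := rfl

theorem app_eq_pull (q : X ⟶ Y) {U : Y.Opens} (s : Γ(Y, U)) :
    q.app U s = pull q (le_refl (q ⁻¹ᵁ U)) s := by
  rw [← res_app, res_self]

theorem pull_comp (p : X ⟶ Y) (q : Y ⟶ Z) {U : Z.Opens} {W : Y.Opens} {V : X.Opens}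
    (h : W ≤ q ⁻¹ᵁ U) (h' : V ≤ p ⁻¹ᵁ W) (s : Γ(Z, U)) :
    pull p h' (pull q h s) = pull (p ≫ q) (h'.trans fun _ hx ↦ h hx) s := by
  simp only [pull]
  rw [← CommRingCat.comp_apply, Scheme.Hom.appLE_comp_appLE]

variable {σ : Type} {X : Scheme.{0}}

theorem pull_ratio_mul (q : X ⟶ PP σ) {i j : σ} (l : σ) {V : X.Opens} (hi : V ≤ q ⁻¹ᵁ chart i)
    (hj : V ≤ q ⁻¹ᵁ chart j) :
    pull q hi (ratio i j) * pull q hj (ratio j l) = pull q hi (ratio i l) := by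
  have h : V ≤ q ⁻¹ᵁ (chart i ⊓ chart j) := le_inf hi hj
  rw [← pull_res q h inf_le_left, ← pull_res q h inf_le_right, ← map_mul,
    ratio_mul_ratio, pull_res]

end pull

/-! ## The ideal of the universal hypersurface -/

section universalIdeal

instance {σ τ : Type} : (PPProd σ τ).IsSeparated := by
  have : IsSeparated (toSpecC σ) := by unfold toSpecC; infer_instance
  have : IsSeparated (toSpecC τ) := by unfold toSpecC; infer_instance
  refine ⟨?_⟩
  rw [← terminal.comp_from (pullback.fst (toSpecC σ) (toSpecC τ) ≫ toSpecC σ)]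
  infer_instance

variable {n d : ℕ}

theorem sum_exponent (I : Exponent n d) : ∑ l, I.1 l = d :=
  (Finset.mem_finsuppAntidiag.mp I.2).1

theorem isAffineOpen_ambientChart (i : Fin (n + 1)) (J : Exponent n d) :
    IsAffineOpen (ambientChart i J) :=
  isAffineOpen_box (isAffineOpen_chart i) (isAffineOpen_chart J)

theorem ambientChart_le_left (i : Fin (n + 1)) (J : Exponent n d) :
    ambientChart i J ≤ prPn n d ⁻¹ᵁ chart i := inf_le_left

theorem ambientChart_le_right (i : Fin (n + 1)) (J : Exponent n d) :
    ambientChart i J ≤ prLinSys n d ⁻¹ᵁ chart J := inf_le_right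

theorem localEquation_eq (i : Fin (n + 1)) (J : Exponent n d) :
    localEquation i J = ∑ I : Exponent n d,
      pull (prLinSys n d) (ambientChart_le_right i J) (ratio J I) *
        ∏ l, pull (prPn n d) (ambientChart_le_left i J) (ratio i l) ^ I.1 l := rfl

theorem res_localEquation {V : (Ambient n d).Opens} {i : Fin (n + 1)} {J : Exponent n d}
    (h : V ≤ ambientChart i J) : res h (localEquation i J) = ∑ I : Exponent n d,
      pull (prLinSys n d) (h.trans (ambientChart_le_right i J)) (ratio J I) *
        ∏ l, pull (prPn n d) (h.trans (ambientChart_le_left i J)) (ratio i l) ^ I.1 l := by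
  simp only [localEquation_eq, map_sum, map_mul, map_prod, map_pow, res_pull]

/-- Two local equations differ by a unit. -/
theorem res_localEquation_eq {V : (Ambient n d).Opens} {i i' : Fin (n + 1)} {J J' : Exponent n d}
    (h : V ≤ ambientChart i J) (h' : V ≤ ambientChart i' J') : res h (localEquation i J) =
      pull (prLinSys n d) (h.trans (ambientChart_le_right i J)) (ratio J J') *
        pull (prPn n d) (h.trans (ambientChart_le_left i J)) (ratio i i') ^ d *
          res h' (localEquation i' J') := by
  rw [res_localEquation, res_localEquation, Finset.mul_sum]
  refine Finset.sum_congr rfl fun I _ ↦ ?_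
  rw [← pull_ratio_mul (prLinSys n d) I (h.trans (ambientChart_le_right i J))
    (h'.trans (ambientChart_le_right i' J'))]
  have h1 (l : Fin (n + 1)) := pull_ratio_mul (prPn n d) (i := i) (j := i') l
    (h.trans (ambientChart_le_left i J)) (h'.trans (ambientChart_le_left i' J'))
  rw [Finset.prod_congr rfl fun l _ ↦ congrArg (· ^ I.1 l) (h1 l).symm]
  simp only [mul_pow]
  rw [Finset.prod_mul_distrib, Finset.prod_pow_eq_pow_sum, sum_exponent]
  ring

theorem mem_of_mem_universalIdeal (U : (Ambient n d).affineOpens) {i : Fin (n + 1)}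
    {J : Exponent n d} (h : U.1 ≤ ambientChart i J) {a : Γ(Ambient n d, U)}
    (ha : a ∈ (universalIdeal n d).ideal U) : a ∈ Ideal.span {res h (localEquation i J)} := by
  have h1 := Scheme.IdealSheafData.ideal_ofIdeals_le _ U ha
  simp only [Submodule.mem_iInf] at h1
  exact (mem_span_res_iff inf_le_left (le_inf le_rfl h) h (localEquation i J) a).mp (h1 i J)

/-- `ofIdeals` is the largest ideal sheaf inside the prescribed ideals and might be too small. The
intersection of the principal ideal sheaves of all charts lies below it, and contains the local
equation because each local equation is a multiple of any other on the overlap. -/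
theorem localEquation_mem (i : Fin (n + 1)) (J : Exponent n d) : localEquation i J ∈
    (universalIdeal n d).ideal ⟨ambientChart i J, isAffineOpen_ambientChart i J⟩ := by
  have h : ⨅ p : Fin (n + 1) × Exponent n d,
      principalIdeal (ambientChart p.1 p.2) (localEquation p.1 p.2) ≤ universalIdeal n d := by
    refine Scheme.IdealSheafData.le_ofIdeals_iff.mpr fun W a ha ↦ ?_
    rw [Scheme.IdealSheafData.ideal_iInf, iInf_apply, Submodule.mem_iInf] at ha
    simp only [Submodule.mem_iInf]
    exact fun i J ↦ (mem_principalIdeal (isAffineOpen_ambientChart i J) _ _ _).mp (ha (i, J))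
  refine h ⟨_, isAffineOpen_ambientChart i J⟩ ?_
  rw [Scheme.IdealSheafData.ideal_iInf, iInf_apply, Submodule.mem_iInf]
  rintro ⟨i', J'⟩
  refine (mem_principalIdeal (isAffineOpen_ambientChart i' J') _ _ _).mpr ?_
  rw [Ideal.mem_span_singleton]
  exact Dvd.intro_left _ (res_localEquation_eq inf_le_left inf_le_right).symm

theorem mem_universalIdeal (U : (Ambient n d).affineOpens) {i : Fin (n + 1)}
    {J : Exponent n d} (h : U.1 ≤ ambientChart i J) {a : Γ(Ambient n d, U)} :
    a ∈ (universalIdeal n d).ideal U ↔ a ∈ Ideal.span {res h (localEquation i J)} := by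
  refine ⟨mem_of_mem_universalIdeal U h, fun ha ↦ ?_⟩
  refine (Ideal.span_singleton_le_iff_mem _).mpr ?_ ha
  exact (universalIdeal n d).ideal_le_comap_ideal (U := U)
    (V := ⟨ambientChart i J, isAffineOpen_ambientChart i J⟩) h (localEquation_mem i J)

end universalIdeal

/-! ## Affine open subsets of projective space -/

section basis

variable {τ : Type}

/-- Homogeneous fractions embed in the localization of the polynomial ring at `x_J`. Domains are
needed as coefficient rings in order to cancel the universal equation. -/
instance isDomain_chart (J : τ) : IsDomain Γ(PP τ, chart J) := by
  have e := (Proj.basicOpenIsoAway (MvPolynomial.homogeneousSubmodule τ ℂ) _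
    (MvPolynomial.isHomogeneous_X ℂ J) Nat.one_pos).commRingCatIsoToRingEquiv
  have : IsDomain (Localization.Away (MvPolynomial.X J : MvPolynomial τ ℂ)) :=
    IsLocalization.isDomain_localization
      (powers_le_nonZeroDivisors_of_noZeroDivisors (MvPolynomial.X_ne_zero J))
  have : IsDomain (HomogeneousLocalization.Away (MvPolynomial.homogeneousSubmodule τ ℂ)
      (MvPolynomial.X J)) :=
    (HomogeneousLocalization.val_injective _).isDomain (algebraMap _ (Localization.Away
      (MvPolynomial.X J : MvPolynomial τ ℂ)))
  exact e.symm.injective.isDomain e.symm.toRingHom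

/-- Projective space has a basis of affine open subsets whose rings of functions are domains. -/
theorem exists_isDomain (V : (PP τ).Opens) (x : PP τ) (hx : x ∈ V) :
    ∃ (W : (PP τ).Opens) (J : τ), x ∈ W ∧ W ≤ V ∧ W ≤ chart J ∧ IsAffineOpen W ∧
      IsDomain Γ(PP τ, W) := by
  obtain ⟨J, hJ⟩ := exists_mem_chart x
  obtain ⟨f, hf, hxf⟩ := (isAffineOpen_chart J).exists_basicOpen_le (⟨x, hx⟩ : V) hJ
  refine ⟨_, J, hxf, hf, (PP τ).basicOpen_le f, (isAffineOpen_chart J).basicOpen f, ?_⟩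
  have := (isAffineOpen_chart J).isLocalization_basicOpen f
  refine IsLocalization.isDomain_of_le_nonZeroDivisors (M := .powers f) _
    (powers_le_nonZeroDivisors_of_noZeroDivisors ?_)
  -- The zero function has an empty basic open subset, whereas this one contains `x`.
  rintro rfl
  simp at hxf

end basis

/-! ## Sections of twisting sheaves -/

section twist

variable {σ : Type} {X : Scheme.{0}} {q : X ⟶ PP σ} {m : ℤ}

/-- The local coordinate of a section of `q^* 𝒪(m)` on the preimage of a chart. -/
def coord (q : X ⟶ PP σ) (m : ℤ) {V : X.Opens} (i : σ) :
    Γ(twist q m, V) →+ Γ(X, V ⊓ q ⁻¹ᵁ chart i) where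
  toFun s := (show cocycleSections _ _ V from s).1 i
  map_zero' := rfl
  map_add' _ _ := rfl

theorem coord_ext {V : X.Opens} {s t : Γ(twist q m, V)} (h : ∀ i, coord q m i s = coord q m i t) :
    s = t :=
  Subtype.ext (funext h)

theorem le_preimage_inf {V : X.Opens} {U U' : (PP σ).Opens} (h : V ≤ q ⁻¹ᵁ U) (h' : V ≤ q ⁻¹ᵁ U') :
    V ≤ q ⁻¹ᵁ (U ⊓ U') := le_inf h h'

theorem pull_transition (k : ℕ) (i j : σ) {V : X.Opens} (hi : V ≤ q ⁻¹ᵁ chart i)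
    (hj : V ≤ q ⁻¹ᵁ chart j) :
    pull q (le_preimage_inf hi hj) (transition k i j) = pull q hi (ratio i j) ^ k := by
  rw [transition, map_mul, map_pow, map_pow, pull_res, pull_res]
  simp

/-- The local coordinates of a section differ by the transition functions. -/
theorem res_coord (k : ℕ) {V W : X.Opens} (s : Γ(twist q k, V)) (i j : σ)
    (hi : W ≤ V ⊓ q ⁻¹ᵁ chart i) (hj : W ≤ V ⊓ q ⁻¹ᵁ chart j) :
    res hi (coord q k i s) = pull q (hi.trans inf_le_right) (ratio i j) ^ k *
      res hj (coord q k j s) := by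
  have hi' : V ⊓ (q ⁻¹ᵁ chart i ⊓ q ⁻¹ᵁ chart j) ≤ q ⁻¹ᵁ chart i :=
    inf_le_right.trans inf_le_left
  have hj' : V ⊓ (q ⁻¹ᵁ chart i ⊓ q ⁻¹ᵁ chart j) ≤ q ⁻¹ᵁ chart j :=
    inf_le_right.trans inf_le_right
  have h : res (inf_le_inf_left V inf_le_left) (coord q k i s) =
      pull q (le_preimage_inf hi' hj') (transition k i j) *
      res (inf_le_inf_left V inf_le_right) (coord q k j s) :=
    (show cocycleSections _ _ V from s).2 i j
  have h2 := congrArg (res (le_inf (hi.trans inf_le_left)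
    (le_inf (hi.trans inf_le_right) (hj.trans inf_le_right)) :
      W ≤ V ⊓ (q ⁻¹ᵁ chart i ⊓ q ⁻¹ᵁ chart j))) h
  rwa [map_mul, res_res, res_res, pull_transition k i j hi' hj', map_pow, res_pull] at h2

/-- A section of `q^* 𝒪(k)` from its local coordinates. -/
def twistMk (q : X ⟶ PP σ) (k : ℕ) (V : X.Opens) (a : ∀ i, Γ(X, V ⊓ q ⁻¹ᵁ chart i))
    (ha : ∀ i j, res (inf_le_inf_left V inf_le_left) (a i) =
      pull q ((inf_le_right : V ⊓ (q ⁻¹ᵁ chart i ⊓ q ⁻¹ᵁ chart j) ≤ _).trans inf_le_left)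
        (ratio i j) ^ k * res (inf_le_inf_left V inf_le_right) (a j)) :
    Γ(twist q k, V) :=
  (show cocycleSections _ _ V from ⟨a, fun i j ↦ by
    rw [ha i j, ← pull_transition k i j (inf_le_right.trans inf_le_left)
      (inf_le_right.trans inf_le_right)]
    rfl⟩)

/-- The section of `q^* 𝒪(k)` given by a monomial of degree `k`. -/
def monomialSection [Fintype σ] (q : X ⟶ PP σ) (k : ℕ) (e : σ → ℕ) (he : ∑ l, e l = k) :
    Γ(twist q k, ⊤) :=
  twistMk q k ⊤ (fun i ↦ ∏ l, pull q inf_le_right (ratio i l) ^ e l) fun i j ↦ by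
    simp only [map_prod, map_pow, res_pull]
    rw [← he, ← Finset.prod_pow_eq_pow_sum, ← Finset.prod_mul_distrib]
    refine Finset.prod_congr rfl fun l _ ↦ ?_
    rw [← mul_pow, pull_ratio_mul]

theorem coord_monomialSection [Fintype σ] (k : ℕ) (e : σ → ℕ) (he : ∑ l, e l = k) (i : σ) :
    coord q k i (monomialSection q k e he) = ∏ l, pull q inf_le_right (ratio i l) ^ e l := rfl

end twist

/-! ### Sections of push-forwards. -/

section pushforward

variable {X Y : Scheme.{u}} (f : X ⟶ Y) (M : X.Modules)

/-- A section of a push-forward as a section of the original sheaf. -/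
def ofPushforward {V : Y.Opens} : Γ((Scheme.Modules.pushforward f).obj M, V) →+ Γ(M, f ⁻¹ᵁ V) where
  toFun s := s
  map_zero' := rfl
  map_add' _ _ := rfl

/-- A section of a sheaf as a section of its push-forward. -/
def toPushforward {V : Y.Opens} : Γ(M, f ⁻¹ᵁ V) →+ Γ((Scheme.Modules.pushforward f).obj M, V) where
  toFun s := s
  map_zero' := rfl
  map_add' _ _ := rfl

theorem ofPushforward_injective {V : Y.Opens} :
    Function.Injective (ofPushforward f M (V := V)) := fun _ _ h ↦ h

end pushforward

/-! ## Forms on a product with a projective space -/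

section formOn

variable {n : ℕ} {τ : Type}

/-- An exponent as the exponent of a Laurent monomial. -/
def laurentExponent {m : ℕ} (b : Exponent n m) : Fin (n + 1) → ℤ := fun l ↦ b.1 l

theorem laurentExponent_injective {m : ℕ} :
    Function.Injective (laurentExponent : Exponent n m → Fin (n + 1) → ℤ) := fun _ _ h ↦
  Subtype.ext (Finsupp.ext fun l ↦ Nat.cast_injective (R := ℤ) (congrFun h l))

theorem laurentExponent_mem_cone {m : ℕ} (b : Exponent n m) :
    laurentExponent b ∈ cone (∅ : Set (Fin (n + 1))) m :=
  ⟨by simp only [laurentExponent]; rw [← Nat.cast_sum, sum_exponent], fun _ _ ↦ Nat.cast_nonneg _⟩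

theorem exists_finsupp_eq {σ : Type} [Fintype σ] {m : ℤ} {e : σ → ℤ}
    (he : e ∈ cone (∅ : Set σ) m) :
    ∃ b : σ →₀ ℕ, (fun l ↦ (b l : ℤ)) = e ∧ ((∑ l, b l : ℕ) : ℤ) = m := by
  have h (l : σ) : ((e l).toNat : ℤ) = e l := Int.toNat_of_nonneg (he.2 l (Set.notMem_empty l))
  refine ⟨Finsupp.equivFunOnFinite.symm fun l ↦ (e l).toNat, funext h, ?_⟩
  rw [Nat.cast_sum, ← he.1]
  exact Finset.sum_congr rfl fun l _ ↦ h l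

theorem exists_laurentExponent_eq {m : ℕ} {e : Fin (n + 1) → ℤ}
    (he : e ∈ cone (∅ : Set (Fin (n + 1))) m) : ∃ b : Exponent n m, laurentExponent b = e := by
  obtain ⟨b, rfl, hb⟩ := exists_finsupp_eq he
  exact ⟨⟨b, Finset.mem_finsuppAntidiag.mpr ⟨by exact_mod_cast hb, by simp⟩⟩, rfl⟩

/-- The Laurent polynomial with the given coefficients. -/
def laurentForm {R : Type*} [CommRing R] {m : ℕ} (c : Exponent n m → R) :
    Laurent (Fin (n + 1)) R :=
  ∑ b, AddMonoidAlgebra.single (laurentExponent b) (c b)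

theorem laurentForm_mem {R : Type*} [CommRing R] {m : ℕ} (c : Exponent n m → R) :
    laurentForm c ∈ expIn R (cone ∅ m) :=
  sum_mem fun b _ ↦ single_mem_expIn (laurentExponent_mem_cone b) _

theorem coeff_laurentForm {R : Type*} [CommRing R] {m : ℕ} (c : Exponent n m → R)
    (b : Exponent n m) : (laurentForm c).coeff (laurentExponent b) = c b := by
  rw [laurentForm, AddMonoidAlgebra.coeff_sum, Finsupp.finsetSum_apply, Finset.sum_eq_single b]
  · simp
  · intro b' _ h
    rw [AddMonoidAlgebra.coeff_single, Finsupp.single_eq_of_ne]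
    exact fun h' ↦ h (laurentExponent_injective h'.symm)
  · simp

theorem exists_eq_laurentForm {R : Type*} [CommRing R] {m : ℕ} {P : Laurent (Fin (n + 1)) R}
    (hP : P ∈ expIn R (cone ∅ m)) : ∃ c : Exponent n m → R, P = laurentForm c :=
  ⟨_, eq_sum_single laurentExponent laurentExponent_injective
    (fun _ he ↦ exists_laurentExponent_eq he) hP⟩

/-- The function `∑ b, c b * x ^ b / x_i ^ m` on the product of a chart and an open subset. -/
def formOn {W : (PP τ).Opens} {m : ℕ} (c : Exponent n m → Γ(PP τ, W)) (i : Fin (n + 1)) :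
    Γ(PPProd (Fin (n + 1)) τ, box (chart i) W) :=
  ∑ b, right (chart i) W (c b) * ∏ l, left (chart i) W (ratio i l) ^ b.1 l

/-- Multiplication by `x_i ^ m` undoes the dehomogenization, so the result no longer depends on the
chart. -/
theorem expandOn_formOn {W : (PP τ).Opens} (hW : IsAffineOpen W) {m : ℕ}
    (c : Exponent n m → Γ(PP τ, W)) (i : Fin (n + 1)) :
    expandOn hW (torus_le_chart i) (formOn c i) * xpow Γ(PP τ, W) i m = laurentForm c := by
  rw [formOn, map_sum, Finset.sum_mul, laurentForm]
  refine Finset.sum_congr rfl fun b _ ↦ ?_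
  simp only [map_mul, map_prod, map_pow, expandOn_right, expandOn_left, expand_ratio, mul_pow,
    xpow_pow]
  rw [Finset.prod_mul_distrib]
  have h1 : ∏ l, xpow Γ(PP τ, W) i ((b.1 l : ℤ) * -1) = xpow Γ(PP τ, W) i (-m) := by
    have : ∏ l, xpow Γ(PP τ, W) i (-1) ^ b.1 l = _ := Finset.prod_pow_eq_pow_sum _ _ _
    rw [sum_exponent] at this
    simpa [xpow_pow] using this
  rw [h1, mul_assoc, mul_assoc, mul_comm (xpow _ i (-m)), xpow_mul_xpow_neg, mul_one]
  simp only [mul_one]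
  rw [prod_xpow (fun l ↦ (b.1 l : ℤ)), AddMonoidAlgebra.single_mul_single, zero_add, mul_one]
  rfl

theorem box_le_ambientChart {d : ℕ} {U : (Pn n).Opens} {W : (LinSys n d).Opens} {i : Fin (n + 1)}
    {J : Exponent n d} (hi : U ≤ chart i) (hJ : W ≤ chart J) : box U W ≤ ambientChart i J :=
  box_mono hi hJ

theorem res_localEquation_eq_formOn {d : ℕ} {W : (LinSys n d).Opens} {J : Exponent n d}
    (hW : W ≤ chart J) (i : Fin (n + 1)) :
    res (box_le_ambientChart le_rfl hW) (localEquation i J) =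
      formOn (fun I ↦ res hW (ratio J I)) i := by
  rw [res_localEquation, formOn]
  refine Finset.sum_congr rfl fun I _ ↦ congrArg₂ (· * ·) ?_ rfl
  exact (pull_res _ (box_le_right _ _) _ _).symm

end formOn

/-! ## Sections of the Verlinde bundle -/

section Verlinde

variable {n d : ℕ}

/-- `V` is the preimage of `U`, given by two inclusions because in the applications it is an
intersection of two preimages. -/
theorem pull_subschemeι_eq_zero {X : Scheme.{u}} (I : X.IdealSheafData) {U : X.Opens}
    (hU : IsAffineOpen U) {V : I.subscheme.Opens} (h : V ≤ I.subschemeι ⁻¹ᵁ U)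
    (h' : I.subschemeι ⁻¹ᵁ U ≤ V) (a : Γ(X, U)) :
    pull I.subschemeι h a = 0 ↔ a ∈ I.ideal ⟨U, hU⟩ := by
  obtain rfl : V = I.subschemeι ⁻¹ᵁ U := le_antisymm h h'
  rw [← I.ker_subschemeι_app ⟨U, hU⟩, RingHom.mem_ker, ← app_eq_pull]

theorem exists_pull_subschemeι_eq {X : Scheme.{u}} (I : X.IdealSheafData) {U : X.Opens}
    (hU : IsAffineOpen U) {V : I.subscheme.Opens} (h : V ≤ I.subschemeι ⁻¹ᵁ U)
    (h' : I.subschemeι ⁻¹ᵁ U ≤ V) (s : Γ(I.subscheme, V)) : ∃ a, pull I.subschemeι h a = s := by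
  obtain rfl : V = I.subschemeι ⁻¹ᵁ U := le_antisymm h h'
  obtain ⟨a, ha⟩ := I.subschemeι_app_surjective ⟨U, hU⟩ s
  exact ⟨a, by rw [← app_eq_pull, ha]⟩

theorem preimage_le_box (U : (Pn n).Opens) (W : (LinSys n d).Opens) :
    family n d ⁻¹ᵁ W ⊓ toPn n d ⁻¹ᵁ U ≤ (universalIdeal n d).subschemeι ⁻¹ᵁ box U W :=
  fun _ hx ↦ ⟨hx.2, hx.1⟩

theorem box_le_preimage (U : (Pn n).Opens) (W : (LinSys n d).Opens) :
    (universalIdeal n d).subschemeι ⁻¹ᵁ box U W ≤ family n d ⁻¹ᵁ W ⊓ toPn n d ⁻¹ᵁ U :=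
  fun _ hx ↦ ⟨hx.2, hx.1⟩

/-- The functions on the ambient space that vanish on the universal hypersurface. -/
theorem pull_eq_zero {U : (Pn n).Opens} {W : (LinSys n d).Opens} (hU : IsAffineOpen U)
    (hW : IsAffineOpen W) {i : Fin (n + 1)} {J : Exponent n d} (hi : U ≤ chart i)
    (hJ : W ≤ chart J) {V : (Universal n d).Opens}
    (h : V ≤ (universalIdeal n d).subschemeι ⁻¹ᵁ box U W)
    (h' : (universalIdeal n d).subschemeι ⁻¹ᵁ box U W ≤ V) (a : Γ(Ambient n d, box U W)) :
    pull (universalIdeal n d).subschemeι h a = 0 ↔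
      res (box_le_ambientChart hi hJ) (localEquation i J) ∣ a := by
  rw [pull_subschemeι_eq_zero _ (isAffineOpen_box hU hW) h h',
    mem_universalIdeal ⟨_, isAffineOpen_box hU hW⟩ (box_le_ambientChart hi hJ),
    Ideal.mem_span_singleton]

variable {k : ℕ}

/-- The section of the Verlinde bundle given by a monomial of degree `k`. -/
def verlindeSection (d : ℕ) (b : Exponent n k) : Γ(verlindeBundle n d k, ⊤) :=
  toPushforward (family n d) (twist (toPn n d) k)
    (mres (twist (toPn n d) k) le_top (monomialSection (toPn n d) k b.1 (sum_exponent b)))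

/-- The local coordinate of a section of the Verlinde bundle on the preimage of a chart. -/
def verlindeCoord {V : (LinSys n d).Opens} (i : Fin (n + 1)) : Γ(verlindeBundle n d k, V) →+
    Γ(Universal n d, family n d ⁻¹ᵁ V ⊓ toPn n d ⁻¹ᵁ chart i) :=
  (coord (toPn n d) k i).comp (ofPushforward (family n d) (twist (toPn n d) k))

theorem verlindeCoord_ext {V : (LinSys n d).Opens} {s t : Γ(verlindeBundle n d k, V)}
    (h : ∀ i, verlindeCoord i s = verlindeCoord i t) : s = t :=
  ofPushforward_injective _ _ (coord_ext h)

theorem verlindeCoord_smul {V : (LinSys n d).Opens} (i : Fin (n + 1)) (r : Γ(LinSys n d, V))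
    (s : Γ(verlindeBundle n d k, V)) :
    verlindeCoord i (r • s) = pull (family n d) inf_le_left r * verlindeCoord i s := rfl

theorem verlindeCoord_verlindeSection (V : (LinSys n d).Opens) (i : Fin (n + 1))
    (b : Exponent n k) :
    verlindeCoord i (mres _ (le_top : V ≤ ⊤) (verlindeSection d b)) =
      ∏ l, pull (toPn n d) inf_le_right (ratio i l) ^ b.1 l := by
  have h : verlindeCoord i (mres _ (le_top : V ≤ ⊤) (verlindeSection d b)) =
      res (inf_le_inf_right _ le_top) (coord (toPn n d) k i
        (monomialSection (toPn n d) k b.1 (sum_exponent b))) := res_res _ _ _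
  rw [h, coord_monomialSection]
  simp only [map_prod, map_pow, res_pull]

/-- Combinations of monomial sections are the sections that lift to forms on the ambient product;
this turns questions about `V_k` into questions modulo the equation. -/
theorem verlindeCoord_comb {W : (LinSys n d).Opens} (i : Fin (n + 1))
    (c : Exponent n k → Γ(LinSys n d, W)) :
    verlindeCoord i (comb (verlindeSection d) c) =
      pull (universalIdeal n d).subschemeι (preimage_le_box (chart i) W) (formOn c i) := by
  rw [comb, map_sum, formOn, map_sum]
  refine Finset.sum_congr rfl fun b _ ↦ ?_
  rw [verlindeCoord_smul, verlindeCoord_verlindeSection, map_mul, map_prod]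
  simp only [map_pow, left, right, pull_comp]
  rfl

end Verlinde

/-! ### Lifting sections to forms, and divisibility by the universal equation. -/

section Generation

variable {n d k : ℕ} {W : (LinSys n d).Opens} {J : Exponent n d}

/-- The equation of the universal hypersurface, divided by the coordinate with index `J`. -/
def equation (hJ : W ≤ chart J) : Laurent (Fin (n + 1)) Γ(LinSys n d, W) :=
  laurentForm fun I ↦ res hJ (ratio J I)

/-- The coefficient at `J` is `α_J / α_J = 1`. -/
theorem equation_ne_zero [Nontrivial Γ(LinSys n d, W)] (hJ : W ≤ chart J) : equation hJ ≠ 0 := by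
  intro h
  have h1 := coeff_laurentForm (fun I ↦ res hJ (ratio J I)) J
  rw [show laurentForm (fun I ↦ res hJ (ratio J I)) = 0 from h, ratio_self, map_one] at h1
  simp at h1

theorem equation_mem (hJ : W ≤ chart J) : equation hJ ∈ expIn Γ(LinSys n d, W) (cone ∅ d) :=
  laurentForm_mem _

theorem expandOn_localEquation (hW : IsAffineOpen W) (hJ : W ≤ chart J) (i : Fin (n + 1)) :
    expandOn hW (torus_le_chart i) (res (box_le_ambientChart le_rfl hJ) (localEquation i J)) *
      xpow Γ(LinSys n d, W) i d = equation hJ := by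
  rw [res_localEquation_eq_formOn]
  exact expandOn_formOn hW _ i

/-- The local coordinates of a section of the Verlinde bundle satisfy the cocycle condition up to
multiples of the equation. -/
theorem exists_sub_eq_equation_mul (hW : IsAffineOpen W) (hJ : W ≤ chart J)
    (s : Γ(verlindeBundle n d k, W)) (B : ∀ i, Γ(Ambient n d, box (chart i) W))
    (hB : ∀ i, pull (universalIdeal n d).subschemeι (preimage_le_box (chart i) W) (B i) =
      verlindeCoord i s) (i j : Fin (n + 1)) :
    ∃ H ∈ expIn Γ(LinSys n d, W) (cone {i, j} (k - d)),
      expandOn hW (torus_le_chart i) (B i) * xpow _ i k -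
        expandOn hW (torus_le_chart j) (B j) * xpow _ j k = equation hJ * H := by
  by_cases hij : i = j
  · subst hij
    exact ⟨0, zero_mem _, by rw [sub_self, mul_zero]⟩
  have hi : chart i ⊓ chart j ≤ chart i := inf_le_left
  have hj : chart i ⊓ chart j ≤ chart j := inf_le_right
  have hle := box_le_preimage (n := n) (d := d) (chart i ⊓ chart j) W
  have hli := hle.trans (show _ ≤ family n d ⁻¹ᵁ W ⊓ toPn n d ⁻¹ᵁ chart i from
    fun _ hx ↦ ⟨hx.1, hx.2.1⟩)
  have hlj := hle.trans (show _ ≤ family n d ⁻¹ᵁ W ⊓ toPn n d ⁻¹ᵁ chart j from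
    fun _ hx ↦ ⟨hx.1, hx.2.2⟩)
  -- The lifts obey the transition rule of `𝒪(k)` after restriction to the hypersurface, so on the
  -- ambient overlap the failure is a multiple of the local equation.
  have h1 : pull (universalIdeal n d).subschemeι (le_refl _)
      (res (box_mono hi le_rfl) (B i) -
        left (chart i ⊓ chart j) W (res hi (ratio i j)) ^ k *
          res (box_mono hj le_rfl) (B j)) = 0 := by
    rw [map_sub, map_mul, map_pow, pull_res, pull_res, left, pull_comp, pull_res,
      ← res_pull _ (preimage_le_box (chart i) W) hli,
      ← res_pull _ (preimage_le_box (chart j) W) hlj,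
      hB, hB, sub_eq_zero]
    exact res_coord (q := toPn n d) k (ofPushforward (family n d) (twist (toPn n d) k) s) i j
      hli hlj
  rw [pull_eq_zero (isAffineOpen_chart_inf i j) hW hi hJ (le_refl _) (le_refl _)] at h1
  obtain ⟨h, hh⟩ := h1
  have h2 := congrArg (expandOn hW (torus_le_overlap i j)) hh
  rw [map_sub, map_mul, map_pow, map_mul, expandOn_res hW _ hi, expandOn_res hW _ hj,
    expandOn_left, res_res, expand_ratio,
    ← res_res (box_mono hi le_rfl) (box_le_ambientChart le_rfl hJ), expandOn_res hW _ hi] at h2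
  -- The local equation is the equation divided by `x_i ^ d`, and the relation is multiplied by `x_i
  -- ^ k`; the power `x_i ^ (k - d)` is left for the quotient.
  refine ⟨expandOn hW (torus_le_overlap i j) h * xpow _ i (k - d), ?_, ?_⟩
  · have := mul_mem_cone (zero_add _) (expandOn_overlap_mem hW hij h)
      (xpow_mem (R := Γ(LinSys n d, W)) i (k - d))
    rwa [Set.union_singleton, Set.insert_eq_of_mem (Set.mem_insert i {j})] at this
  · rw [← expandOn_localEquation hW hJ i]
    have h3 : xpow Γ(LinSys n d, W) i d * xpow _ i (k - d) = xpow _ i k := by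
      rw [xpow_add, add_sub_cancel]
    have h4 : xpow Γ(LinSys n d, W) i (-1) ^ k * xpow _ i k = 1 := by
      rw [xpow_pow, mul_neg_one, mul_comm, xpow_mul_xpow_neg]
    have h5 : xpow Γ(LinSys n d, W) j 1 ^ k = xpow _ j k := by
      rw [xpow_pow, mul_one]
    rw [mul_pow, h5] at h2
    calc _ = (expandOn hW (torus_le_chart i) (B i) - xpow _ j k * xpow _ i (-1) ^ k *
          expandOn hW (torus_le_chart j) (B j)) * xpow _ i k := by
          linear_combination expandOn hW (torus_le_chart j) (B j) * xpow _ j k * h4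
      _ = _ := by
        rw [h2]
        linear_combination -(expandOn hW (torus_le_chart i) (res (box_le_ambientChart le_rfl hJ)
          (localEquation i J)) * expandOn hW (torus_le_overlap i j) h) * h3

/-- Near a point, the chart coordinates of a section lift to the ambient affine charts. The
differences of the lifts are the equation times a cocycle of `𝒪(k - d)`, which is a coboundary by
`exists_form_of_sections`. Correcting the lifts by it gives a single form of degree `k`. -/
theorem generates_verlindeSection (hn : 1 < n) :
    Generates (M := verlindeBundle n d k) (verlindeSection d) := by
  intro V s x hx
  obtain ⟨W, J, hxW, hWV, hJ, hW, hdom⟩ := exists_isDomain V x hx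
  refine ⟨W, hWV, hxW, ?_⟩
  choose B hB using fun i ↦ exists_pull_subschemeι_eq _
    (isAffineOpen_box (isAffineOpen_chart i) hW) (preimage_le_box (chart i) W)
    (box_le_preimage (chart i) W) (verlindeCoord i (mres _ hWV s))
  choose H hmem hH using exists_sub_eq_equation_mul hW hJ _ B hB
  have hb (i : Fin (n + 1)) : expandOn hW (torus_le_chart i) (B i) * xpow _ i k ∈
      expIn Γ(LinSys n d, W) (cone {i} k) := by
    have := mul_mem_cone (zero_add _) (expandOn_chart_mem hW i (B i))
      (xpow_mem (R := Γ(LinSys n d, W)) i k)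
    rwa [Set.union_self] at this
  obtain ⟨P, hP, Q, hQ, hPQ⟩ := exists_form_of_sections (⟨0, by omega⟩ : Fin (n + 1))
    ⟨1, by omega⟩ ⟨2, by omega⟩ (by simp) (by simp) (by simp) (equation_mem hJ)
    (equation_ne_zero hJ) _ hb H hmem hH
  obtain ⟨c, rfl⟩ := exists_eq_laurentForm hP
  refine ⟨c, verlindeCoord_ext fun i ↦ ?_⟩
  rw [← hB, verlindeCoord_comb, ← sub_eq_zero, ← map_sub, pull_eq_zero (isAffineOpen_chart i) hW
    le_rfl hJ (preimage_le_box _ _) (box_le_preimage _ _)]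
  -- The correction `Q i` has degree `k - d`; divided by `x_i ^ (k - d)` it becomes a function on
  -- the chart.
  obtain ⟨g, hg⟩ := exists_expandOn_chart_eq hW i (p := Q i * xpow _ i (d - k)) (by
    have := mul_mem_cone (show (k - d : ℤ) + (d - k) = 0 by ring) (hQ i)
      (xpow_mem (R := Γ(LinSys n d, W)) i (d - k))
    rwa [Set.union_self] at this)
  refine ⟨g, expandOn_chart_injective hW i ?_⟩
  apply (isUnit_xpow (R := Γ(LinSys n d, W)) i k).mul_right_cancel
  rw [map_sub, sub_mul, hPQ, expandOn_formOn, add_sub_cancel_left, map_mul, hg,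
    ← expandOn_localEquation hW hJ i]
  have h3 : xpow Γ(LinSys n d, W) i (d - k) * xpow _ i k = xpow _ i d := by
    rw [xpow_add, sub_add_cancel]
  linear_combination -(expandOn hW (torus_le_chart i) (res (box_le_ambientChart le_rfl hJ)
    (localEquation i J)) * Q i) * h3

/-- A relation between the sections of the Verlinde bundle comes from a multiple of the
equation. -/
theorem exists_eq_equation_mul (hn : 1 < n) [IsDomain Γ(LinSys n d, W)] (hW : IsAffineOpen W)
    (hJ : W ≤ chart J) (c : Exponent n k → Γ(LinSys n d, W))
    (hc : comb (verlindeSection d) c = (0 : Γ(verlindeBundle n d k, W))) :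
    ∃ q ∈ expIn Γ(LinSys n d, W) (cone (∅ : Set (Fin (n + 1))) (k - d)),
      laurentForm c = equation hJ * q := by
  have h (i : Fin (n + 1)) : ∃ H ∈ expIn Γ(LinSys n d, W) (cone {i} (k - d)),
      laurentForm c = equation hJ * H := by
    have h1 := congrArg (verlindeCoord i) hc
    rw [verlindeCoord_comb, map_zero, pull_eq_zero (isAffineOpen_chart i) hW
      le_rfl hJ (preimage_le_box _ _) (box_le_preimage _ _)] at h1
    obtain ⟨g, hg⟩ := h1
    refine ⟨expandOn hW (torus_le_chart i) g * xpow _ i (k - d), ?_, ?_⟩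
    · have := mul_mem_cone (zero_add _) (expandOn_chart_mem hW i g)
        (xpow_mem (R := Γ(LinSys n d, W)) i (k - d))
      rwa [Set.union_self] at this
    · rw [← expandOn_formOn hW c i, hg, map_mul, ← expandOn_localEquation hW hJ i]
      have h3 : xpow Γ(LinSys n d, W) i d * xpow _ i (k - d) = xpow _ i k := by
        rw [xpow_add, add_sub_cancel]
      linear_combination -(expandOn hW (torus_le_chart i) (res (box_le_ambientChart le_rfl hJ)
        (localEquation i J)) * expandOn hW (torus_le_chart i) g) * h3
  choose H hmem hH using h
  exact exists_form_of_dvd (⟨0, by omega⟩ : Fin (n + 1)) ⟨1, by omega⟩ (by simp)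
    (equation_ne_zero hJ) H hmem hH

end Generation

/-! ## The relations between the sections of the Verlinde bundle -/

section Relations

variable {n d k : ℕ}

variable (n d k) in
/-- The exponents of the monomials of degree `k - d`. -/
abbrev Cofactor : Type := {θ : Fin (n + 1) →₀ ℕ // θ.degree + d = k}

theorem sum_cofactor (θ : Cofactor n d k) : ∑ l, θ.1 l + d = k := by
  rw [← Finsupp.degree_eq_sum]
  exact θ.2

instance : Finite (Cofactor n d k) :=
  Finite.of_injective (fun θ ↦ (⟨θ.1, Finset.mem_finsuppAntidiag.mpr
      ⟨Nat.eq_sub_of_add_eq (sum_cofactor θ), by simp⟩⟩ : Exponent n (k - d)))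
    fun _ _ h ↦ Subtype.ext (Subtype.mk.inj h)

instance : Fintype (Cofactor n d k) := Fintype.ofFinite _

/-- The exponent of a product of monomials of degrees `k - d` and `d`. -/
def mulExponent (θ : Cofactor n d k) (I : Exponent n d) : Exponent n k :=
  ⟨θ.1 + I.1, Finset.mem_finsuppAntidiag.mpr ⟨by
    change ∑ l, (θ.1 l + I.1 l) = k
    rw [Finset.sum_add_distrib, sum_exponent I, sum_cofactor θ], by simp⟩⟩

/-- The sections `ν b` satisfy the relations `∑ I, α_I ν (θ + I) = 0`. -/
def SatisfiesRelations {N : (LinSys n d).Modules} (ν : Exponent n k → Γ(N, ⊤)) : Prop :=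
  ∀ (θ : Cofactor n d k) (J : Exponent n d),
    comb (fun I ↦ ν (mulExponent θ I)) (V := chart J) (fun I ↦ ratio J I) = 0

/-- On each chart the combination is the dehomogenized monomial `θ` times the local equation, which
vanishes on the hypersurface. -/
theorem verlindeSection_satisfiesRelations :
    SatisfiesRelations (N := verlindeBundle n d k) (verlindeSection d) := by
  intro θ J
  refine verlindeCoord_ext fun i ↦ ?_
  have h : pull (universalIdeal n d).subschemeι (preimage_le_box (chart i) (chart J))
      (formOn (fun I ↦ ratio J I) i) = 0 := by
    have h1 : (fun I ↦ ratio J I) = fun I ↦ res (le_refl (chart J)) (ratio J I) :=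
      funext fun I ↦ (res_self _ _).symm
    rw [h1, pull_eq_zero (isAffineOpen_chart i) (isAffineOpen_chart J) le_rfl le_rfl
      (preimage_le_box _ _) (box_le_preimage _ _), res_localEquation_eq_formOn (le_refl (chart J))]
  rw [comb, map_sum, map_zero]
  have h2 (I : Exponent n d) : verlindeCoord i (ratio J I • mres (verlindeBundle n d k)
      (le_top : chart J ≤ ⊤) (verlindeSection d (mulExponent θ I))) =
      (∏ l, pull (toPn n d) inf_le_right (ratio i l) ^ θ.1 l) *
      (pull (universalIdeal n d).subschemeι (preimage_le_box (chart i) (chart J))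
        (right (chart i) (chart J) (ratio J I) *
          ∏ l, left (chart i) (chart J) (ratio i l) ^ I.1 l)) := by
    rw [verlindeCoord_smul, verlindeCoord_verlindeSection, map_mul, map_prod]
    simp only [map_pow, left, right, pull_comp, mulExponent, Finsupp.add_apply, pow_add,
      Finset.prod_mul_distrib]
    exact mul_left_comm _ _ _
  rw [Finset.sum_congr rfl fun I _ ↦ h2 I, ← Finset.mul_sum, ← map_sum]
  exact (congrArg _ h).trans (mul_zero _)

/-- The Verlinde bundle is the universal sheaf with sections satisfying the relations. -/
theorem exists_hom_of_satisfiesRelations (hn : 1 < n) {N : (LinSys n d).Modules}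
    (ν : Exponent n k → Γ(N, ⊤)) (hν : SatisfiesRelations ν) :
    ∃ φ : verlindeBundle n d k ⟶ N, ∀ b, φ.app ⊤ (verlindeSection d b) = ν b := by
  refine (generates_verlindeSection hn).exists_hom ν fun V c hc x hx ↦ ?_
  obtain ⟨W, J, hxW, hWV, hJ, hW, hdom⟩ := exists_isDomain V x hx
  refine ⟨W, hWV, hxW, ?_⟩
  obtain ⟨q, hq, hcq⟩ := exists_eq_equation_mul hn hW hJ (fun b ↦ res hWV (c b)) (by
    rw [← comb_res, hc, map_zero])
  -- The quotient is a combination of monomials of degree `k - d`. For `k < d` there are none and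
  -- the sum is empty.
  have hq' := eq_sum_single (fun (θ : Cofactor n d k) l ↦ (θ.1 l : ℤ))
    (fun θ θ' h ↦ Subtype.ext (Finsupp.ext fun l ↦ Nat.cast_injective (R := ℤ) (congrFun h l)))
    (fun e he ↦ by
      obtain ⟨b, hb, hs⟩ := exists_finsupp_eq he
      refine ⟨⟨b, ?_⟩, hb⟩
      rw [Finsupp.degree_eq_sum]
      omega) hq
  -- `Λ` replaces each monomial `x ^ b` of degree `k` by `ν b`. It remains to see that it kills the
  -- multiples of the equation.
  let Λ : Laurent (Fin (n + 1)) Γ(LinSys n d, W) →+ Γ(N, W) :=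
    { toFun := fun p ↦ comb ν fun b ↦ p.coeff (laurentExponent b)
      map_zero' := by simp [comb]
      map_add' := fun p p' ↦ by
        rw [← comb_add]
        rfl }
  have hΛ (b : Exponent n k) (r : Γ(LinSys n d, W)) :
      Λ (AddMonoidAlgebra.single (laurentExponent b) r) = r • mres N le_top (ν b) := by
    change ∑ b', _ = _
    rw [Finset.sum_eq_single b]
    · simp
    · intro b' _ h
      have h0 : (AddMonoidAlgebra.single (laurentExponent b) r).coeff (laurentExponent b') = 0 := by
        rw [AddMonoidAlgebra.coeff_single, Finsupp.single_eq_of_ne]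
        exact fun h' ↦ h (laurentExponent_injective h')
      simp only [h0, zero_smul]
    · simp
  have h1 : comb ν (fun b ↦ res hWV (c b)) = Λ (laurentForm fun b ↦ res hWV (c b)) := by
    change _ = comb ν _
    simp only [coeff_laurentForm]
  rw [h1, hcq, hq', Finset.mul_sum, map_sum]
  -- The term of `θ` is the coefficient of `q` at `θ` times the given relation for `θ` and `J`.
  refine Finset.sum_eq_zero fun θ _ ↦ ?_
  rw [equation, laurentForm, Finset.sum_mul, map_sum]
  have h2 (I : Exponent n d) : Λ (AddMonoidAlgebra.single (laurentExponent I)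
      (res hJ (ratio J I)) * AddMonoidAlgebra.single (fun l ↦ (θ.1 l : ℤ))
        (q.coeff fun l ↦ (θ.1 l : ℤ))) =
      q.coeff (fun l ↦ (θ.1 l : ℤ)) •
        (res hJ (ratio J I) • mres N le_top (ν (mulExponent θ I))) := by
    rw [AddMonoidAlgebra.single_mul_single, smul_smul, ← hΛ, mul_comm]
    congr 2
    funext l
    simp [laurentExponent, mulExponent, add_comm]
  rw [Finset.sum_congr rfl fun I _ ↦ h2 I, ← Finset.smul_sum]
  have h3 := congrArg (mres N hJ) (hν θ J)
  rw [comb_res, map_zero] at h3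
  exact (congrArg _ h3).trans (smul_zero _)

end Relations

/-! ## Pull-back along linear embeddings -/

section linearEmbedding

variable {σ τ : Type} [Fintype σ] (v : σ → τ → ℂ)

/-- The linear form `∑ i, v i J * x_i`, divided by `x_j`. -/
def linearCoord (j : σ) (J : τ) : Γ(PP σ, chart j) := ∑ i, const σ (chart j) (v i J) * ratio j i

theorem evalAt_linearCoord (j : σ) (J : τ) (p : chart j) :
    evalAt p (linearCoord v j J) * polyAt p.1 (MvPolynomial.X j) =
      polyAt p.1 (coordHom v (MvPolynomial.X J)) := by
  rw [linearCoord, map_sum, Finset.sum_mul, coordHom_X, map_sum]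
  refine Finset.sum_congr rfl fun i _ ↦ ?_
  rw [map_mul, evalAt_const, mul_assoc, evalAt_ratio, map_mul]

variable [Fintype τ] (hv : LinearIndependent ℂ v)

theorem evalAt_pull_linearEmbedding (J I : τ)
    (p : Proj.basicOpen (MvPolynomial.homogeneousSubmodule σ ℂ)
      (coordHom v (MvPolynomial.X J))) :
    evalAt p (pull (linearEmbedding v hv) (le_refl (linearEmbedding v hv ⁻¹ᵁ chart J))
      (ratio J I)) * polyAt p.1 (coordHom v (MvPolynomial.X J)) =
        polyAt p.1 (coordHom v (MvPolynomial.X I)) := by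
  have h1 : pull (linearEmbedding v hv) (le_refl (linearEmbedding v hv ⁻¹ᵁ chart J))
      (ratio J I) = Proj.awayToSection (MvPolynomial.homogeneousSubmodule σ ℂ)
        (coordHom v (MvPolynomial.X J)) (HomogeneousLocalization.Away.mk _
          ((coordHom v).map_mem (MvPolynomial.isHomogeneous_X ℂ J)) 1
          (coordHom v (MvPolynomial.X I))
          ((coordHom v).map_mem (MvPolynomial.isHomogeneous_X ℂ I))) :=
    (ConcreteCategory.congr_hom (Proj.awayToSection_comp_appLE (coordHom v)
      (irrelevant_le_map_coordHom v hv) (MvPolynomial.isHomogeneous_X ℂ J)) _).trans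
        (congrArg (Proj.awayToSection (MvPolynomial.homogeneousSubmodule σ ℂ)
          (coordHom v (MvPolynomial.X J))).hom (HomogeneousLocalization.Away.map_mk (coordHom v)
            (MvPolynomial.X J)
          (MvPolynomial.isHomogeneous_X ℂ J) 1 (MvPolynomial.X I)
          (MvPolynomial.isHomogeneous_X ℂ I)))
  have h2 := evalAt_awayToSection ((coordHom v).map_mem (MvPolynomial.isHomogeneous_X ℂ J)) 1
    _ ((coordHom v).map_mem (MvPolynomial.isHomogeneous_X ℂ I)) p
  rw [pow_one] at h2
  exact (congrArg (fun s ↦ evalAt p s * polyAt p.1 (coordHom v (MvPolynomial.X J))) h1).trans h2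

/-- The coordinate `α_I` pulls back to the linear form `∑ i, v i I * x_i`; this is the resulting
identity of ratios with the denominator cleared. -/
theorem pull_linearEmbedding_ratio (j : σ) (J I : τ) {V : (PP σ).Opens} (hj : V ≤ chart j)
    (hJ : V ≤ linearEmbedding v hv ⁻¹ᵁ chart J) :
    pull (linearEmbedding v hv) hJ (ratio J I) * res hj (linearCoord v j J) =
      res hj (linearCoord v j I) := by
  refine evalAt_ext fun p ↦ ?_
  apply (isUnit_polyAt (hj p.2)).mul_right_cancel
  rw [map_mul, mul_assoc]
  simp only [evalAt_res]
  rw [evalAt_linearCoord v j J ⟨p.1, hj p.2⟩, evalAt_linearCoord v j I ⟨p.1, hj p.2⟩,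
    ← evalAt_pull_linearEmbedding v hv J I ⟨p.1, hJ p.2⟩,
    ← res_pull _ (le_refl (linearEmbedding v hv ⁻¹ᵁ chart J)) hJ]
  rfl

/-- By independence some linear functional is `1` on `v j` and `0` on the other vectors. It recovers
`x_j` from the linear forms, so these have no common zero. -/
theorem exists_sum_mul_linearCoord (hv : LinearIndependent ℂ v) (j : σ) : ∃ g : τ → ℂ,
    ∑ J, const σ (chart j) (g J) * linearCoord v j J = 1 := by
  classical
  obtain ⟨g, hg⟩ := LinearMap.exists_extend (Finsupp.lapply j ∘ₗ hv.repr)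
  have hgv (k : σ) : g (v k) = if k = j then 1 else 0 := by
    have h := LinearMap.congr_fun hg
      (⟨v k, Submodule.subset_span ⟨k, rfl⟩⟩ : Submodule.span ℂ (Set.range v))
    simpa [hv.repr_eq_single k, Finsupp.single_apply] using h
  have hg' (k : σ) : ∑ J, g (Pi.single J 1) * v k J = if k = j then 1 else 0 := by
    rw [← hgv k, LinearMap.pi_apply_eq_sum_univ g (v k)]
    refine Finset.sum_congr rfl fun J _ ↦ ?_
    have hs : (fun j ↦ if J = j then (1 : ℂ) else 0) = Pi.single J 1 := by
      ext j
      simp [Pi.single_apply, eq_comm]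
    rw [hs, smul_eq_mul, mul_comm]
  refine ⟨fun J ↦ g (Pi.single J 1), ?_⟩
  simp only [linearCoord, Finset.mul_sum]
  rw [Finset.sum_comm]
  simp only [← mul_assoc, ← map_mul, ← Finset.sum_mul, ← map_sum, hg']
  rw [Finset.sum_eq_single j]
  · rw [if_pos rfl, map_one, one_mul, ratio_self]
  · intro k _ hk
    rw [if_neg hk, map_zero, zero_mul]
  · simp

/-- On the preimage of a chart, the linear form that defines the chart is invertible. -/
theorem isUnit_linearCoord (j : σ) (J : τ) {V : (PP σ).Opens} (hj : V ≤ chart j)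
    (hJ : V ≤ linearEmbedding v hv ⁻¹ᵁ chart J) : IsUnit (res hj (linearCoord v j J)) := by
  obtain ⟨g, hg⟩ := exists_sum_mul_linearCoord v hv j
  -- The inverse is `∑ I, g I * (α_I / α_J)`, pulled back along the embedding.
  refine IsUnit.of_mul_eq_one_right
    (∑ I, const σ V (g I) * pull (linearEmbedding v hv) hJ (ratio J I)) ?_
  have h := congrArg (res hj) hg
  rw [map_sum, map_one] at h
  rw [← h, Finset.sum_mul]
  refine Finset.sum_congr rfl fun I _ ↦ ?_
  rw [mul_assoc, pull_linearEmbedding_ratio, map_mul, res_const]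

end linearEmbedding

/-! ## The restriction of the Verlinde bundle to a line -/

section line

variable {n d k : ℕ} {f : Fin 2 → MvPolynomial (Fin (n + 1)) ℂ}

/-- The section of `N` obtained from the polynomial `f i * x ^ θ` by replacing the monomials
`x ^ b` with the sections `ν b`. -/
def productSection {N : (PP (Fin 2)).Modules} (f : Fin 2 → MvPolynomial (Fin (n + 1)) ℂ)
    (ν : Exponent n k → Γ(N, ⊤)) (θ : Cofactor n d k) (i : Fin 2) : Γ(N, ⊤) :=
  comb (fun I ↦ ν (mulExponent θ I)) fun I ↦ const (Fin 2) ⊤ (coeffs (f i) I)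

/-- The sections `ν b` satisfy the relations `∑ i, x_i ν (f i * x ^ θ) = 0`. -/
def SatisfiesLineRelations {N : (PP (Fin 2)).Modules} (d : ℕ)
    (f : Fin 2 → MvPolynomial (Fin (n + 1)) ℂ) (ν : Exponent n k → Γ(N, ⊤)) : Prop :=
  ∀ (θ : Cofactor n d k) (j : Fin 2),
    comb (productSection f ν θ) (V := chart j) (fun i ↦ ratio j i) = 0

/-- An exchange of summation: at the point `s f₁ + t f₂` of the line, the universal relation for `θ`
reads `s f₁θ + t f₂θ = 0`. -/
theorem comb_productSection {N : (PP (Fin 2)).Modules} (ν : Exponent n k → Γ(N, ⊤))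
    (θ : Cofactor n d k) (j : Fin 2) :
    comb (productSection f ν θ) (V := chart j) (fun i ↦ ratio j i) =
      comb (fun I ↦ ν (mulExponent θ I)) fun I ↦ linearCoord (fun i ↦ coeffs (f i)) j I := by
  simp only [comb, productSection, linearCoord, map_sum, Finset.smul_sum, Finset.sum_smul,
    mres_smul, mres_mres, res_const, smul_smul]
  rw [Finset.sum_comm]
  simp only [mul_comm]

variable (hf : ∀ i, (f i).IsHomogeneous d) (hli : LinearIndependent ℂ f)

/-- Where a chart of `ℙ¹` meets the preimage of a chart of `|𝒪(d)|`, the two kinds of relation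
differ by the factor `linearCoord`, which is a unit there. Both are local conditions. -/
theorem satisfiesRelations_iff {N : (PP (Fin 2)).Modules} (ν : Exponent n k → Γ(N, ⊤)) :
    SatisfiesRelations (N := (Scheme.Modules.pushforward (line hf hli)).obj N)
      (fun b ↦ toPushforward (line hf hli) N (V := ⊤) (ν b)) ↔
        SatisfiesLineRelations d f ν := by
  have hv := linearIndependent_coeffs hf hli
  have key (θ : Cofactor n d k) (J : Exponent n d) (j : Fin 2) {V : (PP (Fin 2)).Opens}
      (hj : V ≤ chart j) (hJ : V ≤ line hf hli ⁻¹ᵁ chart J) :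
      mres N hj (comb (productSection f ν θ) (V := chart j) (fun i ↦ ratio j i)) =
        res hj (linearCoord (fun i ↦ coeffs (f i)) j J) • mres N hJ
          (comb (fun I ↦ ν (mulExponent θ I)) fun I ↦ (line hf hli).app (chart J) (ratio J I)) := by
    rw [comb_productSection, comb_res, comb_res, ← comb_smul]
    congr 1
    funext I
    rw [← pull_linearEmbedding_ratio _ hv j J I hj hJ, mul_comm]
    rfl
  have hiff (θ : Cofactor n d k) (J : Exponent n d) :
      comb (M := (Scheme.Modules.pushforward (line hf hli)).obj N)
        (fun I ↦ toPushforward (line hf hli) N (V := ⊤) (ν (mulExponent θ I))) (V := chart J)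
          (fun I ↦ ratio J I) = 0 ↔
      comb (fun I ↦ ν (mulExponent θ I)) (fun I ↦ (line hf hli).app (chart J) (ratio J I)) = 0 :=
    Iff.rfl
  refine ⟨fun h θ j ↦ mres_ext fun x hx ↦ ?_, fun h θ J ↦ ?_⟩
  · obtain ⟨J, hJ⟩ := exists_mem_chart (line hf hli x)
    refine ⟨chart j ⊓ line hf hli ⁻¹ᵁ chart J, inf_le_left, ⟨hx, hJ⟩, ?_⟩
    rw [key θ J j _ inf_le_right, (hiff θ J).mp (h θ J), map_zero, map_zero, smul_zero]
  · rw [hiff]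
    refine mres_ext fun x hx ↦ ?_
    obtain ⟨j, hj⟩ := exists_mem_chart x
    refine ⟨line hf hli ⁻¹ᵁ chart J ⊓ chart j, inf_le_left, ⟨hx, hj⟩, ?_⟩
    have h1 := key θ J j (inf_le_right : line hf hli ⁻¹ᵁ chart J ⊓ chart j ≤ _) inf_le_left
    rw [h θ j, map_zero] at h1
    rw [map_zero]
    have hu : IsUnit (res (inf_le_right : line hf hli ⁻¹ᵁ chart J ⊓ chart j ≤ chart j)
        (linearCoord (fun i ↦ coeffs (f i)) j J)) :=
      isUnit_linearCoord _ hv j J inf_le_right inf_le_left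
    exact hu.smul_eq_zero.mp h1.symm

/-- The section of the restriction of the Verlinde bundle to a line given by a monomial. -/
def lineSection (b : Exponent n k) : Γ(verlindeOnLine k hf hli, ⊤) :=
  ofPushforward (line hf hli) (verlindeOnLine k hf hli) (V := ⊤)
    (((Scheme.Modules.pullbackPushforwardAdjunction (line hf hli)).unit.app
      (verlindeBundle n d k)).app ⊤ (verlindeSection d b))

theorem app_lineSection {N : (PP (Fin 2)).Modules} (φ : verlindeOnLine k hf hli ⟶ N)
    (b : Exponent n k) : toPushforward (line hf hli) N (V := ⊤) (φ.app ⊤ (lineSection hf hli b)) =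
      ((Scheme.Modules.pullbackPushforwardAdjunction (line hf hli)).homEquiv _ _ φ).app ⊤
        (verlindeSection d b) :=
  (congrArg (fun ψ : verlindeBundle n d k ⟶ (Scheme.Modules.pushforward (line hf hli)).obj N ↦
    ψ.app ⊤ (verlindeSection d b)) (Adjunction.homEquiv_unit ..)).symm

/-- By adjunction this is a statement on homomorphisms out of `V_k`, which is generated by the
monomials. -/
theorem lineSection_hom_ext (hn : 1 < n) {N : (PP (Fin 2)).Modules}
    {φ ψ : verlindeOnLine k hf hli ⟶ N}
    (h : ∀ b, φ.app ⊤ (lineSection hf hli b) = ψ.app ⊤ (lineSection hf hli b)) : φ = ψ := by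
  apply ((Scheme.Modules.pullbackPushforwardAdjunction (line hf hli)).homEquiv _ _).injective
  refine (generates_verlindeSection hn).hom_ext fun b ↦ ?_
  rw [← app_lineSection, ← app_lineSection, h]

/-- The universal property of `V_k`, applied to the push-forward of `N` and transposed. With
`lineSection_hom_ext` it is all that is used about homomorphisms out of `V_{k,T}`. -/
theorem exists_hom_of_satisfiesLineRelations (hn : 1 < n) {N : (PP (Fin 2)).Modules}
    (ν : Exponent n k → Γ(N, ⊤)) (hν : SatisfiesLineRelations d f ν) :
    ∃ φ : verlindeOnLine k hf hli ⟶ N, ∀ b, φ.app ⊤ (lineSection hf hli b) = ν b := by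
  obtain ⟨φ, hφ⟩ := exists_hom_of_satisfiesRelations hn _
    ((satisfiesRelations_iff hf hli ν).mpr hν)
  refine ⟨((Scheme.Modules.pullbackPushforwardAdjunction (line hf hli)).homEquiv _ _).symm φ,
    fun b ↦ ?_⟩
  have := app_lineSection hf hli
    (((Scheme.Modules.pullbackPushforwardAdjunction (line hf hli)).homEquiv _ _).symm φ) b
  rw [Equiv.apply_symm_apply, hφ] at this
  exact this

theorem lineSection_satisfiesLineRelations :
    SatisfiesLineRelations (k := k) d f (lineSection hf hli) := by
  rw [← satisfiesRelations_iff hf hli]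
  intro θ J
  have := congrArg (((Scheme.Modules.pullbackPushforwardAdjunction (line hf hli)).unit.app
      (verlindeBundle n d k)).app (chart J)) (verlindeSection_satisfiesRelations θ J)
  rw [app_comb, map_zero] at this
  exact this

end line

/-! ## The sheaves `𝒪(0)` and `𝒪(1)` -/

section OO

variable {σ : Type}

theorem pull_id {X : Scheme.{u}} {U V : X.Opens} (h : V ≤ U) (s : Γ(X, U)) :
    pull (𝟙 X) h s = res h s := by
  have : pull (𝟙 X) h s = res h ((𝟙 X : X ⟶ X).app U s) := (res_app (𝟙 X) h s).symm
  rw [this, Scheme.Hom.id_app]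
  rfl

/-- The local coordinate of a section of `𝒪(m)` on a chart. -/
def chartCoord (m : ℤ) {V : (PP σ).Opens} (i : σ) : Γ(OO σ m, V) →+ Γ(PP σ, V ⊓ chart i) :=
  coord (𝟙 (PP σ)) m i

theorem chartCoord_ext {m : ℤ} {V : (PP σ).Opens} {s t : Γ(OO σ m, V)}
    (h : ∀ i, chartCoord m i s = chartCoord m i t) : s = t :=
  coord_ext (q := 𝟙 (PP σ)) h

theorem chartCoord_smul {m : ℤ} {V : (PP σ).Opens} (r : Γ(PP σ, V)) (s : Γ(OO σ m, V)) (i : σ) :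
    chartCoord m i (r • s) = res inf_le_left r * chartCoord m i s := rfl

theorem chartCoord_mres {m : ℤ} {V W : (PP σ).Opens} (h : V ≤ W) (s : Γ(OO σ m, W)) (i : σ) :
    chartCoord m i (mres _ h s) = res (inf_le_inf_right _ h) (chartCoord m i s) := rfl

theorem res_chartCoord (m : ℕ) {V W : (PP σ).Opens} (s : Γ(OO σ m, V)) (i j : σ)
    (hi : W ≤ V ⊓ chart i) (hj : W ≤ V ⊓ chart j) :
    res hi (chartCoord m i s) = res (hi.trans inf_le_right) (ratio i j) ^ m *
      res hj (chartCoord m j s) := by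
  have h := res_coord (q := 𝟙 (PP σ)) m s i j hi hj
  rw [pull_id (hi.trans inf_le_right)] at h
  exact h

variable [Fintype σ] {m : ℕ} {e : σ → ℕ}

/-- The section of `𝒪(m)` given by a monomial of degree `m`. -/
def formSection (he : ∑ l, e l = m) : Γ(OO σ m, ⊤) := monomialSection (𝟙 (PP σ)) m e he

theorem chartCoord_formSection (he : ∑ l, e l = m) {j : σ} (hj : ∀ l ≠ j, e l = 0)
    {V : (PP σ).Opens} (i : σ) : chartCoord m i (mres _ (le_top : V ≤ ⊤) (formSection he)) =
      res inf_le_right (ratio i j) ^ m := by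
  have h : chartCoord m i (formSection he) =
      ∏ l, pull (𝟙 (PP σ)) (inf_le_right : ⊤ ⊓ chart i ≤ _) (ratio i l) ^ e l := rfl
  have hm : e j = m := by
    rw [← he, Finset.sum_eq_single j (fun l _ hl ↦ hj l hl)
      (fun h ↦ absurd (Finset.mem_univ j) h)]
  rw [chartCoord_mres, h, Finset.prod_eq_single j (fun l _ hl ↦ by rw [hj l hl, pow_zero])
    (fun h ↦ absurd (Finset.mem_univ j) h), hm, map_pow,
    pull_id (inf_le_right : ⊤ ⊓ chart i ≤ _), res_res]

/-- On the chart `x_j ≠ 0`, the sections of `𝒪(m)` are the multiples of `x_j ^ m`. -/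
theorem exists_eq_smul (he : ∑ l, e l = m) {j : σ} (hj : ∀ l ≠ j, e l = 0) {V : (PP σ).Opens}
    (hV : V ≤ chart j) (s : Γ(OO σ m, V)) :
    ∃ a : Γ(PP σ, V), s = a • mres (OO σ m) le_top (formSection he) := by
  refine ⟨res (le_inf le_rfl hV) (chartCoord m j s), chartCoord_ext fun i ↦ ?_⟩
  have h := res_chartCoord m s i j (le_refl _) (inf_le_left.trans (le_inf le_rfl hV))
  rw [res_self] at h
  rw [h, chartCoord_smul, chartCoord_formSection he hj, res_res, mul_comm]

theorem sum_zero_eq_zero (σ : Type) [Fintype σ] : ∑ l, (0 : σ → ℕ) l = 0 := by simp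

/-- The constant section `1` of `𝒪(0)`. -/
def oneSection (σ : Type) [Fintype σ] : Γ(OO σ (0 : ℕ), ⊤) := formSection (sum_zero_eq_zero σ)

theorem chartCoord_oneSection {V : (PP σ).Opens} (i : σ) :
    chartCoord (0 : ℕ) i (mres _ (le_top : V ≤ ⊤) (oneSection σ)) = 1 := by
  rw [oneSection, chartCoord_formSection (j := i) _ (fun l hl ↦ rfl), pow_zero]

theorem comb_unit {X : Scheme.{u}} {M : X.Modules} (s : Γ(M, ⊤)) {V : X.Opens}
    (c : Unit → Γ(X, V)) : comb (fun _ : Unit ↦ s) c = c () • mres M le_top s :=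
  Fintype.sum_unique _

theorem generates_oneSection : Generates (M := OO σ (0 : ℕ)) fun _ : Unit ↦ oneSection σ := by
  intro V s x hx
  obtain ⟨j, hj⟩ := exists_mem_chart x
  refine ⟨V ⊓ chart j, inf_le_left, ⟨hx, hj⟩, ?_⟩
  obtain ⟨a, ha⟩ := exists_eq_smul (sum_zero_eq_zero σ) (j := j) (fun _ _ ↦ rfl)
    inf_le_right (mres (OO σ (0 : ℕ)) (inf_le_left : V ⊓ chart j ≤ V) s)
  refine ⟨fun _ ↦ a, ?_⟩
  rw [comb_unit, ha]
  rfl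

theorem exists_hom_OO_zero {N : (PP σ).Modules} (ν : Γ(N, ⊤)) :
    ∃ φ : OO σ (0 : ℕ) ⟶ N, φ.app ⊤ (oneSection σ) = ν := by
  obtain ⟨φ, hφ⟩ := (generates_oneSection (σ := σ)).exists_hom (fun _ ↦ ν) fun V c hc x hx ↦ by
    refine ⟨V, le_rfl, hx, ?_⟩
    suffices h : c () = 0 by rw [comb_unit, h, map_zero, zero_smul]
    refine res_ext fun y hy ↦ ?_
    obtain ⟨j, hj⟩ := exists_mem_chart y
    refine ⟨V ⊓ chart j, inf_le_left, ⟨hy, hj⟩, ?_⟩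
    have h := congrArg (chartCoord (0 : ℕ) j) hc
    rw [comb_unit, chartCoord_smul, chartCoord_oneSection, mul_one, map_zero] at h
    rw [h, map_zero]
  exact ⟨φ, hφ ()⟩

variable [DecidableEq σ]

theorem sum_single_one (j : σ) : ∑ l, (Pi.single j 1 : σ → ℕ) l = 1 := by simp

/-- The homogeneous coordinate `x_j` as a section of `𝒪(1)`. -/
def coordinateSection (j : σ) : Γ(OO σ (1 : ℕ), ⊤) := formSection (sum_single_one j)

theorem chartCoord_coordinateSection {V : (PP σ).Opens} (i j : σ) :
    chartCoord (1 : ℕ) i (mres _ (le_top : V ≤ ⊤) (coordinateSection j)) =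
      res inf_le_right (ratio i j) := by
  rw [coordinateSection, chartCoord_formSection (j := j) _
    (fun l hl ↦ by rw [Pi.single_eq_of_ne hl]), pow_one]

end OO

/-! ### The Euler presentation of `𝒪(1)` on the projective line. -/

section projectiveLine

/-- Sections of `𝒪(1)` on the projective line with the relation
`x_0 * eulerSection 0 + x_1 * eulerSection 1 = 0`. -/
def eulerSection : Fin 2 → Γ(OO (Fin 2) (1 : ℕ), ⊤) :=
  ![coordinateSection 1, -coordinateSection 0]

theorem comb_eulerSection {V : (PP (Fin 2)).Opens} (c : Fin 2 → Γ(PP (Fin 2), V)) :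
    comb eulerSection c = c 0 • mres _ le_top (coordinateSection 1) -
      c 1 • mres _ le_top (coordinateSection 0) := by
  simp [comb, eulerSection, Fin.sum_univ_two, sub_eq_add_neg]

theorem chartCoord_comb_eulerSection {V : (PP (Fin 2)).Opens} (c : Fin 2 → Γ(PP (Fin 2), V))
    (i : Fin 2) : chartCoord (1 : ℕ) i (comb eulerSection c) =
      res inf_le_left (c 0) * res inf_le_right (ratio i 1) -
        res inf_le_left (c 1) * res inf_le_right (ratio i 0) := by
  rw [comb_eulerSection, map_sub, chartCoord_smul, chartCoord_smul, chartCoord_coordinateSection,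
    chartCoord_coordinateSection]

theorem comb_eulerSection_ratio (j : Fin 2) :
    comb eulerSection (V := chart j) (fun i ↦ ratio j i) = 0 := by
  refine chartCoord_ext fun i ↦ ?_
  rw [map_zero, chartCoord_comb_eulerSection,
    ← ratio_mul_ratio i j 0 inf_le_right inf_le_left,
    ← ratio_mul_ratio i j 1 inf_le_right inf_le_left]
  ring

theorem generates_eulerSection : Generates eulerSection := by
  intro V s x hx
  obtain ⟨j, hj⟩ := exists_mem_chart x
  refine ⟨V ⊓ chart j, inf_le_left, ⟨hx, hj⟩, ?_⟩
  obtain ⟨a, ha⟩ := exists_eq_smul (sum_single_one j) (j := j)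
    (fun l hl ↦ by rw [Pi.single_eq_of_ne hl]) inf_le_right
    (mres (OO (Fin 2) (1 : ℕ)) (inf_le_left : V ⊓ chart j ≤ V) s)
  rw [ha]
  change ∃ c, a • mres _ le_top (coordinateSection j) = _
  simp only [comb_eulerSection]
  -- On chart `0` the generator `x_0` is minus the second Euler section; on chart `1` the generator
  -- `x_1` is the first.
  fin_cases j
  · exact ⟨![0, -a], by simp⟩
  · exact ⟨![a, 0], by simp⟩

/-- The two Euler sections generate `𝒪(1)`, and on a chart every relation between them is a multiple
of the evident one. -/
theorem exists_hom_OO_one {N : (PP (Fin 2)).Modules} (ν : Fin 2 → Γ(N, ⊤))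
    (hν : ∀ j, comb ν (V := chart j) (fun i ↦ ratio j i) = 0) :
    ∃ φ : OO (Fin 2) (1 : ℕ) ⟶ N, ∀ i, φ.app ⊤ (eulerSection i) = ν i := by
  refine generates_eulerSection.exists_hom ν fun V c hc x hx ↦ ?_
  obtain ⟨j, hj⟩ := exists_mem_chart x
  refine ⟨V ⊓ chart j, inf_le_left, ⟨hx, hj⟩, ?_⟩
  have h1 := congrArg (chartCoord (1 : ℕ) j) hc
  rw [chartCoord_comb_eulerSection, map_zero, sub_eq_zero] at h1
  -- The relation says `c 0 * x_1 = c 1 * x_0`; division by `x_j` expresses both coefficients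
  -- through `c j`.
  have h2 (i : Fin 2) : res (inf_le_left : V ⊓ chart j ≤ V) (c i) =
      res inf_le_left (c j) * res inf_le_right (ratio j i) := by
    by_cases hij : i = j
    · subst hij
      rw [ratio_self, map_one, mul_one]
    · fin_cases j <;> fin_cases i
      · exact absurd rfl hij
      · simpa [ratio_self] using h1.symm
      · simpa [ratio_self] using h1
      · exact absurd rfl hij
  have h3 := congrArg (mres N (inf_le_right : V ⊓ chart j ≤ chart j)) (hν j)
  rw [comb_res, map_zero] at h3
  have h4 : (fun i ↦ res (inf_le_left : V ⊓ chart j ≤ V) (c i)) =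
      res (inf_le_left : V ⊓ chart j ≤ V) (c j) • fun i ↦ res inf_le_right (ratio j i) :=
    funext h2
  rw [h4, comb_smul, h3, smul_zero]

end projectiveLine

/-! ## Global sections of `𝒪(0)` -/

section globalSections

variable {σ : Type}

/-- Polynomials in the functions `x_l / x_i`. -/
def ratioPoly (i : σ) : MvPolynomial {l // l ≠ i} ℂ →+* Γ(PP σ, chart i) :=
  MvPolynomial.eval₂Hom (const σ (chart i)) fun l ↦ ratio i l

theorem ratioPoly_surjective (i : σ) : Function.Surjective (ratioPoly i) := by
  intro s
  refine chart_induction i (ratioPoly i).range (fun c ↦ ?_) (fun l ↦ ?_) s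
  · exact ⟨MvPolynomial.C c, MvPolynomial.eval₂Hom_C _ _ _⟩
  · by_cases hl : l = i
    · subst hl
      exact ⟨1, by rw [map_one, ratio_self]⟩
    · exact ⟨MvPolynomial.X ⟨l, hl⟩, MvPolynomial.eval₂Hom_X' _ _ _⟩

variable [Fintype σ]

theorem eq_single_zero {p : Laurent σ ℂ} (hp : p ∈ expIn ℂ (cone ∅ 0)) :
    p = AddMonoidAlgebra.single 0 (p.coeff 0) := by
  have h := eq_sum_single (ι := Unit) (fun _ ↦ 0) (Function.injective_of_subsingleton _)
    (fun e he ↦ ⟨(), ?_⟩) hp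
  · rwa [Fintype.sum_unique] at h
  · funext i
    exact ((Finset.sum_eq_zero_iff_of_nonneg fun i _ ↦ he.2 i (Set.notMem_empty i)).mp he.1 i
      (Finset.mem_univ i)).symm

/-- The constant `c` as a section of `𝒪(0)`. -/
def constSection (σ : Type) [Fintype σ] : ℂ →+ Γ(OO σ (0 : ℕ), ⊤) where
  toFun c := const σ ⊤ c • oneSection σ
  map_zero' := by rw [map_zero, zero_smul]
  map_add' a b := by rw [map_add, add_smul]

theorem constSection_apply (c : ℂ) : constSection σ c = const σ ⊤ c • oneSection σ := rfl

theorem chartCoord_constSection (c : ℂ) {V : (PP σ).Opens} (i : σ) :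
    chartCoord (0 : ℕ) i (mres _ (le_top : V ≤ ⊤) (constSection σ c)) = const σ _ c := by
  rw [constSection_apply, mres_smul, chartCoord_smul, chartCoord_oneSection, mul_one, res_const,
    res_const]

theorem const_smul_constSection (a c : ℂ) :
    const σ ⊤ a • constSection σ c = constSection σ (a * c) := by
  rw [constSection_apply, constSection_apply, smul_smul, map_mul]

variable [DecidableEq σ] [Nonempty σ]

/-- The expansion of functions on a chart as Laurent polynomials. -/
def expandChart (i : σ) : Γ(PP σ, chart i) →+* Laurent σ ℂ :=
  (expand (RingHom.id ℂ)).comp (res (torus_le_chart i))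

theorem expandChart_const (i : σ) (c : ℂ) :
    expandChart i (const σ (chart i) c) = AddMonoidAlgebra.single 0 c := by
  rw [expandChart, RingHom.comp_apply, res_const, expand_const, RingHom.id_apply]

theorem expandChart_ratio (i l : σ) :
    expandChart i (ratio i l) = xpow ℂ l 1 * xpow ℂ i (-1) := expand_ratio (RingHom.id ℂ) i l

theorem expandChart_mem (i : σ) (s : Γ(PP σ, chart i)) :
    expandChart i s ∈ expIn ℂ (cone {i} 0) := by
  refine chart_induction i ((coneRing ℂ {i}).comap (expandChart i)) (fun c ↦ ?_) (fun l ↦ ?_) s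
  · change expandChart i _ ∈ expIn ℂ (cone {i} 0)
    rw [expandChart_const]
    exact single_zero_mem_cone _ _
  · change expandChart i _ ∈ expIn ℂ (cone {i} 0)
    rw [expandChart_ratio]
    have := mul_mem_cone (show (1 : ℤ) + -1 = 0 by norm_num) (toLaurent_mem (RingHom.id ℂ)
      (MvPolynomial.isHomogeneous_X ℂ l)) (xpow_mem (R := ℂ) i (-1))
    rwa [toLaurent_X, Set.empty_union] at this

theorem expandChart_ratioPoly_monomial (i : σ) (e : {l // l ≠ i} →₀ ℕ) (c : ℂ) :
    expandChart i (ratioPoly i (MvPolynomial.monomial e c)) =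
      AddMonoidAlgebra.single (chartExponent i e) c := by
  rw [ratioPoly, MvPolynomial.coe_eval₂Hom, MvPolynomial.eval₂_monomial,
    Finsupp.prod_fintype _ _ (by simp), map_mul, map_prod, expandChart_const]
  simp only [map_pow, expandChart_ratio]
  simp only [xpow, AddMonoidAlgebra.single_mul_single, AddMonoidAlgebra.single_pow, one_pow,
    mul_one, AddMonoidAlgebra.prod_single, Finset.prod_const_one, zero_add]
  rfl

theorem expandChart_ratioPoly_coeff (i : σ) (p : MvPolynomial {l // l ≠ i} ℂ)
    (e : {l // l ≠ i} →₀ ℕ) :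
    (expandChart i (ratioPoly i p)).coeff (chartExponent i e) = p.coeff e := by
  classical
  induction p using MvPolynomial.induction_on' with
  | monomial e' r =>
    rw [expandChart_ratioPoly_monomial, AddMonoidAlgebra.coeff_single, Finsupp.single_apply,
      MvPolynomial.coeff_monomial]
    simp only [(chartExponent_injective i).eq_iff]
  | add p q hp hq =>
    rw [map_add, map_add, AddMonoidAlgebra.coeff_add, Finsupp.add_apply, hp, hq,
      MvPolynomial.coeff_add]

theorem expandChart_injective (i : σ) : Function.Injective (expandChart i) := by
  rw [injective_iff_map_eq_zero]
  intro b hb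
  obtain ⟨p, rfl⟩ := ratioPoly_surjective i b
  have : p = 0 := MvPolynomial.ext _ _ fun e ↦ by
    rw [← expandChart_ratioPoly_coeff, hb]
    simp
  rw [this, map_zero]

/-- Linear forms with constant coefficients that vanish on a chart are zero. -/
theorem eq_zero_of_sum_const_mul_ratio (j : σ) {c : σ → ℂ}
    (h : ∑ i, const σ (chart j) (c i) * ratio j i = 0) : c = 0 := by
  have h1 := congrArg (fun s ↦ expandChart j s * xpow ℂ j 1) h
  simp only [map_sum, map_mul, expandChart_const, expandChart_ratio, map_zero, zero_mul,
    Finset.sum_mul, mul_assoc] at h1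
  have h2 : xpow ℂ j (-1) * xpow ℂ j 1 = 1 := by
    rw [mul_comm, xpow_mul_xpow_neg]
  simp only [h2, mul_one] at h1
  simp only [mul_one, xpow, AddMonoidAlgebra.single_mul_single, zero_add] at h1
  funext i
  have h3 := congrArg (fun p ↦ p.coeff (Pi.single i 1)) h1
  simp only [AddMonoidAlgebra.coeff_sum, Finsupp.finsetSum_apply, AddMonoidAlgebra.coeff_single,
    AddMonoidAlgebra.coeff_zero, Finsupp.coe_zero, Pi.zero_apply] at h3
  rw [Finset.sum_eq_single i (fun l _ hl ↦ Finsupp.single_eq_of_ne fun h ↦ hl ?_)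
    (fun h ↦ absurd (Finset.mem_univ i) h), Finsupp.single_eq_same] at h3
  · exact h3
  · by_contra hl
    have := congrFun h i
    rw [Pi.single_eq_same, Pi.single_eq_of_ne (Ne.symm hl)] at this
    exact one_ne_zero this

theorem constSection_injective : Function.Injective (constSection σ) := by
  rw [injective_iff_map_eq_zero]
  intro c hc
  obtain ⟨i⟩ := ‹Nonempty σ›
  have h := congrArg (fun s ↦ chartCoord (0 : ℕ) i (mres _ (le_top : chart i ≤ ⊤) s)) hc
  simp only [chartCoord_constSection, map_zero] at h
  have h2 := congrArg (fun s ↦ (expandChart i (res (le_inf le_rfl le_rfl) s)).coeff 0) h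
  simpa [res_const, expandChart_const] using h2

/-- All chart coordinates have the same expansion on the torus. Two charts together exclude negative
exponents, so in degree zero only the constant term remains. -/
theorem constSection_surjective [Nontrivial σ] : Function.Surjective (constSection σ) := by
  intro s
  obtain ⟨i₀, i₁, hi⟩ := exists_pair_ne σ
  obtain ⟨a, ha⟩ : ∃ a : ∀ i : σ, Γ(PP σ, chart i), ∀ i, a i =
      res (le_inf le_top le_rfl) (chartCoord (0 : ℕ) i s) := ⟨_, fun _ ↦ rfl⟩
  have heq (i j : σ) : expandChart i (a i) = expandChart j (a j) := by
    have h := res_chartCoord (W := torus σ) 0 s i j (le_inf le_top (torus_le_chart i))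
      (le_inf le_top (torus_le_chart j))
    rw [pow_zero, one_mul] at h
    rw [expandChart, expandChart, RingHom.comp_apply, RingHom.comp_apply]
    rw [ha, ha, res_res, res_res, h]
  have hmem : expandChart i₀ (a i₀) ∈ expIn ℂ (cone ∅ 0) := by
    refine mem_cone_empty_of_forall hi (expandChart_mem i₀ (a i₀)) ?_
    rw [heq i₀ i₁]
    exact expandChart_mem i₁ (a i₁)
  refine ⟨(expandChart i₀ (a i₀)).coeff 0, chartCoord_ext fun i ↦ ?_⟩
  have h1 : a i = const σ (chart i) ((expandChart i₀ (a i₀)).coeff 0) := by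
    apply expandChart_injective i
    rw [expandChart_const, ← eq_single_zero hmem, heq i i₀]
  have h2 : chartCoord (0 : ℕ) i s =
      const σ (⊤ ⊓ chart i) ((expandChart i₀ (a i₀)).coeff 0) := by
    rw [← res_const (inf_le_right : ⊤ ⊓ chart i ≤ chart i), ← h1, ha]
    exact ((res_res _ _ _).trans (res_self _ _)).symm
  rw [h2, ← mres_self (M := OO σ (0 : ℕ)) le_top (constSection σ _), chartCoord_constSection]

end globalSections

section constEquiv

variable {σ : Type} [Fintype σ] [DecidableEq σ] [Nontrivial σ]

/-- The global sections of `𝒪(0)` are the constants. -/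
def constEquiv (σ : Type) [Fintype σ] [DecidableEq σ] [Nontrivial σ] :
    ℂ ≃+ Γ(OO σ (0 : ℕ), ⊤) :=
  AddEquiv.ofBijective (constSection σ) ⟨constSection_injective, constSection_surjective⟩

theorem constEquiv_symm_smul (a : ℂ) (s : Γ(OO σ (0 : ℕ), ⊤)) :
    (constEquiv σ).symm (const σ ⊤ a • s) = a * (constEquiv σ).symm s := by
  obtain ⟨c, rfl⟩ := (constEquiv σ).surjective s
  rw [AddEquiv.symm_apply_apply, AddEquiv.symm_apply_eq]
  exact const_smul_constSection a c

end constEquiv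

/-- There are no nonzero homomorphisms from `𝒪(1)` to `𝒪`. -/
theorem hom_OO_one_OO_zero (φ : OO (Fin 2) (1 : ℕ) ⟶ OO (Fin 2) (0 : ℕ)) : φ = 0 := by
  refine generates_eulerSection.hom_ext fun i ↦ ?_
  -- The Euler sections go to constants, and the Euler relation becomes a linear relation between
  -- the coordinates, which must be trivial.
  choose c hc using fun i ↦ constSection_surjective (φ.app ⊤ (eulerSection i))
  have h := congrArg (φ.app (chart 0)) (comb_eulerSection_ratio 0)
  rw [app_comb, map_zero] at h
  simp only [← hc] at h
  have h2 := congrArg (chartCoord (0 : ℕ) 0) h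
  simp only [comb, map_sum, chartCoord_smul, chartCoord_constSection, map_zero] at h2
  have h3 : ∑ i, const (Fin 2) (chart 0) (c i) * ratio 0 i = 0 := by
    have := congrArg (res (le_inf le_rfl le_rfl : chart (0 : Fin 2) ≤ chart 0 ⊓ chart 0)) h2
    rw [map_sum, map_zero] at this
    rw [← this]
    refine Finset.sum_congr rfl fun i _ ↦ ?_
    rw [map_mul, res_const, res_res, res_self, mul_comm]
  rw [← hc, eq_zero_of_sum_const_mul_ratio 0 h3, Pi.zero_apply, map_zero]
  rfl

/-! ## Coefficient vectors and dimensions -/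

section coeffs

variable {n d k : ℕ}

theorem card_exponent : Fintype.card (Exponent n k) = (k + n).choose n := by
  rw [Fintype.card_coe, Finset.card_finsuppAntidiag_nat_eq_choose, Finset.card_univ,
    Fintype.card_fin, add_right_comm, Nat.add_sub_cancel, add_comm n k, Nat.choose_symm_add]

/-- For `k < d` both sides vanish; positivity of `n` ensures `k + n - d < n` even where the
subtraction truncates. -/
theorem card_cofactor (hn : 0 < n) : Fintype.card (Cofactor n d k) = verlindeDegree n d k := by
  rcases lt_or_ge k d with hk | hk
  · have : IsEmpty (Cofactor n d k) :=
      ⟨fun θ ↦ by have := θ.2; omega⟩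
    rw [Fintype.card_eq_zero, verlindeDegree, Nat.choose_eq_zero_of_lt (by omega)]
  · have e : Cofactor n d k ≃ Exponent n (k - d) := Equiv.subtypeEquivRight fun θ ↦ by
      rw [Finset.mem_finsuppAntidiag, Finsupp.degree_eq_sum]
      constructor
      · exact fun h ↦ ⟨Nat.eq_sub_of_add_eq h, by simp⟩
      · exact fun h ↦ by have : ∑ i, θ i = k - d := h.1; omega
    rw [Fintype.card_congr e, card_exponent, verlindeDegree, Nat.sub_add_comm hk]

theorem verlindeRank_add_verlindeDegree :
    verlindeRank n d k + verlindeDegree n d k = Fintype.card (Exponent n k) := by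
  rw [card_exponent, verlindeRank, verlindeDegree, Nat.sub_add_cancel]
  exact Nat.choose_le_choose n (Nat.sub_le _ _)

/-- The coefficients of `f i * x ^ θ`. -/
def productVector (f : Fin 2 → MvPolynomial (Fin (n + 1)) ℂ) (p : Fin 2 × Cofactor n d k) :
    Exponent n k → ℂ :=
  coeffs (f p.1 * MvPolynomial.monomial p.2.1 1)

variable (n k) in
/-- The coefficients of the monomials of degree `k` as a linear map. -/
def coeffsLinear : MvPolynomial (Fin (n + 1)) ℂ →ₗ[ℂ] Exponent n k → ℂ :=
  LinearMap.pi fun b ↦ MvPolynomial.lcoeff ℂ b.1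

theorem mem_exponent_of_degree {b : Fin (n + 1) →₀ ℕ} (hb : b.degree = k) :
    b ∈ Finset.finsuppAntidiag (Finset.univ : Finset (Fin (n + 1))) k := by
  rw [Finsupp.degree_eq_sum] at hb
  simp [Finset.mem_finsuppAntidiag, hb]

theorem coeffsLinear_injOn :
    Set.InjOn (coeffsLinear n k) (MvPolynomial.homogeneousSubmodule (Fin (n + 1)) ℂ k) := by
  intro p hp q hq h
  refine MvPolynomial.ext _ _ fun b ↦ ?_
  by_cases hb : b.degree = k
  · exact congrFun h ⟨b, mem_exponent_of_degree hb⟩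
  · rw [MvPolynomial.IsHomogeneous.coeff_eq_zero hp hb,
      MvPolynomial.IsHomogeneous.coeff_eq_zero hq hb]

variable {f : Fin 2 → MvPolynomial (Fin (n + 1)) ℂ}

theorem isHomogeneous_mul_monomial (hf : ∀ i, (f i).IsHomogeneous d)
    (p : Fin 2 × Cofactor n d k) :
    (f p.1 * MvPolynomial.monomial p.2.1 1).IsHomogeneous k := by
  have h := (hf p.1).mul (MvPolynomial.isHomogeneous_monomial (1 : ℂ) (d := p.2.1) rfl)
  rwa [add_comm d, p.2.2] at h

/-- Coefficient vectors determine forms of degree `k`, and the span of the products consists of such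
forms. -/
theorem linearIndependent_productVector_iff (hf : ∀ i, (f i).IsHomogeneous d) :
    LinearIndependent ℂ (fun p : Fin 2 × Cofactor n d k ↦ productVector f p) ↔
      LinearIndependent ℂ (fun p : Fin 2 × Cofactor n d k ↦
        f p.1 * MvPolynomial.monomial p.2.1 (1 : ℂ)) := by
  refine LinearMap.linearIndependent_iff_of_injOn (coeffsLinear n k)
    (coeffsLinear_injOn.mono (Submodule.span_le.mpr ?_))
  rintro _ ⟨p, rfl⟩
  exact isHomogeneous_mul_monomial hf p

/-- Only the monomials `θ + I` occur in `f i * x ^ θ`, each for one `I`, with the coefficient of `f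
i` at `I`. -/
theorem sum_productVector_smul (hf : ∀ i, (f i).IsHomogeneous d) {R M : Type*}
    [Semiring R] [AddCommMonoid M] [Module R M]
    (κ : ℂ →+* R) (ν : Exponent n k → M) (i : Fin 2) (θ : Cofactor n d k) :
    ∑ b, κ (productVector f (i, θ) b) • ν b =
      ∑ I : Exponent n d, κ (coeffs (f i) I) • ν (mulExponent θ I) := by
  have hinj : Function.Injective (mulExponent (n := n) (d := d) θ) := fun I J h ↦
    Subtype.ext (add_left_cancel (Subtype.mk.inj h))
  have h1 (I : Exponent n d) : productVector f (i, θ) (mulExponent θ I) = coeffs (f i) I := by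
    have h : (mulExponent θ I).1 = I.1 + θ.1 := add_comm _ _
    rw [productVector, coeffs, h, MvPolynomial.coeff_mul_monomial, mul_one]
    rfl
  simp only [← h1]
  refine (Finset.sum_subset (Finset.subset_univ (Finset.univ.map ⟨_, hinj⟩))
    fun b _ hb ↦ ?_).symm.trans (Finset.sum_map ..)
  suffices h : productVector f (i, θ) b = 0 by rw [h, map_zero, zero_smul]
  rw [productVector, coeffs, MvPolynomial.coeff_mul_monomial']
  split_ifs with h
  · rw [mul_one]
    by_contra hne
    refine hb (Finset.mem_map.mpr ⟨⟨b.1 - θ.1, mem_exponent_of_degree ?_⟩, Finset.mem_univ _,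
      Subtype.ext (add_tsub_cancel_of_le h)⟩)
    by_contra hdeg
    exact hne ((hf i).coeff_eq_zero hdeg)
  · rfl

end coeffs

theorem sumExtend_inl {K V ι : Type*} [DivisionRing K] [AddCommGroup V] [Module K V] {v : ι → V}
    (h : LinearIndependent K v) (i : ι) : Module.Basis.sumExtend h (Sum.inl i) = v i := by
  simp only [Module.Basis.sumExtend, Module.Basis.reindex_apply, Module.Basis.extend_apply_self]
  rfl

/-- Rank and nullity for the matrix with rows `v`, together with the equality of row rank and column
rank. -/
theorem linearIndependent_of_finrank_ker {K ι β : Type*} [Field K] [Fintype ι] [Fintype β]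
    (v : ι → β → K) (h : Module.finrank K (LinearMap.ker (Matrix.of v).mulVecLin) +
      Fintype.card ι ≤ Fintype.card β) : LinearIndependent K v := by
  rw [linearIndependent_iff_card_le_finrank_span]
  have h1 := (Matrix.of v).mulVecLin.finrank_range_add_finrank_ker
  rw [Module.finrank_fintype_fun_eq_card] at h1
  have h2 := (Matrix.of v).rank_eq_finrank_span_row
  change Module.finrank K _ = Module.finrank K (Submodule.span K (Set.range v)) at h2
  rw [Set.finrank, ← h2]
  omega

/-! ## Splitting types -/

section splitting

variable {A C : Type}

variable (A C) in
/-- The summands of the sheaf `𝒪(1) ^ A ⊕ 𝒪 ^ C`. -/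
def summand : A ⊕ C → (PP (Fin 2)).Modules :=
  Sum.elim (fun _ ↦ OO (Fin 2) (1 : ℕ)) fun _ ↦ OO (Fin 2) (0 : ℕ)

/-- Reindexing lets the copies of `𝒪(1)` be labelled by the monomials `θ` and the copies of `𝒪` by
any set of the right size. -/
theorem hasSplittingType_genericType_iff [Fintype A] [Fintype C] {r δ : ℕ} (hA : Fintype.card A = δ)
    (hC : Fintype.card C + δ = r) (M : (PP (Fin 2)).Modules) :
    HasSplittingType M (genericType r δ) ↔ Nonempty (M ≅ ⨁ summand A C) := by
  have hanti : Antitone (genericType r δ) := by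
    intro i j hij
    have : (i : ℕ) ≤ j := hij
    simp only [genericType]
    split_ifs <;> omega
  let eA : Fin δ ≃ A := (Fintype.equivFinOfCardEq hA).symm
  let eC : Fin (Fintype.card C) ≃ C := (Fintype.equivFin C).symm
  let e : Fin δ ⊕ Fin (Fintype.card C) ≃ Fin r :=
    finSumFinEquiv.trans (finCongr (by omega))
  have w : ∀ j, summand A C ((e.symm.trans (eA.sumCongr eC)) j) =
      OO (Fin 2) (genericType r δ j) := by
    intro j
    obtain ⟨j, rfl⟩ := e.surjective j
    rw [Equiv.trans_apply, Equiv.symm_apply_apply]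
    rcases j with j | j
    · have : genericType r δ (e (Sum.inl j)) = ((1 : ℕ) : ℤ) := if_pos j.2
      rw [this]
      rfl
    · have : genericType r δ (e (Sum.inr j)) = ((0 : ℕ) : ℤ) :=
        if_neg (Nat.not_lt.mpr (Nat.le_add_right δ j))
      rw [this]
      rfl
  have E := biproduct.whiskerEquiv (f := fun i ↦ OO (Fin 2) (genericType r δ i))
    (g := summand A C) (e.symm.trans (eA.sumCongr eC)) fun j ↦ eqToIso (w j)
  exact ⟨fun h ↦ h.2.map (· ≪≫ E), fun h ↦ ⟨hanti, h.map (· ≪≫ E.symm)⟩⟩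

end splitting

/-! ## Global sections as complex vector spaces -/

section sectionMap

/-- The global sections of a sheaf of modules on the projective line form a complex vector space. -/
abbrev constModule (N : (PP (Fin 2)).Modules) : Module ℂ Γ(N, ⊤) :=
  Module.compHom Γ(N, ⊤) (const (Fin 2) ⊤)

attribute [local instance] constModule

variable {N N' : (PP (Fin 2)).Modules}

theorem app_smul_const (φ : N ⟶ N') (c : ℂ) (s : Γ(N, ⊤)) : φ.app ⊤ (c • s) = c • φ.app ⊤ s :=
  Scheme.Modules.Hom.app_smul φ (const (Fin 2) ⊤ c) s

/-- The action of a homomorphism on global sections. -/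
def globalMap (φ : N ⟶ N') : Γ(N, ⊤) →ₗ[ℂ] Γ(N', ⊤) where
  toFun := φ.app ⊤
  map_add' := map_add _
  map_smul' := app_smul_const φ

theorem globalMap_apply (φ : N ⟶ N') (s : Γ(N, ⊤)) : globalMap φ s = φ.app ⊤ s := rfl

theorem globalMap_comp {N'' : (PP (Fin 2)).Modules} (φ : N ⟶ N') (ψ : N' ⟶ N'') (s : Γ(N, ⊤)) :
    globalMap (φ ≫ ψ) s = globalMap ψ (globalMap φ s) := rfl

/-- Global sections of `𝒪(0)` are complex numbers. -/
def constValue : Γ(OO (Fin 2) (0 : ℕ), ⊤) ≃ₗ[ℂ] ℂ :=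
  { (constEquiv (Fin 2)).symm with map_smul' := constEquiv_symm_smul }

variable {n d k : ℕ} {f : Fin 2 → MvPolynomial (Fin (n + 1)) ℂ}

theorem productSection_eq (hf : ∀ i, (f i).IsHomogeneous d) (ν : Exponent n k → Γ(N, ⊤))
    (θ : Cofactor n d k) (i : Fin 2) :
    productSection f ν θ i = Fintype.linearCombination ℂ ν (productVector f (i, θ)) := by
  refine Eq.trans ?_ (sum_productVector_smul hf (const (Fin 2) ⊤) ν i θ).symm
  simp only [productSection, comb, mres_self]

theorem globalMap_linearCombination (φ : N ⟶ N') (ν : Exponent n k → Γ(N, ⊤))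
    (x : Exponent n k → ℂ) : globalMap φ (Fintype.linearCombination ℂ ν x) =
      Fintype.linearCombination ℂ (fun b ↦ globalMap φ (ν b)) x := by
  simp only [Fintype.linearCombination_apply, map_sum, map_smul]

variable (hf : ∀ i, (f i).IsHomogeneous d) (hli : LinearIndependent ℂ f)

/-- In the basis `β` the relations on the line involve only the pairs `f₁θ, f₂θ`, and for each `θ`
they are the Euler relation. Both sides have universal properties, which give maps in both
directions; these are mutually inverse on generators. -/
theorem nonempty_iso_of_linearIndependent (hn : 1 < n) {C : Type} [Finite C]
    (β : Module.Basis ((Fin 2 × Cofactor n d k) ⊕ C) ℂ (Exponent n k → ℂ))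
    (hβ : ∀ p, β (Sum.inl p) = productVector f p) :
    Nonempty (verlindeOnLine k hf hli ≅ ⨁ summand (Cofactor n d k) C) := by
  classical
  let S := ⨁ summand (Cofactor n d k) C
  let ιA (θ : Cofactor n d k) : OO (Fin 2) (1 : ℕ) ⟶ S :=
    biproduct.ι (summand (Cofactor n d k) C) (Sum.inl θ)
  let ιC (c : C) : OO (Fin 2) (0 : ℕ) ⟶ S :=
    biproduct.ι (summand (Cofactor n d k) C) (Sum.inr c)
  let w : (Fin 2 × Cofactor n d k) ⊕ C → Γ(S, ⊤) :=
    Sum.elim (fun p ↦ globalMap (ιA p.2) (eulerSection p.1))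
      fun c ↦ globalMap (ιC c) (oneSection (Fin 2))
  let T : (Exponent n k → ℂ) →ₗ[ℂ] Γ(S, ⊤) := β.constr ℂ w
  have hT (κ) : T (β κ) = w κ := β.constr_basis ℂ w κ
  have hT' (x : Exponent n k → ℂ) :
      Fintype.linearCombination ℂ (fun b ↦ T (Pi.single b 1)) x = T x := by
    rw [Fintype.linearCombination_apply]
    simp only [← map_smul, ← map_sum]
    congr 1
    exact (pi_eq_sum_univ' x).symm
  obtain ⟨φ, hφ⟩ := exists_hom_of_satisfiesLineRelations hf hli hn (fun b ↦ T (Pi.single b 1)) (by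
    intro θ j
    have h : productSection f (fun b ↦ T (Pi.single b 1)) θ =
        fun i ↦ (ιA θ).app ⊤ (eulerSection i) := by
      funext i
      rw [productSection_eq hf, hT', ← hβ, hT]
      rfl
    rw [h, ← app_comb, comb_eulerSection_ratio, map_zero])
  let L : (Exponent n k → ℂ) →ₗ[ℂ] Γ(verlindeOnLine k hf hli, ⊤) :=
    Fintype.linearCombination ℂ (lineSection hf hli)
  -- The inverse sends the Euler sections of the summand `θ` to `f₁θ, f₂θ`, and the generators of
  -- the trivial summands to the remaining basis vectors.
  choose ψA hψA using fun θ : Cofactor n d k ↦ exists_hom_OO_one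
    (productSection f (lineSection hf hli) θ) (lineSection_satisfiesLineRelations hf hli θ)
  choose ψC hψC using fun c : C ↦ exists_hom_OO_zero (L (β (Sum.inr c)))
  let ψ : S ⟶ verlindeOnLine k hf hli := biproduct.desc fun
    | Sum.inl θ => ψA θ
    | Sum.inr c => ψC c
  have hψιA (θ) : ιA θ ≫ ψ = ψA θ := biproduct.ι_desc _ (Sum.inl θ)
  have hψιC (c) : ιC c ≫ ψ = ψC c := biproduct.ι_desc _ (Sum.inr c)
  have hψw (κ) : globalMap ψ (w κ) = L (β κ) := by
    rcases κ with ⟨i, θ⟩ | c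
    · refine (globalMap_comp (ιA θ) ψ (eulerSection i)).symm.trans ?_
      rw [hψιA, globalMap_apply, hψA, productSection_eq hf, ← hβ]
    · refine (globalMap_comp (ιC c) ψ (oneSection (Fin 2))).symm.trans ?_
      rw [hψιC, globalMap_apply, hψC]
  have hψT : globalMap ψ ∘ₗ T = L := β.ext fun κ ↦ by
    rw [LinearMap.comp_apply, hT, hψw]
  have hφL (x) : globalMap φ (L x) = T x := by
    rw [globalMap_linearCombination]
    simp only [globalMap_apply, hφ, hT']
  refine ⟨φ, ψ, ?_, ?_⟩
  · refine lineSection_hom_ext hf hli hn fun b ↦ ?_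
    change globalMap ψ (φ.app ⊤ (lineSection hf hli b)) = lineSection hf hli b
    rw [hφ, ← LinearMap.comp_apply, hψT, Fintype.linearCombination_apply_single, one_smul]
  · refine biproduct.hom_ext' _ _ fun κ ↦ ?_
    rw [Category.comp_id]
    rcases κ with θ | c
    · refine generates_eulerSection.hom_ext fun i ↦ ?_
      change globalMap φ (globalMap ψ (w (Sum.inl (i, θ)))) = w (Sum.inl (i, θ))
      rw [hψw, hφL, hT]
    · refine generates_oneSection.hom_ext fun _ ↦ ?_
      change globalMap φ (globalMap ψ (w (Sum.inr c))) = w (Sum.inr c)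
      rw [hψw, hφL, hT]

/-- Scalars act on homomorphisms into `𝒪` by composition with these endomorphisms. -/
theorem exists_hom_OO_zero_smul (a : ℂ) : ∃ φ : OO (Fin 2) (0 : ℕ) ⟶ OO (Fin 2) (0 : ℕ),
    ∀ s, globalMap φ s = a • s := by
  obtain ⟨φ, hφ⟩ := exists_hom_OO_zero (a • oneSection (Fin 2))
  refine ⟨φ, fun s ↦ ?_⟩
  obtain ⟨c, rfl⟩ := constSection_surjective s
  have h : constSection (Fin 2) c = c • oneSection (Fin 2) := rfl
  rw [h, map_smul, globalMap_apply, hφ, smul_comm]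

/-- The kernel consists of the functionals on forms of degree `k` that vanish on all products. It
embeds in `Hom(V_{k,T}, 𝒪)`, and a homomorphism from the direct sum to `𝒪` is determined by one
constant for each trivial summand. -/
theorem finrank_ker_le_of_iso (hn : 1 < n) {A C : Type} [Finite A] [Fintype C]
    (e : verlindeOnLine k hf hli ≅ ⨁ summand A C) :
    Module.finrank ℂ (LinearMap.ker (Matrix.of fun p : Fin 2 × Cofactor n d k ↦
      productVector f p).mulVecLin) ≤ Fintype.card C := by
  classical
  set K := LinearMap.ker (Matrix.of fun p : Fin 2 × Cofactor n d k ↦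
      productVector f p).mulVecLin with hK
  -- The monomial `b` goes to the constant `x b`. The line relations hold because each product goes
  -- to zero.
  have hφ (x : K) : ∃ φ : verlindeOnLine k hf hli ⟶ OO (Fin 2) (0 : ℕ),
      ∀ b, φ.app ⊤ (lineSection hf hli b) = x.1 b • oneSection (Fin 2) := by
    refine exists_hom_of_satisfiesLineRelations hf hli hn _ fun θ j ↦ ?_
    have h : productSection f (fun b ↦ x.1 b • oneSection (Fin 2)) θ = fun i ↦ 0 := by
      funext i
      have hx : ∑ b, productVector f (i, θ) b * x.1 b = 0 := congrFun x.2 (i, θ)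
      rw [productSection_eq hf, Fintype.linearCombination_apply]
      simp only [smul_smul, ← Finset.sum_smul]
      rw [hx, zero_smul]
    rw [h]
    simp [comb]
  choose φ hφ using hφ
  have hadd (x y : K) : φ (x + y) = φ x + φ y := lineSection_hom_ext hf hli hn fun b ↦ by
    change _ = (φ x).app ⊤ _ + (φ y).app ⊤ _
    rw [hφ, hφ, hφ, ← add_smul]
    rfl
  have hsmul (a : ℂ) (x : K) (s) : globalMap (φ (a • x)) s = a • globalMap (φ x) s := by
    obtain ⟨μ, hμ⟩ := exists_hom_OO_zero_smul a
    have : φ (a • x) = φ x ≫ μ := lineSection_hom_ext hf hli hn fun b ↦ by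
      change _ = globalMap μ ((φ x).app ⊤ _)
      rw [hφ, hφ, hμ, smul_smul]
      rfl
    rw [this, globalMap_comp, hμ]
  let ιC (c : C) : OO (Fin 2) (0 : ℕ) ⟶ ⨁ summand A C := biproduct.ι (summand A C) (Sum.inr c)
  let w (c : C) : Γ(verlindeOnLine k hf hli, ⊤) :=
    globalMap (ιC c ≫ e.inv) (oneSection (Fin 2))
  let Ψ : K →ₗ[ℂ] C → ℂ :=
    { toFun x c := constValue (globalMap (φ x) (w c))
      map_add' x y := funext fun c ↦ by
        rw [hadd, Pi.add_apply, ← map_add]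
        rfl
      map_smul' a x := funext fun c ↦ by
        rw [hsmul, map_smul]
        rfl }
  have hΨ : Function.Injective Ψ := by
    rw [injective_iff_map_eq_zero]
    intro x hx
    -- On the summands `𝒪(1)` there is nothing to check, and on the summands `𝒪` the value at `1` is
    -- recorded by `Ψ`.
    have h1 : e.inv ≫ φ x = 0 := by
      refine biproduct.hom_ext' _ _ fun κ ↦ ?_
      rw [comp_zero]
      rcases κ with θ | c
      · exact hom_OO_one_OO_zero _
      · refine generates_oneSection.hom_ext fun _ ↦ ?_
        have h := congrFun hx c
        exact constValue.map_eq_zero_iff.mp h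
    have h2 : φ x = 0 := by
      rw [← cancel_epi e.inv, h1, comp_zero]
    refine Subtype.ext (funext fun b ↦ constSection_injective (σ := Fin 2) ?_)
    have h3 := hφ x b
    rw [h2] at h3
    exact h3.symm.trans (map_zero (constSection (Fin 2))).symm
  have := LinearMap.finrank_le_finrank_of_injective hΨ
  rwa [Module.finrank_fintype_fun_eq_card] at this

end sectionMap

end Verlinde

end

/-! ### The criterion for the generic splitting type. -/

theorem corollary2p3 (n d k : ℕ) (hn : 1 < n) (hk : 1 ≤ k)
    (f : Fin 2 → MvPolynomial (Fin (n + 1)) ℂ) (hf : ∀ i, (f i).IsHomogeneous d)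
    (hli : LinearIndependent ℂ f)
    (hdr : Verlinde.verlindeDegree n d k ≤ Verlinde.verlindeRank n d k) :
    Verlinde.HasSplittingType (Verlinde.verlindeOnLine k hf hli)
        (Verlinde.genericType (Verlinde.verlindeRank n d k) (Verlinde.verlindeDegree n d k)) ↔
      LinearIndependent ℂ
        (fun p : Fin 2 × {θ : Fin (n + 1) →₀ ℕ // θ.degree + d = k} ↦
          f p.1 * MvPolynomial.monomial p.2.1 (1 : ℂ)) := by
  have hcard : Fintype.card (Verlinde.Cofactor n d k) = Verlinde.verlindeDegree n d k :=
    Verlinde.card_cofactor (by omega)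
  have hsum := Verlinde.verlindeRank_add_verlindeDegree (n := n) (d := d) (k := k)
  refine Iff.trans ?_ (Verlinde.linearIndependent_productVector_iff hf)
  constructor
  · intro h
    have hC : Fintype.card (Fin (Verlinde.verlindeRank n d k - Verlinde.verlindeDegree n d k)) +
        Verlinde.verlindeDegree n d k = Verlinde.verlindeRank n d k := by
      rw [Fintype.card_fin, Nat.sub_add_cancel hdr]
    obtain ⟨e⟩ := (Verlinde.hasSplittingType_genericType_iff hcard hC _).mp h
    -- The kernel has dimension at most `r - d`, and `(r - d) + 2d = r + d` is the number of
    -- monomials of degree `k`.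
    refine Verlinde.linearIndependent_of_finrank_ker _ ?_
    have := Verlinde.finrank_ker_le_of_iso hf hli hn e
    rw [Fintype.card_prod, Fintype.card_fin, hcard]
    omega
  · intro h
    let β := Module.Basis.sumExtend h
    have : Finite (Module.Basis.sumExtendIndex h) :=
      have := Module.Finite.finite_basis β
      Finite.sum_right (Fin 2 × Verlinde.Cofactor n d k)
    have : Fintype (Module.Basis.sumExtendIndex h) := Fintype.ofFinite _
    -- Counting the basis gives `r + d = 2d + |C|`, so there are `r - d` additional vectors, as many
    -- as trivial summands are needed.
    have hC := Module.finrank_eq_card_basis β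
    rw [Module.finrank_fintype_fun_eq_card, Fintype.card_sum, Fintype.card_prod, Fintype.card_fin,
      hcard] at hC
    refine (Verlinde.hasSplittingType_genericType_iff hcard
      (C := Module.Basis.sumExtendIndex h) (by omega) _).mpr ?_
    exact Verlinde.nonempty_iso_of_linearIndependent hf hli hn β fun p ↦
      Verlinde.sumExtend_inl h p
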